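/- **Setting.** There are $m$ arms, $d\ge 1$ resources and a horizon $T\ge 1$; each resource has budget $B=bT$ with $b>0$. At period $t$ a vector of rewards $r_{t,i}\in[0,1]$ and consumptions $c_{t,j,i}\in[0,1]$ ($i\le m$, $j\le d$) is drawn from a law $\mathcal P_t$, independently over time; the sequence $(\mathcal P_t)$ is arbitrary. One of the arms (the null arm) has zero reward and zero consumption. Let $\mu_t=\mathbb E[r_t]$, $C_t=\mathbb E[c_t]$, $\bar\mu=\frac1T\sum_{t=1}^T\mu_t$, $\bar C=\frac1T\sum_{t=1}^T C_t$, and $$V_1=\sum_{t=1}^{T-1}\|\mu_t-\mu_{t+1}\|_\infty,\quad V_2=\max_{j}\sum_{t=1}^{T-1}\|C_{t,j}-C_{t+1,j}\|_\infty,\quad W_1=\sum_{t=1}^T\|\mu_t-\bar\mu\|_\infty,\quad W_2=\sum_{t=1}^T\|C_t-\bar C\|_1,$$ where $C_{t,j}$ is the $j$-th row of $C_t$ and $\|M\|_1=\max_i\sum_j|M_{ji}|$. With $\Delta_m$ the standard simplex, let $$\mathrm{LP}_T=\max\Big\{\sum_{t=1}^T\mu_t^\top x_t:\ \sum_{t=1}^T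 C_tx_t\le B\mathbf 1,\ x_t\in\Delta_m\Big\},\qquad \mathrm{LP}(\mu,C)=\max\{\mu^\top x:\ Cx\le b\mathbf 1,\ x\in\Delta_m\}.$$ Let $(q^*,\alpha^*)$ be any optimal solution of the dual of $\mathrm{LP}_T$, i.e. of $\min\{Tb\sum_jq_j+\sum_t\alpha_t:\ \mu_t\le C_t^\top q+\alpha_t\mathbf 1\ (t\le T),\ q\ge0\}$, let $(q_t^*,\alpha_t^*)$ be any optimal solution of the dual of $\mathrm{LP}(\mu_t,C_t)$, i.e. of $\min\{b\sum_jq_j+\alpha:\ \mu_t\le C_t^\top q+\alpha\mathbf 1,\ q\ge0\}$, and let $\bar q=\max\{\|q^*\|_\infty,\|q_1^*\|_\infty,\dots,\|q_T^*\|_\infty\}$. **Algorithm.** Put $L_1=\log(12mT^3)$, $L_2=\log(12mdT^3)$ and $w_k=\min\{\lceil m^{1/3}V_k^{-2/3}T^{2/3}L_k^{1/3}\rceil,T\}$ (so $w_k=T$ if $V_k=0$). At each $t\le T$ the algorithm stops if some resource satisfies $\sum_{s<t}c_{s,j,i_s}>B$. Otherwise, with $n^{(w)}_{t,i}$ the number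 of plays of arm $i$ in the periods $s$ with $\max(1,t-w)\le s\le t-1$, it forms $$\mathrm{UCB}_{t,i}=\frac{\sum_{s=\max(1,t-w_1)}^{t-1}r_{s,i}\mathbf 1\{i_s=i\}}{n^{(w_1)}_{t,i}+1}+\sqrt{\frac{2L_1}{n^{(w_1)}_{t,i}+1}},\qquad \mathrm{LCB}_{t,j,i}=\frac{\sum_{s=\max(1,t-w_2)}^{t-1}c_{s,j,i}\mathbf 1\{i_s=i\}}{n^{(w_2)}_{t,i}+1}-\sqrt{\frac{2L_2}{n^{(w_2)}_{t,i}+1}},$$ takes any optimal solution $x_t^*$ of $\mathrm{LP}(\mathrm{UCB}_t,\mathrm{LCB}_t)$, and draws the arm $i_t$ from $x_t^*$. Let $\tau$ be the first $t\le T$ with $\sum_{s\le t}c_{s,j,i_s}>B$ for some $j$, and $\tau=T+1$ if there is none. The regret against the dynamic LP benchmark is $\mathrm{Reg}=\mathrm{LP}_T-\mathbb E\big[\sum_{t=1}^{\tau-1}r_{t,i_t}\big]$. **Theorem.** Let $$R=\frac1b\Big(4\sqrt T\,L_2+(14+2d)\,m^{1/3}V_2^{1/3}T^{2/3}L_2^{1/3}+8\sqrt{2mT}\sqrt{L_2}+1\Big)+4\sqrt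 T\,L_1+16\,m^{1/3}V_1^{1/3}T^{2/3}L_1^{1/3}+2(W_1+\bar qW_2).$$ 1. If $b\le 1$, then $\mathrm{Reg}\le R$. 2. For every $b>0$, $\mathrm{Reg}\le R+8\sqrt{2mT}\sqrt{L_1}$. 3. There is a universal constant $K$ such that for every $b>0$ $$\mathrm{Reg}\le K\,L_2\Big(\max\{1,\tfrac1b\}\sqrt{mT}+m^{1/3}V_1^{1/3}T^{2/3}+\tfrac1b\,m^{1/3}d\,V_2^{1/3}T^{2/3}+W_1+\bar qW_2\Big);$$ in particular, for $b\le1$, $\mathrm{Reg}=\tilde O\big(\tfrac1b\sqrt{mT}+m^{1/3}V_1^{1/3}T^{2/3}+\tfrac1b m^{1/3}dV_2^{1/3}T^{2/3}+W_1+\bar qW_2\big)$. -/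

import Mathlib

open MeasureTheory ProbabilityTheory

namespace BwK

noncomputable section

/-! ### Environment -/

/-- One period's outcome: a reward `r i` for each arm `i`, and a consumption `c j i` of each
resource `j` by each arm `i`. -/
abbrev Outcome (m d : ℕ) : Type := (Fin m → ℝ) × (Fin d → Fin m → ℝ)

/-- A (possibly non-stationary) environment with `m` arms, one of which is the null arm, and `d`
resources: the laws of the outcomes at the periods `1, 2, …`. Only the periods `1, …, T` matter. -/
structure Env (m d : ℕ) where
  law : ℕ → Measure (Outcome m d)
  isProb : ∀ t, IsProbabilityMeasure (law t)
  reward_mem : ∀ t, ∀ᵐ y ∂(law t), ∀ i, y.1 i ∈ Set.Icc (0 : ℝ) 1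
  consumption_mem : ∀ t, ∀ᵐ y ∂(law t), ∀ j i, y.2 j i ∈ Set.Icc (0 : ℝ) 1
  null : Fin m
  null_reward : ∀ t, ∀ᵐ y ∂(law t), y.1 null = 0
  null_consumption : ∀ t, ∀ᵐ y ∂(law t), ∀ j, y.2 j null = 0

/-- Expected reward vector of period `t`. -/
def Env.mu {m d : ℕ} (E : Env m d) (t : ℕ) : Fin m → ℝ := fun i => ∫ y, y.1 i ∂(E.law t)

/-- Expected consumption matrix of period `t` (rows are resources, columns are arms). -/
def Env.C {m d : ℕ} (E : Env m d) (t : ℕ) : Fin d → Fin m → ℝ :=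
  fun j i => ∫ y, y.2 j i ∂(E.law t)

/-! ### Non-stationarity measures

The norm of `Fin n → ℝ` is the maximum norm. -/

/-- Local non-stationarity of the rewards. -/
def V1 {m : ℕ} (mu : ℕ → Fin m → ℝ) (T : ℕ) : ℝ := ∑ t ∈ Finset.Ico 1 T, ‖mu t - mu (t + 1)‖

/-- Local non-stationarity of the consumption: the maximum over the resources. -/
def V2 {m d : ℕ} (C : ℕ → Fin d → Fin m → ℝ) (T : ℕ) : ℝ :=
  ⨆ j : Fin d, ∑ t ∈ Finset.Ico 1 T, ‖C t j - C (t + 1) j‖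

/-- The `L₁` operator norm of a matrix: the maximal absolute column sum. -/
def matL1 {m d : ℕ} (M : Fin d → Fin m → ℝ) : ℝ := ⨆ i : Fin m, ∑ j : Fin d, |M j i|

/-- Global non-stationarity of the rewards. -/
def W1 {m : ℕ} (mu : ℕ → Fin m → ℝ) (T : ℕ) : ℝ :=
  ∑ t ∈ Finset.Icc 1 T, ‖mu t - (T : ℝ)⁻¹ • ∑ s ∈ Finset.Icc 1 T, mu s‖

/-- Global non-stationarity of the consumption. -/
def W2 {m d : ℕ} (C : ℕ → Fin d → Fin m → ℝ) (T : ℕ) : ℝ :=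
  ∑ t ∈ Finset.Icc 1 T, matL1 (C t - (T : ℝ)⁻¹ • ∑ s ∈ Finset.Icc 1 T, C s)

/-! ### Linear programs and their duals -/

/-- Feasibility in the benchmark program over the whole horizon, with budget `B` per resource. -/
def DynFeasible {m d : ℕ} (C : ℕ → Fin d → Fin m → ℝ) (T : ℕ) (B : ℝ) (x : ℕ → Fin m → ℝ) :
    Prop :=
  (∀ t ∈ Finset.Icc 1 T, x t ∈ stdSimplex ℝ (Fin m)) ∧
    ∀ j, ∑ t ∈ Finset.Icc 1 T, ∑ i, C t j i * x t i ≤ B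

/-- Optimal value of the benchmark program over the whole horizon. -/
def dynLP {m d : ℕ} (mu : ℕ → Fin m → ℝ) (C : ℕ → Fin d → Fin m → ℝ) (T : ℕ) (B : ℝ) : ℝ :=
  sSup {v | ∃ x, DynFeasible C T B x ∧ v = ∑ t ∈ Finset.Icc 1 T, ∑ i, mu t i * x t i}

/-- Feasibility in the single-step program with right-hand side `b`. -/
def StepFeasible {m d : ℕ} (C : Fin d → Fin m → ℝ) (b : ℝ) (x : Fin m → ℝ) : Prop :=
  x ∈ stdSimplex ℝ (Fin m) ∧ ∀ j, ∑ i, C j i * x i ≤ b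

/-- `x` is an optimal solution of the single-step program. -/
def StepOptimal {m d : ℕ} (mu : Fin m → ℝ) (C : Fin d → Fin m → ℝ) (b : ℝ) (x : Fin m → ℝ) :
    Prop :=
  StepFeasible C b x ∧ ∀ y, StepFeasible C b y → ∑ i, mu i * y i ≤ ∑ i, mu i * x i

/-- Feasibility in the dual of the benchmark program. -/
def DynDualFeasible {m d : ℕ} (mu : ℕ → Fin m → ℝ) (C : ℕ → Fin d → Fin m → ℝ) (T : ℕ)
    (q : Fin d → ℝ) (α : ℕ → ℝ) : Prop :=
  (∀ t ∈ Finset.Icc 1 T, ∀ i, mu t i - ∑ j, C t j i * q j - α t ≤ 0) ∧ ∀ j, 0 ≤ q j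

/-- `(q, α)` is an optimal solution of the dual of the benchmark program with budget `b * T`. -/
def DynDualOptimal {m d : ℕ} (mu : ℕ → Fin m → ℝ) (C : ℕ → Fin d → Fin m → ℝ) (T : ℕ) (b : ℝ)
    (q : Fin d → ℝ) (α : ℕ → ℝ) : Prop :=
  DynDualFeasible mu C T q α ∧ ∀ q' α', DynDualFeasible mu C T q' α' →
    T * ∑ j, b * q j + ∑ t ∈ Finset.Icc 1 T, α t
      ≤ T * ∑ j, b * q' j + ∑ t ∈ Finset.Icc 1 T, α' t

/-- Feasibility in the dual of the single-step program. -/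
def StepDualFeasible {m d : ℕ} (mu : Fin m → ℝ) (C : Fin d → Fin m → ℝ)
    (q : Fin d → ℝ) (α : ℝ) : Prop :=
  (∀ i, mu i - ∑ j, C j i * q j - α ≤ 0) ∧ ∀ j, 0 ≤ q j

/-- `(q, α)` is an optimal solution of the dual of the single-step program. -/
def StepDualOptimal {m d : ℕ} (mu : Fin m → ℝ) (C : Fin d → Fin m → ℝ) (b : ℝ)
    (q : Fin d → ℝ) (α : ℝ) : Prop :=
  StepDualFeasible mu C q α ∧ ∀ q' α', StepDualFeasible mu C q' α' →
    ∑ j, b * q j + α ≤ ∑ j, b * q' j + α'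

/-- The largest dual price `max {‖q*‖_∞, ‖q*_1‖_∞, …, ‖q*_T‖_∞}`. -/
def qbar {d : ℕ} (T : ℕ) (q : Fin d → ℝ) (qs : ℕ → Fin d → ℝ) : ℝ :=
  max ‖q‖ (((Finset.Icc 1 T).sup fun t => ‖qs t‖₊ : NNReal) : ℝ)

/-! ### The sliding-window UCB algorithm -/

/-- Number of plays of arm `i` in the last `w` periods before `t`. -/
def plays {m : ℕ} (arm : ℕ → Fin m) (w t : ℕ) (i : Fin m) : ℕ :=
  ∑ s ∈ Finset.Ico (max 1 (t - w)) t, if arm s = i then 1 else 0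

/-- Sliding-window estimator of the quantity `z s` that arm `i` generates at period `s`. -/
def estimate {m : ℕ} (arm : ℕ → Fin m) (z : ℕ → ℝ) (w t : ℕ) (i : Fin m) : ℝ :=
  (∑ s ∈ Finset.Ico (max 1 (t - w)) t, if arm s = i then z s else 0) / (plays arm w t i + 1)

/-- Upper confidence bounds of the rewards. -/
def ucb {m d : ℕ} (T w : ℕ) (y : ℕ → Outcome m d) (arm : ℕ → Fin m) (t : ℕ) (i : Fin m) : ℝ :=
  estimate arm (fun s => (y s).1 i) w t i
    + √(2 / (plays arm w t i + 1) * Real.log (12 * m * T ^ 3))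

/-- Lower confidence bounds of the consumption. -/
def lcb {m d : ℕ} (T w : ℕ) (y : ℕ → Outcome m d) (arm : ℕ → Fin m) (t : ℕ)
    (j : Fin d) (i : Fin m) : ℝ :=
  estimate arm (fun s => (y s).2 j i) w t i
    - √(2 / (plays arm w t i + 1) * Real.log (12 * m * d * T ^ 3))

/-- No resource budget has been exceeded before period `t`: the algorithm still plays at `t`. -/
def Active {m d : ℕ} (B : ℝ) (y : ℕ → Outcome m d) (arm : ℕ → Fin m) (t : ℕ) : Prop :=
  ∀ j, ∑ s ∈ Finset.Ico 1 t, (y s).2 j (arm s) ≤ B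

/-- The σ-algebra of the periods before `t`: all outcomes and all arms played. -/
@[reducible]
def past {Ω : Type*} {m d : ℕ} (y : ℕ → Ω → Outcome m d) (arm : ℕ → Ω → Fin m) (t : ℕ) :
    MeasurableSpace Ω :=
  ⨆ s ∈ Finset.Ico 1 t,
    MeasurableSpace.comap (y s) inferInstance ⊔ MeasurableSpace.comap (arm s) inferInstance

/-- The outcomes `y` and arms `arm` on the probability space `(Ω, P)` form a run, in the
environment `E`, of the sliding-window UCB algorithm with windows `w₁`, `w₂`, horizon `T` and
budget `b * T` for each resource. Nothing is asked of the arms after the budget is exceeded, as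
the algorithm has then stopped. -/
structure IsRun {Ω : Type*} [MeasurableSpace Ω] {m d : ℕ} (E : Env m d) (b : ℝ) (T w₁ w₂ : ℕ)
    (P : Measure Ω) (y : ℕ → Ω → Outcome m d) (arm : ℕ → Ω → Fin m)
    (x : ℕ → Ω → Fin m → ℝ) : Prop where
  measurable_outcome : ∀ t, Measurable (y t)
  measurable_arm : ∀ t, Measurable (arm t)
  /-- The outcome of period `t` has the law prescribed by the environment. -/
  outcome_law : ∀ t ∈ Finset.Icc 1 T, P.map (y t) = E.law t
  /-- The outcome of period `t` is independent of the past and of the choice made at `t`. -/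
  outcome_indep : ∀ t ∈ Finset.Icc 1 T,
    Indep (MeasurableSpace.comap (y t) inferInstance)
      (past y arm t ⊔ MeasurableSpace.comap (arm t) inferInstance) P
  /-- While playing, `x t` solves the single-step program of the confidence bounds. -/
  optimal : ∀ t ∈ Finset.Icc 1 T, ∀ᵐ ω ∂P, Active (b * T) (fun s => y s ω) (fun s => arm s ω) t →
    StepOptimal (ucb T w₁ (fun s => y s ω) (fun s => arm s ω) t)
      (lcb T w₂ (fun s => y s ω) (fun s => arm s ω) t) b (x t ω)
  /-- While playing, the arm is drawn from `x t`, conditionally on the past. -/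
  draw : ∀ t ∈ Finset.Icc 1 T, ∀ i, ∀ᵐ ω ∂P,
    Active (b * T) (fun s => y s ω) (fun s => arm s ω) t →
      (P[Set.indicator {ω' | arm t ω' = i} (fun _ => (1 : ℝ)) | past y arm t]) ω = x t ω i

/-- The stopping period: the first `τ ≤ T` at whose end a budget is exceeded, else `T + 1`. -/
def stopTime {m d : ℕ} (B : ℝ) (T : ℕ) (y : ℕ → Outcome m d) (arm : ℕ → Fin m) : ℕ :=
  sInf ({τ | τ ∈ Finset.Icc 1 T ∧ ∃ j, B < ∑ t ∈ Finset.Icc 1 τ, (y t).2 j (arm t)} ∪ {T + 1})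

/-- Cumulative reward collected before the stopping period. -/
def totalReward {m d : ℕ} (B : ℝ) (T : ℕ) (y : ℕ → Outcome m d) (arm : ℕ → Fin m) : ℝ :=
  ∑ t ∈ Finset.Ico 1 (stopTime B T y arm), (y t).1 (arm t)

/-- Regret against the dynamic linear-programming benchmark. -/
def regret {Ω : Type*} [MeasurableSpace Ω] {m d : ℕ} (E : Env m d) (B : ℝ) (T : ℕ)
    (P : Measure Ω) (y : ℕ → Ω → Outcome m d) (arm : ℕ → Ω → Fin m) : ℝ :=
  dynLP E.mu E.C T B - ∫ ω, totalReward B T (fun s => y s ω) (fun s => arm s ω) ∂P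

/-- The tuned window `min {⌈m^{1/3} V^{-2/3} T^{2/3} L^{1/3}⌉, T}`, which is `T` for `V = 0`. -/
def window (m T : ℕ) (V L : ℝ) : ℕ :=
  if V = 0 then T
  else min ⌈(m : ℝ) ^ (1 / 3 : ℝ) * V ^ (-(2 / 3) : ℝ) * (T : ℝ) ^ (2 / 3 : ℝ)
    * L ^ (1 / 3 : ℝ)⌉₊ T

/-- The explicit regret bound. -/
def regretBound (m d T : ℕ) (b v₁ v₂ W₁ W₂ q : ℝ) : ℝ :=
  1 / b * (4 * √T * Real.log (12 * m * d * T ^ 3)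
      + (14 + 2 * d) * (m : ℝ) ^ (1 / 3 : ℝ) * v₂ ^ (1 / 3 : ℝ) * (T : ℝ) ^ (2 / 3 : ℝ)
          * Real.log (12 * m * d * T ^ 3) ^ (1 / 3 : ℝ)
      + 8 * √(2 * m * T) * √(Real.log (12 * m * d * T ^ 3)) + 1)
    + 4 * √T * Real.log (12 * m * T ^ 3)
    + 16 * (m : ℝ) ^ (1 / 3 : ℝ) * v₁ ^ (1 / 3 : ℝ) * (T : ℝ) ^ (2 / 3 : ℝ)
        * Real.log (12 * m * T ^ 3) ^ (1 / 3 : ℝ)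
    + 2 * (W₁ + q * W₂)

end

end BwK

namespace BwK

/-! ### Linear programming -/

/-! The benchmark is first replaced by the sum of the optimal values of the single-step programs.
Average the per-period dual prices `qs s` over the horizon and use the average as one price for the
whole dynamic program. The dual constraint of period `s` transfers to period `t` with an error
measured by the distances of both periods from the time averages. Weak duality then gives
`dynLP_le`, with loss `2 * (W1 + Q * W2)`. Strong duality in each period, where the null arm is a
Slater point, identifies a dual optimum with the value of a primal optimum `xs t`
(`StepOptimal.exists_dual`).

These values are then compared with the reward along one trajectory. When every confidence interval
is valid up to drift, `xs t` shrunk towards the null arm is feasible for the optimistic program, so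
the mixture actually used is nearly as good (`StepFeasible.value_le`). Each unplayed period costs at
most `1`. There can be few of them: a resource that runs out has consumed more than `b * T`, while
the optimistic program plans at most `b` per played period, so the excess comes from drift, interval
widths and noise (`sum_value_le`).

Validity of the intervals is not treated as an event of high probability. The nonnegative variable
`failure`, a sum of exponential supermartingales over periods and possible play counts, is at least
`1` whenever an interval fails. Adding `T` times it makes the inequality hold almost surely
(`IsRun.ae_sum_value_le`), and it is then integrated. The overspending is likewise dominated by a
soft maximum with controlled exponential moments, so one supermartingale estimate,
`integral_exp_le_one`, serves both purposes.

In expectation, drawing probabilities may be replaced by the arms drawn. The widths then add up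
deterministically over blocks of one window length, to `2 * √(m * w)` per block before scaling. The
tuned window balances this against the drift `w * V` (`window_bounds`), and arithmetic with
constants finishes. -/

/-- An affine function bounded above on a ray cannot have positive slope. This fixes the signs of
the multipliers in the duality proof. -/
lemma nonpos_of_forall_add_mul_lt {a c u : ℝ} (h : ∀ K : ℝ, 0 ≤ K → a + K * c < u) : c ≤ 0 := by
  by_contra! hc
  have h1 := h (|u - a| / c) (by positivity)
  rw [div_mul_cancel₀ _ hc.ne'] at h1
  linarith [le_abs_self (u - a)]

/-- Letting `K` tend to `0` passes from the open separated set to its corner. -/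
lemma le_of_forall_add_mul_lt {a c u : ℝ} (h : ∀ K : ℝ, 0 < K → a + K * c < u) : a ≤ u := by
  by_contra! hc
  have h1 := h ((a - u) / (|c| + 1)) (by have := sub_pos.2 hc; positivity)
  have h2 : (a - u) / (|c| + 1) * c ≥ -(a - u) := by
    have h3 : 0 < |c| + 1 := by positivity
    have h4 : (a - u) / (|c| + 1) * (|c| + 1) = a - u := div_mul_cancel₀ _ h3.ne'
    have h5 : 0 < (a - u) / (|c| + 1) := div_pos (sub_pos.2 hc) h3
    nlinarith [neg_abs_le c]
  linarith

lemma linear_apply_prod {d : ℕ} (f : ℝ × (Fin d → ℝ) →L[ℝ] ℝ) (v : ℝ) (z : Fin d → ℝ) :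
    f (v, z) = v * f (1, 0) + ∑ j, z j * f (0, Pi.single j 1) := by
  have h1 : (v, z) = v • ((1 : ℝ), (0 : Fin d → ℝ))
      + ∑ j, z j • ((0 : ℝ), (Pi.single j 1 : Fin d → ℝ)) := by
    refine Prod.ext ?_ ?_
    · simp [Prod.fst_sum]
    · ext k
      simp [Prod.snd_sum, Finset.sum_apply, Pi.single_apply]
  rw [h1, map_add, map_smul, map_sum]
  simp only [map_smul, smul_eq_mul]

lemma single_stepFeasible {m d : ℕ} {C : Fin d → Fin m → ℝ} {b : ℝ} (hb : 0 ≤ b) {i₀ : Fin m}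
    (h0 : ∀ j, C j i₀ = 0) : StepFeasible C b (Pi.single i₀ 1) :=
  ⟨single_mem_stdSimplex ℝ i₀, fun j => by simp [Pi.single_apply, h0, hb]⟩

lemma exists_stepOptimal {m d : ℕ} (mu : Fin m → ℝ) (C : Fin d → Fin m → ℝ) {b : ℝ}
    (hb : 0 ≤ b) {i₀ : Fin m} (h0 : ∀ j, C j i₀ = 0) : ∃ x, StepOptimal mu C b x := by
  have hc : IsCompact {x | StepFeasible C b x} := by
    have h1 : {x | StepFeasible C b x} = stdSimplex ℝ (Fin m) ∩ {x | ∀ j, ∑ i, C j i * x i ≤ b} :=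
      rfl
    rw [h1]
    refine (isCompact_stdSimplex ℝ (Fin m)).inter_right ?_
    rw [Set.ofPred_forall]
    exact isClosed_iInter fun j => isClosed_le (by fun_prop) continuous_const
  obtain ⟨x, hx, hmax⟩ := hc.exists_isMaxOn ⟨_, single_stepFeasible hb h0⟩
    (f := fun x => ∑ i, mu i * x i) (by fun_prop)
  exact ⟨x, hx, fun y hy => hmax hy⟩

/-- Strong duality for the single-step program, whose null arm is a Slater point. -/
lemma StepOptimal.exists_dual {m d : ℕ} {mu : Fin m → ℝ} {C : Fin d → Fin m → ℝ} {b : ℝ}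
    {x : Fin m → ℝ} (hx : StepOptimal mu C b x) (hb : 0 < b) {i₀ : Fin m}
    (h0 : ∀ j, C j i₀ = 0) :
    ∃ q α, StepDualFeasible mu C q α ∧ ∑ j, b * q j + α ≤ ∑ i, mu i * x i := by
  set l := ∑ i, mu i * x i with hl
  -- Pairs of a reward above the optimum and a consumption strictly within budget. Optimality of `x`
  -- says that no mixture of arms attains such a pair, so the two convex sets can be separated.
  let U : Set (ℝ × (Fin d → ℝ)) := {p | l < p.1 ∧ ∀ j, p.2 j < b}
  let F : (Fin m → ℝ) → ℝ × (Fin d → ℝ) := fun x => (∑ i, mu i * x i, fun j => ∑ i, C j i * x i)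
  have hUo : IsOpen U := by
    have h1 : U = {p | l < p.1} ∩ ⋂ j, {p : ℝ × (Fin d → ℝ) | p.2 j < b} := by
      ext p; simp [U]
    rw [h1]
    refine (isOpen_lt continuous_const continuous_fst).inter ?_
    exact isOpen_iInter_of_finite fun j => isOpen_lt (by fun_prop) continuous_const
  have hUc : Convex ℝ U := by
    intro p hp p' hp' s t hs ht hst
    have key : ∀ {a a' : ℝ}, 0 < a → 0 < a' → 0 < s * a + t * a' := by
      intro a a' ha ha'
      rcases hs.lt_or_eq with h | h
      · have := mul_pos h ha; have := mul_nonneg ht ha'.le; linarith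
      · have : t = 1 := by linarith
        subst this; rw [← h]; simpa using ha'
    refine ⟨?_, fun j => ?_⟩
    · have := key (sub_pos.2 hp.1) (sub_pos.2 hp'.1)
      simp only [Prod.fst_add, Prod.smul_fst, smul_eq_mul]
      have : s * l + t * l = l := by rw [← add_mul, hst, one_mul]
      linarith
    · have := key (sub_pos.2 (hp.2 j)) (sub_pos.2 (hp'.2 j))
      simp only [Prod.snd_add, Prod.smul_snd, smul_eq_mul, Pi.add_apply, Pi.smul_apply]
      have : s * b + t * b = b := by rw [← add_mul, hst, one_mul]
      linarith
  have hSc : Convex ℝ (F '' stdSimplex ℝ (Fin m)) := by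
    refine (convex_stdSimplex ℝ (Fin m)).is_linear_image ⟨fun a a' => ?_, fun c a => ?_⟩
    · refine Prod.ext ?_ (funext fun j => ?_) <;> simp [F, mul_add, Finset.sum_add_distrib]
    · refine Prod.ext ?_ (funext fun j => ?_) <;> simp [F, Finset.mul_sum, mul_left_comm]
  have hdis : Disjoint U (F '' stdSimplex ℝ (Fin m)) := by
    rw [Set.disjoint_left]
    rintro _ hp ⟨z, hz, rfl⟩
    exact absurd (hx.2 z ⟨hz, fun j => (hp.2 j).le⟩) (not_le.2 hp.1)
  obtain ⟨f, u, hfU, hfS⟩ := geometric_hahn_banach_open hUc hUo hSc hdis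
  set β := f (1, 0) with hβ
  set γ : Fin d → ℝ := fun j => f (0, Pi.single j 1) with hγ
  have hf : ∀ v z, f (v, z) = v * β + ∑ j, z j * γ j := fun v z => linear_apply_prod f v z
  have hβ0 : β ≤ 0 := by
    refine nonpos_of_forall_add_mul_lt (a := (l + 1) * β + ∑ j, (b - 1) * γ j) (u := u) ?_
    intro K hK
    have := hfU (l + 1 + K, fun _ => b - 1) ⟨by dsimp; linarith, fun j => by dsimp; linarith⟩
    rw [hf] at this
    linarith
  have hγ0 : ∀ k, 0 ≤ γ k := by
    intro k
    refine neg_nonpos.1 (nonpos_of_forall_add_mul_lt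
      (a := (l + 1) * β + ∑ j, (b - 1) * γ j) (u := u) ?_)
    intro K hK
    have := hfU (l + 1, fun j => b - 1 - K * (Pi.single k 1 : Fin d → ℝ) j)
      ⟨by dsimp; linarith, fun j => by
        have : 0 ≤ (Pi.single k 1 : Fin d → ℝ) j := by
          rw [Pi.single_apply]; split_ifs <;> simp
        have := mul_nonneg hK this
        dsimp; linarith⟩
    rw [hf] at this
    simp only [sub_mul, Finset.sum_sub_distrib, Pi.single_apply, mul_ite, ite_mul, mul_one,
      mul_zero, zero_mul, Finset.sum_ite_eq', Finset.mem_univ, if_true] at this ⊢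
    linarith
  have hlim : l * β + ∑ j, b * γ j ≤ u := by
    refine le_of_forall_add_mul_lt (c := β - ∑ j, γ j) fun K hK => ?_
    have := hfU (l + K, fun _ => b - K) ⟨by dsimp; linarith, fun j => by dsimp; linarith⟩
    rw [hf] at this
    simp only [sub_mul, Finset.sum_sub_distrib, ← Finset.mul_sum] at this ⊢
    linarith
  have hS : ∀ i, u ≤ mu i * β + ∑ j, C j i * γ j := by
    intro i
    have := hfS _ ⟨Pi.single i 1, single_mem_stdSimplex ℝ i, rfl⟩
    simpa [F, hf, Pi.single_apply] using this
  -- Slater's condition: if `β = 0`, the null arm forces `u ≤ 0`, hence `γ = 0`. The functional then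
  -- vanishes and cannot be strictly below `u` on `U`.
  have hβneg : β < 0 := by
    refine lt_of_le_of_ne hβ0 fun hβe => ?_
    have h1 := hS i₀
    simp only [hβe, h0, mul_zero, zero_mul, Finset.sum_const_zero, add_zero] at h1
    have h2 : ∑ j, b * γ j ≤ 0 := by rw [hβe] at hlim; linarith
    have h3 : ∀ j, γ j = 0 := by
      have h4 := (Finset.sum_eq_zero_iff_of_nonneg
        (fun j _ => mul_nonneg hb.le (hγ0 j))).1
        (le_antisymm h2 (Finset.sum_nonneg fun j _ => mul_nonneg hb.le (hγ0 j)))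
      exact fun j => (mul_eq_zero.1 (h4 j (Finset.mem_univ j))).resolve_left hb.ne'
    have h5 := hfU (l + 1, fun _ => b - 1) ⟨by dsimp; linarith, fun j => by dsimp; linarith⟩
    rw [hf] at h5
    simp [hβe, h3] at h5
    linarith
  -- Normalising the reward coefficient to `-1` turns `γ` into prices. The value of `α` is chosen to
  -- make the dual objective exactly `l`.
  refine ⟨fun j => γ j / (-β), l - ∑ j, b * (γ j / (-β)), ⟨fun i => ?_, fun j =>
    div_nonneg (hγ0 j) (by linarith)⟩, by linarith⟩
  have h1 := hS i
  have h2 : l * β + ∑ j, b * γ j ≤ mu i * β + ∑ j, C j i * γ j := hlim.trans h1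
  have e1 : ∑ j, C j i * (γ j / (-β)) = (∑ j, C j i * γ j) / (-β) := by
    rw [Finset.sum_div]; exact Finset.sum_congr rfl fun j _ => by ring
  have e2 : ∑ j, b * (γ j / (-β)) = (∑ j, b * γ j) / (-β) := by
    rw [Finset.sum_div]; exact Finset.sum_congr rfl fun j _ => by ring
  rw [e1, e2]
  have hpos : 0 < -β := by linarith
  have : (mu i - l) + (∑ j, b * γ j) / (-β) - (∑ j, C j i * γ j) / (-β) ≤ 0 := by
    have : (mu i - l) + (∑ j, b * γ j) / (-β) - (∑ j, C j i * γ j) / (-β)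
        = ((mu i - l) * (-β) + ∑ j, b * γ j - ∑ j, C j i * γ j) / (-β) := by
      rw [sub_div, add_div, mul_div_cancel_right₀ _ hpos.ne']
    rw [this]
    exact div_nonpos_of_nonpos_of_nonneg (by linarith) hpos.le
  linarith

lemma sum_abs_le_matL1 {m d : ℕ} (M : Fin d → Fin m → ℝ) (i : Fin m) :
    ∑ j, |M j i| ≤ matL1 M :=
  le_ciSup (f := fun i => ∑ j, |M j i|) (Set.finite_range _).bddAbove i

lemma sum_mul_le_of_mem_stdSimplex {m : ℕ} {x a : Fin m → ℝ} {c : ℝ}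
    (hx : x ∈ stdSimplex ℝ (Fin m)) (h : ∀ i, a i ≤ c) : ∑ i, a i * x i ≤ c := by
  calc ∑ i, a i * x i ≤ ∑ i, c * x i :=
        Finset.sum_le_sum fun i _ => mul_le_mul_of_nonneg_right (h i) (hx.1 i)
    _ = c := by rw [← Finset.mul_sum, hx.2, mul_one]

/-- Per-period dual solutions bound the benchmark, up to the global non-stationarity. -/
lemma dynLP_le {m d T : ℕ} (hT : 1 ≤ T) {mu : ℕ → Fin m → ℝ} {C : ℕ → Fin d → Fin m → ℝ}
    {b Q : ℝ} (hb : 0 ≤ b) {i₀ : Fin m} (h0 : ∀ t j, C t j i₀ = 0)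
    {qs : ℕ → Fin d → ℝ} {αs : ℕ → ℝ}
    (hd : ∀ t ∈ Finset.Icc 1 T, StepDualFeasible (mu t) (C t) (qs t) (αs t))
    (hQ : ∀ t ∈ Finset.Icc 1 T, ‖qs t‖ ≤ Q) :
    dynLP mu C T (b * T) ≤
      ∑ t ∈ Finset.Icc 1 T, (∑ j, b * qs t j + αs t) + 2 * (W1 mu T + Q * W2 C T) := by
  have hT0 : (0 : ℝ) < T := by exact_mod_cast hT
  set mb := (T : ℝ)⁻¹ • ∑ s ∈ Finset.Icc 1 T, mu s with hmb
  set Cb := (T : ℝ)⁻¹ • ∑ s ∈ Finset.Icc 1 T, C s with hCb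
  set e : ℕ → ℝ := fun t => ‖mu t - mb‖ + Q * matL1 (C t - Cb) with he
  have hesum : ∑ t ∈ Finset.Icc 1 T, e t = W1 mu T + Q * W2 C T := by
    simp only [he, Finset.sum_add_distrib, ← Finset.mul_sum]
    rfl
  have hcard : ∑ _t ∈ Finset.Icc 1 T, (1 : ℝ) = T := by simp
  refine csSup_le ⟨_, fun _ => Pi.single i₀ 1, ⟨fun t _ => single_mem_stdSimplex ℝ i₀,
    fun j => ?_⟩, rfl⟩ ?_
  · simp only [Pi.single_apply, mul_ite, mul_one, mul_zero, Finset.sum_ite_eq', Finset.mem_univ,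
      if_true, h0, Finset.sum_const_zero]
    positivity
  rintro _ ⟨x, ⟨hx, hB⟩, rfl⟩
  -- One price vector for the whole horizon: the time average of the single-step prices.
  set p : Fin d → ℝ := fun j => (T : ℝ)⁻¹ * ∑ s ∈ Finset.Icc 1 T, qs s j with hp
  have hp0 : ∀ j, 0 ≤ p j := fun j =>
    mul_nonneg (by positivity) (Finset.sum_nonneg fun s hs => (hd s hs).2 j)
  -- Replace `mu t` and `C t` by the averages, then the averages by `mu s` and `C s`. The two
  -- replacements cost `e t` and `e s`, and the dual constraint of period `s` applies.
  have hpair : ∀ t, ∀ s ∈ Finset.Icc 1 T, ∀ i,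
      mu t i - ∑ j, C t j i * qs s j ≤ αs s + e t + e s := by
    intro t s hs i
    have h1 := (hd s hs).1 i
    have hQs := hQ s hs
    have h2 : ∀ r, |mu r i - mb i| ≤ ‖mu r - mb‖ := fun r => by
      simpa using norm_le_pi_norm (mu r - mb) i
    have h3 : ∀ r, |∑ j, (C r j i - Cb j i) * qs s j| ≤ Q * matL1 (C r - Cb) := by
      intro r
      calc |∑ j, (C r j i - Cb j i) * qs s j| ≤ ∑ j, |(C r j i - Cb j i) * qs s j| :=
            Finset.abs_sum_le_sum_abs _ _
        _ ≤ ∑ j, Q * |C r j i - Cb j i| := by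
            refine Finset.sum_le_sum fun j _ => ?_
            rw [abs_mul, mul_comm]
            refine mul_le_mul_of_nonneg_right ?_ (abs_nonneg _)
            exact (by simpa using norm_le_pi_norm (qs s) j : |qs s j| ≤ ‖qs s‖).trans hQs
        _ ≤ Q * matL1 (C r - Cb) := by
            rw [← Finset.mul_sum]
            exact mul_le_mul_of_nonneg_left (sum_abs_le_matL1 (C r - Cb) i)
              ((norm_nonneg _).trans hQs)
    have e1 : ∀ r, ∑ j, (C r j i - Cb j i) * qs s j
        = ∑ j, C r j i * qs s j - ∑ j, Cb j i * qs s j := fun r => by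
      simp only [sub_mul, Finset.sum_sub_distrib]
    have := abs_le.1 (h2 t)
    have := abs_le.1 (h2 s)
    have ht3 := abs_le.1 (h3 t)
    have hs3 := abs_le.1 (h3 s)
    rw [e1] at ht3 hs3
    simp only [he]
    linarith [this.1, this.2]
  set ab := (T : ℝ)⁻¹ * ∑ s ∈ Finset.Icc 1 T, αs s with hab
  set eb := (T : ℝ)⁻¹ * ∑ s ∈ Finset.Icc 1 T, e s with heb
  have hti : ∀ t i, mu t i - ∑ j, C t j i * p j ≤ ab + e t + eb := by
    intro t i
    have h1 : (T : ℝ)⁻¹ * ∑ s ∈ Finset.Icc 1 T, (mu t i - ∑ j, C t j i * qs s j)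
        ≤ (T : ℝ)⁻¹ * ∑ s ∈ Finset.Icc 1 T, (αs s + e t + e s) :=
      mul_le_mul_of_nonneg_left (Finset.sum_le_sum fun s hs => hpair t s hs i) (by positivity)
    have e1 : (T : ℝ)⁻¹ * ∑ s ∈ Finset.Icc 1 T, (mu t i - ∑ j, C t j i * qs s j)
        = mu t i - ∑ j, C t j i * p j := by
      rw [Finset.sum_sub_distrib, mul_sub, Finset.sum_comm]
      congr 1
      · simp; field_simp
      · rw [Finset.mul_sum]
        refine Finset.sum_congr rfl fun j _ => ?_
        rw [← Finset.mul_sum, hp]; ring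
    have e2 : (T : ℝ)⁻¹ * ∑ s ∈ Finset.Icc 1 T, (αs s + e t + e s) = ab + e t + eb := by
      rw [Finset.sum_add_distrib, Finset.sum_add_distrib, mul_add, mul_add, hab, heb]
      congr 2
      simp; field_simp
    rwa [e1, e2] at h1
  -- Weak duality: the averaged constraints bound the Lagrangian of any feasible `x` at the price
  -- `p`, and the budget term is paid for in `hbud`.
  have hlag : ∑ t ∈ Finset.Icc 1 T, (∑ i, mu t i * x t i - ∑ j, p j * ∑ i, C t j i * x t i)
      ≤ ∑ t ∈ Finset.Icc 1 T, (ab + e t + eb) := by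
    refine Finset.sum_le_sum fun t ht => ?_
    refine le_of_eq_of_le ?_ (sum_mul_le_of_mem_stdSimplex (hx t ht) (hti t))
    simp only [sub_mul, Finset.sum_sub_distrib, Finset.sum_mul, Finset.mul_sum]
    congr 1
    rw [Finset.sum_comm]
    exact Finset.sum_congr rfl fun i _ => Finset.sum_congr rfl fun j _ => by ring
  have hbud : ∑ t ∈ Finset.Icc 1 T, ∑ j, p j * ∑ i, C t j i * x t i
      ≤ ∑ t ∈ Finset.Icc 1 T, ∑ j, b * qs t j := by
    rw [Finset.sum_comm, Finset.sum_comm (s := Finset.Icc 1 T)]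
    refine Finset.sum_le_sum fun j _ => ?_
    rw [← Finset.mul_sum, ← Finset.mul_sum]
    refine (mul_le_mul_of_nonneg_left (hB j) (hp0 j)).trans (le_of_eq ?_)
    rw [hp]; field_simp
  have e3 : ∑ t ∈ Finset.Icc 1 T, (ab + e t + eb)
      = ∑ t ∈ Finset.Icc 1 T, αs t + 2 * ∑ t ∈ Finset.Icc 1 T, e t := by
    rw [Finset.sum_add_distrib, Finset.sum_add_distrib]
    simp only [Finset.sum_const, Nat.card_Icc, Nat.add_sub_cancel, nsmul_eq_mul, hab, heb]
    field_simp
    ring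
  rw [Finset.sum_sub_distrib, e3, hesum] at hlag
  rw [Finset.sum_add_distrib]
  linarith

/-! ### Sliding windows -/

/-- Total variation `∑ δ s` over the window of length `w` before `t`. -/
noncomputable def drift (δ : ℕ → ℝ) (w t : ℕ) : ℝ := ∑ s ∈ Finset.Ico (max 1 (t - w)) t, δ s

lemma drift_nonneg {δ : ℕ → ℝ} (hδ : ∀ s, 0 ≤ δ s) (w t : ℕ) : 0 ≤ drift δ w t :=
  Finset.sum_nonneg fun s _ => hδ s

/-- Exchange the sums: the variation at `s` lies only in the windows of the periods in `(s, s + w]`,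
at most `w` of them. -/
lemma sum_drift_le {δ : ℕ → ℝ} (hδ : ∀ s, 0 ≤ δ s) (w T : ℕ) :
    ∑ t ∈ Finset.Icc 1 T, drift δ w t ≤ w * ∑ s ∈ Finset.Ico 1 T, δ s := by
  have h1 : ∀ t ∈ Finset.Icc 1 T, drift δ w t
      ≤ ∑ s ∈ Finset.Ico 1 T, if t ∈ Finset.Ioc s (s + w) then δ s else 0 := by
    intro t ht
    rw [← Finset.sum_filter]
    refine Finset.sum_le_sum_of_subset_of_nonneg (fun s hs => ?_) fun s _ _ => hδ s
    simp only [Finset.mem_Icc, Finset.mem_Ico, Finset.mem_filter, Finset.mem_Ioc] at *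
    omega
  refine (Finset.sum_le_sum h1).trans ?_
  rw [Finset.sum_comm, Finset.mul_sum]
  refine Finset.sum_le_sum fun s _ => ?_
  rw [← Finset.sum_filter, Finset.sum_const, nsmul_eq_mul]
  refine mul_le_mul_of_nonneg_right ?_ (hδ s)
  have : (Finset.filter (fun t => t ∈ Finset.Ioc s (s + w)) (Finset.Icc 1 T)).card
      ≤ (Finset.Ioc s (s + w)).card :=
    Finset.card_le_card fun t ht => (Finset.mem_filter.1 ht).2
  rw [Nat.card_Ioc, Nat.add_sub_cancel_left] at this
  exact_mod_cast this

lemma abs_sub_le_drift {E : Type*} [SeminormedAddCommGroup E] (a : ℕ → E) {w t s : ℕ}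
    (hs : s ∈ Finset.Ico (max 1 (t - w)) t) :
    ‖a s - a t‖ ≤ drift (fun r => ‖a r - a (r + 1)‖) w t := by
  have hs' := Finset.mem_Ico.1 hs
  have h1 := dist_le_Ico_sum_dist a hs'.2.le
  simp only [dist_eq_norm] at h1
  exact h1.trans (Finset.sum_le_sum_of_subset_of_nonneg
    (Finset.Ico_subset_Ico_left hs'.1) fun r _ _ => norm_nonneg _)

/-- Number of plays of arm `i` in the periods from `a` to `t - 1`. -/
def playsFrom {m : ℕ} (arm : ℕ → Fin m) (a t : ℕ) (i : Fin m) : ℕ :=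
  ∑ s ∈ Finset.Ico a t, if arm s = i then 1 else 0

lemma sum_playsFrom {m : ℕ} (arm : ℕ → Fin m) (a n : ℕ) :
    ∑ i, playsFrom arm a (a + n) i = n := by
  simp only [playsFrom]
  rw [Finset.sum_comm]
  simp

/-- The discrete form of integrating `1 / √x`, which makes the widths of successive plays of one arm
telescope. -/
lemma inv_sqrt_add_one_le (n : ℕ) : 1 / √((n : ℝ) + 1) ≤ 2 * √((n : ℝ) + 1) - 2 * √n := by
  have h1 : 0 < √((n : ℝ) + 1) := Real.sqrt_pos.2 (by positivity)
  have h2 := Real.sq_sqrt (show (0 : ℝ) ≤ (n : ℝ) + 1 by positivity)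
  have h3 := Real.sq_sqrt (show (0 : ℝ) ≤ (n : ℝ) by positivity)
  rw [div_le_iff₀ h1]
  nlinarith [sq_nonneg (√((n : ℝ) + 1) - √n)]

/-- Potential argument: a period changes the count of the arm it plays only, so each width is paid
for by the increase of that arm's `2 * √n`. -/
lemma sum_inv_sqrt_playsFrom_le {m : ℕ} (arm : ℕ → Fin m) (a n : ℕ) :
    ∑ t ∈ Finset.Ico a (a + n), 1 / √((playsFrom arm a t (arm t) : ℝ) + 1)
      ≤ ∑ i, 2 * √(playsFrom arm a (a + n) i) := by
  induction n with
  | zero => simp [playsFrom]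
  | succ n ih =>
    rw [← add_assoc, Finset.sum_Ico_succ_top (Nat.le_add_right a n)]
    have hstep : ∀ i, playsFrom arm a (a + n + 1) i
        = playsFrom arm a (a + n) i + if arm (a + n) = i then 1 else 0 := fun i =>
      Finset.sum_Ico_succ_top (Nat.le_add_right a n) _
    have h1 : ∑ i, (2 * √(playsFrom arm a (a + n + 1) i) - 2 * √(playsFrom arm a (a + n) i))
        = 2 * √((playsFrom arm a (a + n) (arm (a + n)) : ℝ) + 1)
          - 2 * √(playsFrom arm a (a + n) (arm (a + n))) := by
      rw [Finset.sum_eq_single (arm (a + n))]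
      · rw [hstep]; simp
      · intro i _ hi
        rw [hstep, if_neg (Ne.symm hi)]; simp
      · simp
    rw [Finset.sum_sub_distrib] at h1
    have h2 := inv_sqrt_add_one_le (playsFrom arm a (a + n) (arm (a + n)))
    linarith

lemma sum_sqrt_le {m : ℕ} (c : Fin m → ℕ) : ∑ i, √(c i) ≤ √(m * (∑ i, c i : ℕ)) := by
  refine Real.le_sqrt_of_sq_le ?_
  refine (sq_sum_le_card_mul_sum_sq (s := Finset.univ) (f := fun i => √(c i))).trans ?_
  simp

lemma sum_inv_sqrt_playsFrom_le_sqrt {m : ℕ} (arm : ℕ → Fin m) (a n : ℕ) :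
    ∑ t ∈ Finset.Ico a (a + n), 1 / √((playsFrom arm a t (arm t) : ℝ) + 1)
      ≤ 2 * √(m * n) := by
  refine (sum_inv_sqrt_playsFrom_le arm a n).trans ?_
  rw [← Finset.mul_sum]
  have := sum_sqrt_le (fun i => playsFrom arm a (a + n) i)
  rw [sum_playsFrom] at this
  linarith

/-- The widths of the confidence intervals of the arms played add up to `2 √(m w)` per block of
length `w`. -/
lemma sum_inv_sqrt_plays_le {m : ℕ} (arm : ℕ → Fin m) (w : ℕ) (k : ℕ) :
    ∑ t ∈ Finset.Ico 1 (1 + k * w), 1 / √((plays arm w t (arm t) : ℝ) + 1)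
      ≤ 2 * √(m * w) * k := by
  induction k with
  | zero => simp
  | succ k ih =>
    have hk : 1 + k * w ≤ 1 + (k + 1) * w := by nlinarith
    rw [← Finset.sum_Ico_consecutive _ (Nat.le_add_right 1 (k * w)) hk]
    have h1 := sum_inv_sqrt_playsFrom_le_sqrt arm (1 + k * w) w
    have e : 1 + (k + 1) * w = 1 + k * w + w := by ring
    rw [e]
    -- At any period of the block, the window reaches back at least to the start of the block.
    -- Counting only plays inside the block can therefore only widen the intervals.
    have h2 : ∑ t ∈ Finset.Ico (1 + k * w) (1 + k * w + w),
        1 / √((plays arm w t (arm t) : ℝ) + 1)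
        ≤ ∑ t ∈ Finset.Ico (1 + k * w) (1 + k * w + w),
          1 / √((playsFrom arm (1 + k * w) t (arm t) : ℝ) + 1) := by
      refine Finset.sum_le_sum fun t ht => ?_
      have ht' := Finset.mem_Ico.1 ht
      have h3 : playsFrom arm (1 + k * w) t (arm t) ≤ plays arm w t (arm t) :=
        Finset.sum_le_sum_of_subset (Finset.Ico_subset_Ico_left (by omega))
      have h4 : (playsFrom arm (1 + k * w) t (arm t) : ℝ) ≤ plays arm w t (arm t) := by
        exact_mod_cast h3
      gcongr
    push_cast
    linarith

/-- Half-width of the confidence intervals. -/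
noncomputable def radius {m : ℕ} (arm : ℕ → Fin m) (w : ℕ) (L : ℝ) (t : ℕ) (i : Fin m) : ℝ :=
  √(2 / (plays arm w t i + 1) * L)

lemma radius_nonneg {m : ℕ} (arm : ℕ → Fin m) (w : ℕ) (L : ℝ) (t : ℕ) (i : Fin m) :
    0 ≤ radius arm w L t i := Real.sqrt_nonneg _

lemma radius_eq {m : ℕ} (arm : ℕ → Fin m) (w : ℕ) {L : ℝ} (hL : 0 ≤ L) (t : ℕ) (i : Fin m) :
    radius arm w L t i = √(2 * L) * (1 / √((plays arm w t i : ℝ) + 1)) := by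
  rw [radius, mul_one_div, ← Real.sqrt_div (by positivity)]
  congr 1
  ring

lemma sum_radius_le {m : ℕ} (arm : ℕ → Fin m) {w T : ℕ} (hw : 1 ≤ w) (hT : 1 ≤ T) {L : ℝ}
    (hL : 0 ≤ L) :
    ∑ t ∈ Finset.Icc 1 T, radius arm w L t (arm t)
      ≤ 2 * √2 * (√(m * L * w) * ((T - 1) / w + 1 : ℕ)) := by
  -- Round the horizon up to whole blocks; with `T - 1` in the division, `w = T` gives exactly one
  -- block.
  have h1 : Finset.Icc 1 T ⊆ Finset.Ico 1 (1 + ((T - 1) / w + 1) * w) := by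
    intro t ht
    have h2 := Nat.div_add_mod (T - 1) w
    have h3 := Nat.mod_lt (T - 1) (show 0 < w by omega)
    have h4 : ((T - 1) / w + 1) * w = w * ((T - 1) / w) + w := by ring
    simp only [Finset.mem_Icc, Finset.mem_Ico] at *
    omega
  have h2 : ∑ t ∈ Finset.Icc 1 T, radius arm w L t (arm t)
      ≤ ∑ t ∈ Finset.Ico 1 (1 + ((T - 1) / w + 1) * w), radius arm w L t (arm t) :=
    Finset.sum_le_sum_of_subset_of_nonneg h1 fun t _ _ => radius_nonneg _ _ _ _ _
  refine h2.trans ?_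
  simp only [radius_eq _ _ hL, ← Finset.mul_sum]
  refine (mul_le_mul_of_nonneg_left (sum_inv_sqrt_plays_le arm w _) (Real.sqrt_nonneg _)).trans
    (le_of_eq ?_)
  rw [Real.sqrt_mul (by norm_num), mul_right_comm (m : ℝ) L,
    Real.sqrt_mul (show (0 : ℝ) ≤ (m : ℝ) * w by positivity) L]
  ring

/-! ### The tuned window -/

/-- The order `m^{1/3} V^{1/3} T^{2/3} L^{1/3}` of the cost of a variation budget `V`. -/
noncomputable def rate (m T : ℕ) (V L : ℝ) : ℝ :=
  (m : ℝ) ^ (1 / 3 : ℝ) * V ^ (1 / 3 : ℝ) * (T : ℝ) ^ (2 / 3 : ℝ) * L ^ (1 / 3 : ℝ)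

lemma rate_nonneg (m T : ℕ) {V L : ℝ} (hV : 0 ≤ V) (hL : 0 ≤ L) : 0 ≤ rate m T V L := by
  unfold rate; positivity

lemma rpow_third_pow {a : ℝ} (ha : 0 ≤ a) : (a ^ (1 / 3 : ℝ)) ^ 3 = a := by
  rw [← Real.rpow_natCast, ← Real.rpow_mul ha]; norm_num

lemma rpow_two_thirds {a : ℝ} (ha : 0 ≤ a) : a ^ (2 / 3 : ℝ) = (a ^ (1 / 3 : ℝ)) ^ 2 := by
  rw [← Real.rpow_natCast, ← Real.rpow_mul ha]; norm_num

lemma one_le_window {m T : ℕ} (hm : 1 ≤ m) (hT : 1 ≤ T) {V L : ℝ} (hV : 0 ≤ V) (hL : 1 ≤ L) :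
    1 ≤ window m T V L := by
  unfold window
  split_ifs with h
  · exact hT
  · have hV' : 0 < V := lt_of_le_of_ne hV (Ne.symm h)
    have hm' : (0 : ℝ) < m := by exact_mod_cast hm
    have hT' : (0 : ℝ) < T := by exact_mod_cast hT
    refine le_min (Nat.one_le_iff_ne_zero.2 (Nat.ceil_pos.2 ?_).ne') hT
    positivity

/-- The window makes the drift `w * V` and the width `√(m * L * w) * T / w` of equal order. The term
`√(m * L * T)` pays for the last, incomplete block, and for the case of a single full window. -/
lemma window_bounds {m T : ℕ} (hm : 1 ≤ m) (hT : 1 ≤ T) {V L : ℝ} (hV : 0 ≤ V) (hVT : V ≤ T)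
    (hL : 1 ≤ L) :
    window m T V L * V ≤ 2 * rate m T V L ∧
    √(m * L * window m T V L) * ((T - 1) / window m T V L + 1 : ℕ)
      ≤ rate m T V L + √(m * L * T) := by
  have hw1 := one_le_window hm hT hV hL
  set w := window m T V L with hw
  have hfull : w = T → √(m * L * w) * ((T - 1) / w + 1 : ℕ) ≤ rate m T V L + √(m * L * T) := by
    intro h
    rw [h, Nat.div_eq_of_lt (by omega)]
    have := rate_nonneg m T hV (by linarith : 0 ≤ L)
    simpa using this
  rcases eq_or_ne V 0 with h0 | h0
  · refine ⟨?_, hfull (by rw [hw, window, if_pos h0])⟩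
    rw [h0, mul_zero]
    have := rate_nonneg m T le_rfl (by linarith : 0 ≤ L)
    linarith
  have hV' : 0 < V := lt_of_le_of_ne hV (Ne.symm h0)
  have hm' : (1 : ℝ) ≤ m := by exact_mod_cast hm
  have hT' : (1 : ℝ) ≤ T := by exact_mod_cast hT
  set a := (m : ℝ) ^ (1 / 3 : ℝ) with ha
  set v := V ^ (1 / 3 : ℝ) with hv
  set τ := (T : ℝ) ^ (1 / 3 : ℝ) with hτ
  set l := L ^ (1 / 3 : ℝ) with hl
  have ha3 : a ^ 3 = m := rpow_third_pow (by linarith)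
  have hv3 : v ^ 3 = V := rpow_third_pow hV
  have hτ3 : τ ^ 3 = T := rpow_third_pow (by linarith)
  have hl3 : l ^ 3 = L := rpow_third_pow (by linarith)
  have ha1 : 1 ≤ a := Real.one_le_rpow hm' (by norm_num)
  have hl1 : 1 ≤ l := Real.one_le_rpow hL (by norm_num)
  have hv0 : 0 < v := Real.rpow_pos_of_pos hV' _
  have hτ0 : 0 < τ := Real.rpow_pos_of_pos (by linarith) _
  have hvτ : v ≤ τ := Real.rpow_le_rpow hV hVT (by norm_num)
  have hrate : rate m T V L = a * v * τ ^ 2 * l := by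
    rw [rate, rpow_two_thirds (by linarith : (0 : ℝ) ≤ T)]
  set z : ℝ := a * (v ^ 2)⁻¹ * τ ^ 2 * l with hz
  have hwz : w = min ⌈z⌉₊ T := by
    rw [hw, window, if_neg h0, hz, Real.rpow_neg hV, rpow_two_thirds hV,
      rpow_two_thirds (by linarith : (0 : ℝ) ≤ T)]
  have hz0 : 0 < z := by positivity
  refine ⟨?_, ?_⟩
  · have h1 : (w : ℝ) ≤ z + 1 := by
      have h2 : (w : ℝ) ≤ ⌈z⌉₊ := by rw [hwz]; exact_mod_cast min_le_left _ _
      exact h2.trans (Nat.ceil_lt_add_one hz0.le).le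
    have h2 : z * V = a * v * τ ^ 2 * l := by
      rw [hz, ← hv3]; field_simp
    -- The `+ 1` from the ceiling contributes a further `V`, which `V ≤ T` and `m, L ≥ 1` keep below
    -- the rate.
    have h3 : V ≤ a * v * τ ^ 2 * l := by
      have h4 : v ^ 2 ≤ τ ^ 2 := by gcongr
      calc V = 1 * v * v ^ 2 * 1 := by rw [← hv3]; ring
        _ ≤ a * v * τ ^ 2 * l := by gcongr
    rw [hrate]
    nlinarith [mul_le_mul_of_nonneg_right h1 hV]
  · rcases eq_or_ne w T with hwT | hwT
    · exact hfull hwT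
    have hwT' : w ≤ T := by rw [hwz]; exact min_le_right _ _
    -- Away from the truncation at `T`, the window is the ceiling itself.
    have hzw : z ≤ w := by
      have : w = ⌈z⌉₊ := by
        rw [hwz] at hwT ⊢
        rcases min_choice ⌈z⌉₊ T with h | h
        · exact h
        · exact absurd h hwT
      rw [this]; exact Nat.le_ceil z
    have hw0 : (0 : ℝ) < w := by exact_mod_cast hw1
    have hK : (((T - 1) / w + 1 : ℕ) : ℝ) ≤ T / w + 1 := by
      push_cast
      have h1 : (((T - 1) / w : ℕ) : ℝ) ≤ ((T - 1 : ℕ) : ℝ) / w := Nat.cast_div_le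
      have h2 : ((T - 1 : ℕ) : ℝ) ≤ T := by exact_mod_cast Nat.sub_le _ _
      have h3 : ((T - 1 : ℕ) : ℝ) / w ≤ T / w := by gcongr
      linarith
    have h1 : √(m * L * w) * (T / w) ≤ rate m T V L := by
      rw [hrate]
      refine le_of_sq_le_sq ?_ (by positivity)
      rw [mul_pow, Real.sq_sqrt (by positivity)]
      have e1 : (m : ℝ) * L * w * (T / w) ^ 2 = m * L * T ^ 2 / w := by field_simp
      rw [e1, div_le_iff₀ hw0]
      -- The balance identity that determines the formula for `z`.
      calc (m : ℝ) * L * T ^ 2 = (a * v * τ ^ 2 * l) ^ 2 * z := by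
            rw [← ha3, ← hl3, ← hτ3, hz]; field_simp
        _ ≤ (a * v * τ ^ 2 * l) ^ 2 * w := by gcongr
    have h2 : √(m * L * w) ≤ √(m * L * T) := by
      have : (w : ℝ) ≤ T := by exact_mod_cast hwT'
      gcongr
    calc √(m * L * w) * (((T - 1) / w + 1 : ℕ) : ℝ) ≤ √(m * L * w) * (T / w + 1) := by gcongr
      _ ≤ _ := by linarith

/-! ### Confidence bounds -/

/-- Centred sum of the quantities `z s`, with means `ζ s`, collected from arm `i` in the window. -/
noncomputable def deviation {m : ℕ} (arm : ℕ → Fin m) (z ζ : ℕ → ℝ) (w t : ℕ) (i : Fin m) : ℝ :=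
  ∑ s ∈ Finset.Ico (max 1 (t - w)) t, if arm s = i then z s - ζ s else 0

lemma plays_cast {m : ℕ} (arm : ℕ → Fin m) (w t : ℕ) (i : Fin m) :
    (plays arm w t i : ℝ) = ∑ s ∈ Finset.Ico (max 1 (t - w)) t, if arm s = i then (1 : ℝ) else 0 := by
  simp [plays]

lemma plays_lt {m : ℕ} (arm : ℕ → Fin m) (w : ℕ) {t T : ℕ} (ht : t ∈ Finset.Icc 1 T) (i : Fin m) :
    plays arm w t i < T := by
  have h1 : plays arm w t i ≤ ∑ s ∈ Finset.Ico (max 1 (t - w)) t, 1 :=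
    Finset.sum_le_sum fun s _ => by split_ifs <;> simp
  simp only [Finset.sum_const, Nat.card_Ico, smul_eq_mul, mul_one] at h1
  have := Finset.mem_Icc.1 ht
  omega

/-- Multiplied by `n + 1`, the error is the centred noise, plus the drift of the means over the
plays, minus one copy of `ζ t` because the denominator is `n + 1` and not `n`. The `+ 1` in the
hypothesis on the deviation absorbs that copy. -/
lemma abs_estimate_sub_le {m : ℕ} {arm : ℕ → Fin m} {z ζ : ℕ → ℝ} {w t : ℕ} {i : Fin m} {L v : ℝ}
    (hζ : |ζ t| ≤ 1) (hv : ∀ s ∈ Finset.Ico (max 1 (t - w)) t, |ζ s - ζ t| ≤ v)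
    (hv0 : 0 ≤ v)
    (hdev : |deviation arm z ζ w t i| + 1 ≤ √(2 * L * (plays arm w t i + 1))) :
    |estimate arm z w t i - ζ t| ≤ v + radius arm w L t i := by
  set n : ℝ := (plays arm w t i : ℝ) with hn
  have hn0 : 0 ≤ n := Nat.cast_nonneg _
  have hn1 : 0 < n + 1 := by linarith
  have e1 : (∑ s ∈ Finset.Ico (max 1 (t - w)) t, if arm s = i then z s else 0)
      = deviation arm z ζ w t i
        + (∑ s ∈ Finset.Ico (max 1 (t - w)) t, if arm s = i then ζ s - ζ t else 0) + n * ζ t := by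
    rw [deviation, hn, plays_cast, Finset.sum_mul, ← Finset.sum_add_distrib,
      ← Finset.sum_add_distrib]
    refine Finset.sum_congr rfl fun s _ => ?_
    split_ifs <;> ring
  have h1 : |∑ s ∈ Finset.Ico (max 1 (t - w)) t, if arm s = i then ζ s - ζ t else 0| ≤ n * v := by
    refine (Finset.abs_sum_le_sum_abs _ _).trans ?_
    rw [hn, plays_cast, Finset.sum_mul]
    refine Finset.sum_le_sum fun s hs => ?_
    split_ifs
    · simpa using hv s hs
    · simp
  have e2 : estimate arm z w t i - ζ t = (deviation arm z ζ w t i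
        + (∑ s ∈ Finset.Ico (max 1 (t - w)) t, if arm s = i then ζ s - ζ t else 0) - ζ t)
          / (n + 1) := by
    rw [estimate, e1, ← hn, eq_div_iff hn1.ne', sub_mul, div_mul_cancel₀ _ hn1.ne']
    ring
  have e3 : radius arm w L t i * (n + 1) = √(2 * L * (n + 1)) := by
    rw [radius, ← hn]
    nth_rw 2 [← Real.sqrt_sq hn1.le]
    rw [← Real.sqrt_mul' _ (by positivity)]
    congr 1
    field_simp
  rw [e2, abs_div, abs_of_pos hn1, div_le_iff₀ hn1, add_mul, e3]
  have h2 := abs_add_le (deviation arm z ζ w t i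
        + ∑ s ∈ Finset.Ico (max 1 (t - w)) t, if arm s = i then ζ s - ζ t else 0) (-ζ t)
  have h3 := abs_add_le (deviation arm z ζ w t i)
    (∑ s ∈ Finset.Ico (max 1 (t - w)) t, if arm s = i then ζ s - ζ t else 0)
  rw [abs_neg, ← sub_eq_add_neg] at h2
  nlinarith

/-- The exponent for the deviation of a sum of `n` terms at confidence level `L`. -/
noncomputable def tilt (L : ℝ) (n : ℕ) : ℝ := √(2 * L / (n + 1))

/-- Pathwise Chernoff bound: a large deviation makes the exponential of one of the two signs large.
The tilt `r` satisfies `r ^ 2 * (n + 1) = 2 * L`. The exponent is then at least `L + r ^ 2 / 2 - r`,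
and `(r - 1) ^ 2 ≥ 0` explains the loss of `1 / 2`. -/
lemma exp_le_of_deviation {L M : ℝ} {n : ℕ} (hL : 0 ≤ L) (h : √(2 * L * (n + 1)) < |M| + 1) :
    Real.exp (L - 1 / 2) ≤ Real.exp (tilt L n * M - tilt L n ^ 2 / 2 * n)
      + Real.exp (tilt L n * (-M) - tilt L n ^ 2 / 2 * n) := by
  set r := tilt L n with hr
  have hn1 : (0 : ℝ) < n + 1 := by positivity
  have hr0 : 0 ≤ r := Real.sqrt_nonneg _
  have hr2 : r ^ 2 * (n + 1) = 2 * L := by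
    rw [hr, tilt, Real.sq_sqrt (by positivity), div_mul_cancel₀ _ hn1.ne']
  have e1 : √(2 * L * (n + 1)) = r * (n + 1) := by
    rw [← hr2, show r ^ 2 * ((n : ℝ) + 1) * (n + 1) = (r * (n + 1)) ^ 2 by ring]
    exact Real.sqrt_sq (by positivity)
  rw [e1] at h
  have key : L - 1 / 2 ≤ r * |M| - r ^ 2 / 2 * n := by
    nlinarith [sq_nonneg (r - 1), mul_le_mul_of_nonneg_left h.le hr0]
  rcases abs_choice M with hM | hM
  · rw [hM] at key
    linarith [Real.exp_le_exp.2 key, Real.exp_pos (r * (-M) - r ^ 2 / 2 * n)]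
  · rw [hM] at key
    linarith [Real.exp_le_exp.2 key, Real.exp_pos (r * M - r ^ 2 / 2 * n)]

/-- One step of the algorithm: the program of the confidence bounds is nearly as good as the
true program. -/
lemma StepFeasible.value_le {m d : ℕ} {mu : Fin m → ℝ} {C : Fin d → Fin m → ℝ} {b : ℝ}
    {xs p r U : Fin m → ℝ} {Lc : Fin d → Fin m → ℝ} {v v' : ℝ} (hb : 0 < b)
    (hxs : StepFeasible C b xs) (hp : StepOptimal U Lc b p) {i₀ : Fin m}
    (hmu : ∀ i, mu i ≤ 1) (hv : 0 ≤ v) (hv' : 0 ≤ v')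
    (hU0 : 0 ≤ U i₀) (hL0 : ∀ j, Lc j i₀ ≤ 0)
    (hUl : ∀ i, mu i - v ≤ U i) (hUu : ∀ i, U i ≤ mu i + v + 2 * r i)
    (hLu : ∀ j i, Lc j i ≤ C j i + v') :
    ∑ i, mu i * xs i ≤ ∑ i, mu i * p i + 2 * v + v' / b + 2 * ∑ i, r i * p i := by
  have hbv : 0 < b + v' := by linarith
  -- The consumption of `xs` under the lower bounds may exceed `b` by `v'`. Mixing with the null arm
  -- in this proportion restores feasibility and loses at most the fraction `v' / b` of a reward at
  -- most `1`.
  set θ := b / (b + v') with hθ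
  have hθ0 : 0 ≤ θ := by positivity
  have hθ1 : θ ≤ 1 := by rw [hθ, div_le_one hbv]; linarith
  have hθb : θ * (b + v') = b := div_mul_cancel₀ _ hbv.ne'
  set z : Fin m → ℝ := θ • xs + (1 - θ) • Pi.single i₀ 1 with hz
  have hzs : z ∈ stdSimplex ℝ (Fin m) :=
    (convex_stdSimplex ℝ (Fin m)) hxs.1 (single_mem_stdSimplex ℝ i₀) hθ0 (by linarith) (by ring)
  have hzsum : ∀ a : Fin m → ℝ, ∑ i, a i * z i = θ * ∑ i, a i * xs i + (1 - θ) * a i₀ := by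
    intro a
    simp only [hz, Pi.add_apply, Pi.smul_apply, smul_eq_mul, mul_add, Finset.sum_add_distrib,
      Pi.single_apply, Finset.mul_sum]
    congr 1
    · exact Finset.sum_congr rfl fun i _ => by ring
    · simp; ring
  have hzf : StepFeasible Lc b z := by
    refine ⟨hzs, fun j => ?_⟩
    rw [hzsum]
    have h1 : ∑ i, Lc j i * xs i ≤ ∑ i, (C j i + v') * xs i :=
      Finset.sum_le_sum fun i _ => mul_le_mul_of_nonneg_right (hLu j i) (hxs.1.1 i)
    have h2 : ∑ i, (C j i + v') * xs i ≤ b + v' := by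
      simp only [add_mul, Finset.sum_add_distrib, ← Finset.mul_sum, hxs.1.2]
      linarith [hxs.2 j]
    have h3 := mul_le_mul_of_nonneg_left (h1.trans h2) hθ0
    have h4 := mul_nonpos_of_nonneg_of_nonpos (sub_nonneg.2 hθ1) (hL0 j)
    linarith
  have h1 := hp.2 z hzf
  rw [hzsum] at h1
  have h2 : ∑ i, mu i * xs i - v ≤ ∑ i, U i * xs i := by
    have : ∑ i, (mu i - v) * xs i ≤ ∑ i, U i * xs i :=
      Finset.sum_le_sum fun i _ => mul_le_mul_of_nonneg_right (hUl i) (hxs.1.1 i)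
    simpa only [sub_mul, Finset.sum_sub_distrib, ← Finset.mul_sum, hxs.1.2, mul_one] using this
  have h3 : ∑ i, U i * p i ≤ ∑ i, mu i * p i + v + 2 * ∑ i, r i * p i := by
    have : ∑ i, U i * p i ≤ ∑ i, (mu i + v + 2 * r i) * p i :=
      Finset.sum_le_sum fun i _ => mul_le_mul_of_nonneg_right (hUu i) (hp.1.1.1 i)
    refine this.trans (le_of_eq ?_)
    simp only [add_mul, Finset.sum_add_distrib, ← Finset.mul_sum, hp.1.1.2, mul_one, mul_assoc]
  have h4 : ∑ i, mu i * xs i ≤ 1 := sum_mul_le_of_mem_stdSimplex hxs.1 hmu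
  have h5 : 1 - θ ≤ v' / b := by
    have : 1 - θ = v' / (b + v') := by rw [hθ]; field_simp; ring
    rw [this]
    gcongr
    linarith
  have h6 := mul_le_mul_of_nonneg_left h2 hθ0
  have h7 := mul_nonneg (sub_nonneg.2 hθ1) hU0
  have h8 := mul_nonneg (sub_nonneg.2 hθ1) (sub_nonneg.2 h4)
  have h9 := mul_nonneg (sub_nonneg.2 hθ1) hv
  nlinarith

/-! ### Budget exhaustion -/

open Classical in
/-- Indicator of the algorithm playing at period `t`. -/
noncomputable def act {m d : ℕ} (B : ℝ) (y : ℕ → Outcome m d) (arm : ℕ → Fin m) (t : ℕ) : ℝ :=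
  if Active B y arm t then 1 else 0

lemma act_nonneg {m d : ℕ} (B : ℝ) (y : ℕ → Outcome m d) (arm : ℕ → Fin m) (t : ℕ) :
    0 ≤ act B y arm t := by unfold act; split_ifs <;> simp

lemma act_le_one {m d : ℕ} (B : ℝ) (y : ℕ → Outcome m d) (arm : ℕ → Fin m) (t : ℕ) :
    act B y arm t ≤ 1 := by unfold act; split_ifs <;> simp

lemma Active.mono {m d : ℕ} {B : ℝ} {y : ℕ → Outcome m d} {arm : ℕ → Fin m} {T s t : ℕ}
    (hc : ∀ t ∈ Finset.Icc 1 T, ∀ j i, 0 ≤ (y t).2 j i) (hst : s ≤ t) (ht : t ≤ T + 1)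
    (h : Active B y arm t) : Active B y arm s := fun j =>
  (Finset.sum_le_sum_of_subset_of_nonneg (Finset.Ico_subset_Ico_right hst) fun r hr _ =>
    hc r (by simp only [Finset.mem_Ico, Finset.mem_Icc] at *; omega) j _).trans (h j)

lemma act_antitone {m d : ℕ} {B : ℝ} {y : ℕ → Outcome m d} {arm : ℕ → Fin m} {T s t : ℕ}
    (hc : ∀ t ∈ Finset.Icc 1 T, ∀ j i, 0 ≤ (y t).2 j i) (hst : s ≤ t) (ht : t ≤ T + 1) :
    act B y arm t ≤ act B y arm s := by
  by_cases h : Active B y arm t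
  · simp [act, h, h.mono hc hst ht]
  · simp only [act, h, if_false]; exact act_nonneg _ _ _ _

/-- Either all periods are played or some resource is overspent. -/
lemma forall_active_or_exists_lt {m d : ℕ} {B : ℝ} {y : ℕ → Outcome m d} {arm : ℕ → Fin m} (n : ℕ)
    (hc : ∀ t ∈ Finset.Icc 1 n, ∀ j i, 0 ≤ (y t).2 j i) :
    (∀ t ∈ Finset.Icc 1 n, Active B y arm t) ∨
      ∃ j, B < ∑ t ∈ Finset.Icc 1 n, act B y arm t * (y t).2 j (arm t) := by
  induction n with
  | zero => left; simp
  | succ n ih =>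
    have hpos : ∀ j, 0 ≤ act B y arm (n + 1) * (y (n + 1)).2 j (arm (n + 1)) := fun j =>
      mul_nonneg (act_nonneg _ _ _ _) (hc _ (by simp) j _)
    have hsplit : ∀ j, ∑ t ∈ Finset.Icc 1 (n + 1), act B y arm t * (y t).2 j (arm t)
        = ∑ t ∈ Finset.Icc 1 n, act B y arm t * (y t).2 j (arm t)
          + act B y arm (n + 1) * (y (n + 1)).2 j (arm (n + 1)) := fun j =>
      Finset.sum_Icc_succ_top (by omega) _
    rcases ih fun t ht => hc t (by simp only [Finset.mem_Icc] at *; omega) with h | ⟨j, hj⟩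
    · by_cases ha : Active B y arm (n + 1)
      · left
        intro t ht
        rcases eq_or_ne t (n + 1) with rfl | hne
        · exact ha
        · exact h t (by simp only [Finset.mem_Icc] at *; omega)
      -- At the first inactive period all earlier indicators equal `1`, so the weighted consumption
      -- is the true one and already exceeds the budget.
      · right
        simp only [Active, not_forall, not_le] at ha
        obtain ⟨j, hj⟩ := ha
        refine ⟨j, ?_⟩
        rw [hsplit]
        have e : Finset.Ico 1 (n + 1) = Finset.Icc 1 n := by
          ext; simp only [Finset.mem_Ico, Finset.mem_Icc]; omega
        rw [e] at hj
        have : ∑ t ∈ Finset.Icc 1 n, act B y arm t * (y t).2 j (arm t)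
            = ∑ t ∈ Finset.Icc 1 n, (y t).2 j (arm t) :=
          Finset.sum_congr rfl fun t ht => by simp [act, h t ht]
        linarith [hpos j]
    · right
      exact ⟨j, by rw [hsplit]; linarith [hpos j]⟩

/-- The reward collected, period by period. -/
lemma totalReward_eq {m d : ℕ} {B : ℝ} {T : ℕ} {y : ℕ → Outcome m d} {arm : ℕ → Fin m}
    (hc : ∀ t ∈ Finset.Icc 1 T, ∀ j i, 0 ≤ (y t).2 j i) :
    totalReward B T y arm = ∑ t ∈ Finset.Icc 1 T, act B y arm (t + 1) * (y t).1 (arm t) := by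
  set τ := stopTime B T y arm with hτ
  have hmem : τ ∈ ({τ | τ ∈ Finset.Icc 1 T ∧ ∃ j, B < ∑ t ∈ Finset.Icc 1 τ, (y t).2 j (arm t)}
      ∪ {T + 1} : Set ℕ) := Nat.sInf_mem ⟨T + 1, Or.inr rfl⟩
  have hle : ∀ s ∈ ({τ | τ ∈ Finset.Icc 1 T ∧ ∃ j, B < ∑ t ∈ Finset.Icc 1 τ, (y t).2 j (arm t)}
      ∪ {T + 1} : Set ℕ), τ ≤ s := fun s hs => Nat.sInf_le hs
  have hτT : τ ≤ T + 1 := hle _ (Or.inr rfl)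
  have e : ∀ n, Finset.Ico 1 (n + 1) = Finset.Icc 1 n := fun n => by
    ext; simp only [Finset.mem_Ico, Finset.mem_Icc]; omega
  -- The shift matters: a period's reward counts only if the budget still holds after its own
  -- consumption, which is activity at `t + 1`.
  have hact : ∀ t ∈ Finset.Icc 1 T, (Active B y arm (t + 1) ↔ t < τ) := by
    intro t ht
    have ht' := Finset.mem_Icc.1 ht
    constructor
    · intro h
      by_contra! hle'
      rcases hmem with ⟨h1, j, hj⟩ | h1
      · have h2 := (h.mono hc (show τ + 1 ≤ t + 1 by omega) (by omega)) j
        rw [e] at h2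
        linarith
      · have : τ = T + 1 := h1
        omega
    · intro h
      by_contra hn
      simp only [Active, not_forall, not_le, e] at hn
      have := hle t (Or.inl ⟨ht, hn⟩)
      omega
  rw [totalReward, ← hτ]
  have h1 : ∀ t ∈ Finset.Icc 1 T, act B y arm (t + 1) * (y t).1 (arm t)
      = if t < τ then (y t).1 (arm t) else 0 := by
    intro t ht
    by_cases h : t < τ
    · simp [act, (hact t ht).2 h, h]
    · simp [act, mt (hact t ht).1 h, h]
  rw [Finset.sum_congr rfl h1, ← Finset.sum_filter]
  refine Finset.sum_congr ?_ fun _ _ => rfl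
  ext t
  simp only [Finset.mem_Ico, Finset.mem_filter, Finset.mem_Icc]
  omega

/-- Only the reward of the period in which the budget is exceeded is lost. -/
lemma sum_act_le_totalReward_add_one {m d : ℕ} {B : ℝ} {T : ℕ} {y : ℕ → Outcome m d}
    {arm : ℕ → Fin m} (hc : ∀ t ∈ Finset.Icc 1 T, ∀ j i, 0 ≤ (y t).2 j i)
    (hr : ∀ t ∈ Finset.Icc 1 T, ∀ i, (y t).1 i ≤ 1) :
    ∑ t ∈ Finset.Icc 1 T, act B y arm t * (y t).1 (arm t) ≤ totalReward B T y arm + 1 := by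
  rw [totalReward_eq hc]
  have h1 : ∑ t ∈ Finset.Icc 1 T, (act B y arm t - act B y arm (t + 1)) * (y t).1 (arm t)
      ≤ ∑ t ∈ Finset.Icc 1 T, (act B y arm t - act B y arm (t + 1)) := by
    refine Finset.sum_le_sum fun t ht => ?_
    have ht' := Finset.mem_Icc.1 ht
    exact mul_le_of_le_one_right
      (sub_nonneg.2 (act_antitone hc (by omega) (by omega))) (hr t ht _)
  -- The indicator decreases from at most `1` to at least `0`, so its drops, which weight the lost
  -- rewards, telescope to at most `1`.
  have h2 : ∑ t ∈ Finset.Icc 1 T, (act B y arm t - act B y arm (t + 1))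
      = act B y arm 1 - act B y arm (T + 1) := by
    clear h1 hc hr
    induction T with
    | zero => simp
    | succ n ih => rw [Finset.sum_Icc_succ_top (by omega), ih]; ring
  simp only [sub_mul, Finset.sum_sub_distrib] at h1 h2
  linarith [act_le_one B y arm 1, act_nonneg B y arm (T + 1)]

/-! ### The regret along one trajectory -/

/-- Excess of the consumption of resource `j` over its conditional expectation. -/
noncomputable def overspend {m d : ℕ} (B : ℝ) (T : ℕ) (C : ℕ → Fin d → Fin m → ℝ)
    (y : ℕ → Outcome m d) (arm : ℕ → Fin m) (p : ℕ → Fin m → ℝ) (j : Fin d) : ℝ :=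
  ∑ t ∈ Finset.Icc 1 T, act B y arm t * ((y t).2 j (arm t) - ∑ i, C t j i * p t i)

/-- Total width, in expectation given the past, of the confidence intervals. -/
noncomputable def totalRadius {m d : ℕ} (B : ℝ) (T w : ℕ) (L : ℝ)
    (y : ℕ → Outcome m d) (arm : ℕ → Fin m) (p : ℕ → Fin m → ℝ) : ℝ :=
  ∑ t ∈ Finset.Icc 1 T, act B y arm t * ∑ i, radius arm w L t i * p t i

/-- Deterministic core of the analysis, with all randomness isolated in valid deviations and a bound
`O` on overspending. Played periods lose through optimism and drift; unplayed ones are counted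
through the budget. -/
lemma sum_value_le {m d T w₁ w₂ : ℕ} {b : ℝ} (hb : 0 < b) {mu : ℕ → Fin m → ℝ}
    {C : ℕ → Fin d → Fin m → ℝ} {i₀ : Fin m}
    (hmu : ∀ t i, mu t i ∈ Set.Icc (0 : ℝ) 1) (hC : ∀ t j i, C t j i ∈ Set.Icc (0 : ℝ) 1)
    {y : ℕ → Outcome m d} {arm : ℕ → Fin m} {p xs : ℕ → Fin m → ℝ}
    (hr : ∀ t ∈ Finset.Icc 1 T, ∀ i, 0 ≤ (y t).1 i)
    (hc : ∀ t ∈ Finset.Icc 1 T, ∀ j i, 0 ≤ (y t).2 j i)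
    (hc0 : ∀ t ∈ Finset.Icc 1 T, ∀ j, (y t).2 j i₀ = 0)
    (hopt : ∀ t ∈ Finset.Icc 1 T, Active (b * T) y arm t →
      StepOptimal (ucb T w₁ y arm t) (lcb T w₂ y arm t) b (p t))
    (hxs : ∀ t ∈ Finset.Icc 1 T, StepFeasible (C t) b (xs t))
    (hdev₁ : ∀ t ∈ Finset.Icc 1 T, ∀ i,
      |deviation arm (fun s => (y s).1 i) (fun s => mu s i) w₁ t i| + 1
        ≤ √(2 * Real.log (12 * m * T ^ 3) * (plays arm w₁ t i + 1)))
    (hdev₂ : ∀ t ∈ Finset.Icc 1 T, ∀ j i,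
      |deviation arm (fun s => (y s).2 j i) (fun s => C s j i) w₂ t i| + 1
        ≤ √(2 * Real.log (12 * m * d * T ^ 3) * (plays arm w₂ t i + 1)))
    {O : ℝ} (hO0 : 0 ≤ O) (hO : ∀ j, overspend (b * T) T C y arm p j ≤ O) :
    ∑ t ∈ Finset.Icc 1 T, ∑ i, mu t i * xs t i ≤
      ∑ t ∈ Finset.Icc 1 T, act (b * T) y arm t * ∑ i, mu t i * p t i
      + 2 * (w₁ * V1 mu T) + d * (w₂ * V2 C T) / b
      + 2 * totalRadius (b * T) T w₁ (Real.log (12 * m * T ^ 3)) y arm p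
      + 1 / b * (O + w₂ * V2 C T
        + 2 * totalRadius (b * T) T w₂ (Real.log (12 * m * d * T ^ 3)) y arm p) := by
  set A := act (b * T) y arm with hA
  set L₁ := Real.log (12 * m * T ^ 3)
  set L₂ := Real.log (12 * m * d * T ^ 3)
  set v₁ : ℕ → ℝ := drift (fun s => ‖mu s - mu (s + 1)‖) w₁ with hv₁
  set v₂ : Fin d → ℕ → ℝ := fun j => drift (fun s => ‖C s j - C (s + 1) j‖) w₂ with hv₂
  have hv₁0 : ∀ t, 0 ≤ v₁ t := drift_nonneg (fun _ => norm_nonneg _) _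
  have hv₂0 : ∀ j t, 0 ≤ v₂ j t := fun j => drift_nonneg (fun _ => norm_nonneg _) _
  have hv₁s : ∑ t ∈ Finset.Icc 1 T, v₁ t ≤ w₁ * V1 mu T := sum_drift_le (fun _ => norm_nonneg _) _ _
  have hv₂s : ∀ j, ∑ t ∈ Finset.Icc 1 T, v₂ j t ≤ w₂ * V2 C T := fun j => by
    refine (sum_drift_le (fun _ => norm_nonneg _) _ _).trans ?_
    exact mul_le_mul_of_nonneg_left
      (le_ciSup (f := fun j => ∑ t ∈ Finset.Ico 1 T, ‖C t j - C (t + 1) j‖)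
        (Set.finite_range _).bddAbove j) (Nat.cast_nonneg _)
  have hest₁ : ∀ t ∈ Finset.Icc 1 T, ∀ i,
      |estimate arm (fun s => (y s).1 i) w₁ t i - mu t i| ≤ v₁ t + radius arm w₁ L₁ t i := by
    intro t ht i
    refine abs_estimate_sub_le (ζ := fun s => mu s i) ?_ (fun s hs => ?_) (hv₁0 t) (hdev₁ t ht i)
    · exact abs_le.2 ⟨by linarith [(hmu t i).1], (hmu t i).2⟩
    · refine (norm_le_pi_norm (mu s - mu t) i).trans (abs_sub_le_drift mu hs)
  have hest₂ : ∀ t ∈ Finset.Icc 1 T, ∀ j i,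
      |estimate arm (fun s => (y s).2 j i) w₂ t i - C t j i| ≤ v₂ j t + radius arm w₂ L₂ t i := by
    intro t ht j i
    refine abs_estimate_sub_le (ζ := fun s => C s j i) ?_ (fun s hs => ?_) (hv₂0 j t)
      (hdev₂ t ht j i)
    · exact abs_le.2 ⟨by linarith [(hC t j i).1], (hC t j i).2⟩
    · refine (norm_le_pi_norm (C s j - C t j) i).trans (abs_sub_le_drift (fun s => C s j) hs)
  have hwin : ∀ t ∈ Finset.Icc 1 T, ∀ w, ∀ s ∈ Finset.Ico (max 1 (t - w)) t,
      s ∈ Finset.Icc 1 T := by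
    intro t ht w s hs
    simp only [Finset.mem_Ico, Finset.mem_Icc] at *
    omega
  have hU0 : ∀ t ∈ Finset.Icc 1 T, 0 ≤ ucb T w₁ y arm t i₀ := by
    intro t ht
    refine add_nonneg (div_nonneg (Finset.sum_nonneg fun s hs => ?_) (by positivity))
      (Real.sqrt_nonneg _)
    split_ifs
    · exact hr s (hwin t ht _ s hs) i₀
    · exact le_rfl
  have hL0 : ∀ t ∈ Finset.Icc 1 T, ∀ j, lcb T w₂ y arm t j i₀ ≤ 0 := by
    intro t ht j
    have : estimate arm (fun s => (y s).2 j i₀) w₂ t i₀ = 0 := by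
      rw [estimate, Finset.sum_eq_zero, zero_div]
      intro s hs
      split_ifs
      · exact hc0 s (hwin t ht _ s hs) j
      · rfl
    rw [lcb, this, zero_sub, neg_nonpos]
    exact Real.sqrt_nonneg _
  have hstep : ∀ t ∈ Finset.Icc 1 T, A t * ∑ i, mu t i * xs t i ≤
      A t * ∑ i, mu t i * p t i + 2 * v₁ t + (∑ j, v₂ j t) / b
        + 2 * (A t * ∑ i, radius arm w₁ L₁ t i * p t i) := by
    intro t ht
    -- A single slack must serve all resources when `xs` is shrunk, so the drifts are summed over
    -- `j`. This is the source of the factor `d`.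
    have h2 : 0 ≤ ∑ j, v₂ j t := Finset.sum_nonneg fun j _ => hv₂0 j t
    by_cases ha : Active (b * T) y arm t
    · have hA1 : A t = 1 := by simp [hA, act, ha]
      rw [hA1, one_mul, one_mul, one_mul]
      refine (hxs t ht).value_le hb (hopt t ht ha) (i₀ := i₀) (fun i => (hmu t i).2)
        (hv₁0 t) h2 (hU0 t ht) (hL0 t ht) (fun i => ?_) (fun i => ?_) (fun j i => ?_)
      · have := (abs_le.1 (hest₁ t ht i)).1
        simp only [ucb]; simp only [radius] at this; linarith
      · have := (abs_le.1 (hest₁ t ht i)).2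
        simp only [ucb]; simp only [radius] at *; linarith
      · have := (abs_le.1 (hest₂ t ht j i)).2
        have h3 : v₂ j t ≤ ∑ j, v₂ j t :=
          Finset.single_le_sum (f := fun j => v₂ j t) (fun j _ => hv₂0 j t) (Finset.mem_univ j)
        simp only [lcb]; simp only [radius] at this; linarith
    · have hA0 : A t = 0 := by simp [hA, act, ha]
      rw [hA0]
      have := hv₁0 t
      have : 0 ≤ (∑ j, v₂ j t) / b := by positivity
      linarith
  -- If a period is missed, some resource `j` has consumed more than `b * T`, whereas the plan
  -- allows `b` per played period. Only the drift of this one `j` enters, so there is no factor `d`.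
  have hbudget : b * (T - ∑ t ∈ Finset.Icc 1 T, A t)
      ≤ O + w₂ * V2 C T + 2 * totalRadius (b * T) T w₂ L₂ y arm p := by
    have hR0 : 0 ≤ totalRadius (b * T) T w₂ L₂ y arm p := by
      refine Finset.sum_nonneg fun t ht => ?_
      by_cases ha : Active (b * T) y arm t
      · exact mul_nonneg (act_nonneg _ _ _ _) (Finset.sum_nonneg fun i _ =>
          mul_nonneg (radius_nonneg _ _ _ _ _) ((hopt t ht ha).1.1.1 i))
      · simp [act, ha]
    rcases forall_active_or_exists_lt (B := b * T) (arm := arm) T hc with h | ⟨j, hj⟩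
    · have : ∑ t ∈ Finset.Icc 1 T, A t = T := by
        rw [Finset.sum_congr rfl fun t ht => (by simp [hA, act, h t ht] : A t = 1)]
        simp
      rw [this, sub_self, mul_zero]
      have : 0 ≤ w₂ * V2 C T :=
        mul_nonneg (Nat.cast_nonneg _) (Real.iSup_nonneg fun j =>
          Finset.sum_nonneg fun t _ => norm_nonneg _)
      linarith
    · have h1 : ∀ t ∈ Finset.Icc 1 T, A t * ∑ i, C t j i * p t i
          ≤ b * A t + v₂ j t + 2 * (A t * ∑ i, radius arm w₂ L₂ t i * p t i) := by
        intro t ht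
        by_cases ha : Active (b * T) y arm t
        · have hA1 : A t = 1 := by simp [hA, act, ha]
          rw [hA1, one_mul, one_mul, mul_one]
          have hf := (hopt t ht ha).1
          have h2 : ∑ i, C t j i * p t i
              ≤ ∑ i, (lcb T w₂ y arm t j i + v₂ j t + 2 * radius arm w₂ L₂ t i) * p t i := by
            refine Finset.sum_le_sum fun i _ => mul_le_mul_of_nonneg_right ?_ (hf.1.1 i)
            have := (abs_le.1 (hest₂ t ht j i)).1
            simp only [lcb]; simp only [radius] at *; linarith
          simp only [add_mul, Finset.sum_add_distrib, ← Finset.mul_sum, hf.1.2, mul_one,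
            mul_assoc] at h2
          linarith [hf.2 j]
        · have hA0 : A t = 0 := by simp [hA, act, ha]
          rw [hA0]
          linarith [hv₂0 j t]
      have h2 := Finset.sum_le_sum h1
      have h3 := hO j
      rw [overspend] at h3
      simp only [mul_sub, Finset.sum_sub_distrib] at h3
      simp only [Finset.sum_add_distrib, ← Finset.mul_sum] at h2
      have h4 := hv₂s j
      rw [totalRadius]
      linarith
  -- A period that is not played loses at most a reward of `1`.
  have hrest : ∀ t ∈ Finset.Icc 1 T, ∑ i, mu t i * xs t i
      ≤ A t * ∑ i, mu t i * xs t i + (1 - A t) := by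
    intro t ht
    have h1 : ∑ i, mu t i * xs t i ≤ 1 :=
      sum_mul_le_of_mem_stdSimplex (hxs t ht).1 fun i => (hmu t i).2
    have h2 := act_le_one (b * T) y arm t
    nlinarith [act_le_one (b * T) y arm t]
  have h1 := Finset.sum_le_sum hrest
  have h2 := Finset.sum_le_sum hstep
  rw [Finset.sum_add_distrib, Finset.sum_sub_distrib] at h1
  simp only [Finset.sum_add_distrib, ← Finset.mul_sum, ← Finset.sum_div] at h2
  have h3 : ∑ _t ∈ Finset.Icc 1 T, (1 : ℝ) = T := by simp
  have h4 : (∑ t ∈ Finset.Icc 1 T, ∑ j, v₂ j t) / b ≤ d * (w₂ * V2 C T) / b := by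
    gcongr
    rw [Finset.sum_comm]
    refine (Finset.sum_le_sum fun j _ => hv₂s j).trans ?_
    simp
  have h5 : (T : ℝ) - ∑ t ∈ Finset.Icc 1 T, A t ≤ 1 / b * (O + w₂ * V2 C T
        + 2 * totalRadius (b * T) T w₂ L₂ y arm p) := by
    rw [one_div, ← div_eq_inv_mul, le_div_iff₀ hb]
    linarith
  rw [h3] at h1
  have e : totalRadius (b * T) T w₁ L₁ y arm p
      = ∑ t ∈ Finset.Icc 1 T, A t * ∑ i, radius arm w₁ L₁ t i * p t i := rfl
  rw [e]
  linarith

/-! ### Martingale increments and exponential bounds -/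

variable {Ω : Type*} {mΩ : MeasurableSpace Ω} {P : Measure Ω}

/-- Almost surely bounded. -/
def AEBdd {_ : MeasurableSpace Ω} (P : Measure Ω) (f : Ω → ℝ) : Prop :=
  ∃ c, ∀ᵐ ω ∂P, |f ω| ≤ c

lemma AEBdd.const (c : ℝ) : AEBdd P fun _ => c := ⟨|c|, ae_of_all _ fun _ => le_rfl⟩

lemma AEBdd.mul {f g : Ω → ℝ} (hf : AEBdd P f) (hg : AEBdd P g) :
    AEBdd P fun ω => f ω * g ω := by
  obtain ⟨c, hc⟩ := hf
  obtain ⟨c', hc'⟩ := hg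
  refine ⟨c * c', ?_⟩
  filter_upwards [hc, hc'] with ω h h'
  rw [abs_mul]
  exact mul_le_mul h h' (abs_nonneg _) ((abs_nonneg _).trans h)

lemma AEBdd.add {f g : Ω → ℝ} (hf : AEBdd P f) (hg : AEBdd P g) :
    AEBdd P fun ω => f ω + g ω := by
  obtain ⟨c, hc⟩ := hf
  obtain ⟨c', hc'⟩ := hg
  refine ⟨c + c', ?_⟩
  filter_upwards [hc, hc'] with ω h h'
  exact (abs_add_le _ _).trans (add_le_add h h')

lemma AEBdd.neg {f : Ω → ℝ} (hf : AEBdd P f) : AEBdd P fun ω => -f ω := by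
  obtain ⟨c, hc⟩ := hf
  exact ⟨c, by filter_upwards [hc] with ω h; rwa [abs_neg]⟩

lemma AEBdd.sub {f g : Ω → ℝ} (hf : AEBdd P f) (hg : AEBdd P g) :
    AEBdd P fun ω => f ω - g ω := by
  simpa only [sub_eq_add_neg] using hf.add hg.neg

lemma AEBdd.sum {ι : Type*} {s : Finset ι} {f : ι → Ω → ℝ} (hf : ∀ i ∈ s, AEBdd P (f i)) :
    AEBdd P fun ω => ∑ i ∈ s, f i ω := by
  classical
  induction s using Finset.induction_on with
  | empty => simpa using AEBdd.const 0
  | insert a s ha ih =>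
    simp only [Finset.sum_insert ha]
    exact (hf a (Finset.mem_insert_self a s)).add
      (ih fun i hi => hf i (Finset.mem_insert_of_mem hi))

lemma AEBdd.exp {f : Ω → ℝ} (hf : AEBdd P f) : AEBdd P fun ω => Real.exp (f ω) := by
  obtain ⟨c, hc⟩ := hf
  refine ⟨Real.exp c, ?_⟩
  filter_upwards [hc] with ω h
  rw [abs_of_pos (Real.exp_pos _)]
  exact Real.exp_le_exp.2 ((le_abs_self _).trans h)

lemma AEBdd.of_mem_Icc {f : Ω → ℝ} (hf : ∀ᵐ ω ∂P, f ω ∈ Set.Icc (0 : ℝ) 1) : AEBdd P f := by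
  refine ⟨1, ?_⟩
  filter_upwards [hf] with ω h
  exact abs_le.2 ⟨by linarith [h.1], h.2⟩

lemma AEBdd.integrable [IsFiniteMeasure P] {f : Ω → ℝ} (hf : AEBdd P f) (hm : Measurable f) :
    Integrable f P := by
  obtain ⟨c, hc⟩ := hf
  exact Integrable.of_bound hm.aestronglyMeasurable c hc

/-- `D` is orthogonal to all bounded functions that are measurable with respect to `m`. -/
def IsIncrement {_ : MeasurableSpace Ω} (P : Measure Ω) (m : MeasurableSpace Ω) (D : Ω → ℝ) :
    Prop :=
  ∀ Z : Ω → ℝ, Measurable[m] Z → AEBdd P Z → ∫ ω, Z ω * D ω ∂P = 0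

lemma IsIncrement.mono {m m' : MeasurableSpace Ω} {D : Ω → ℝ} (h : IsIncrement P m D)
    (hm : m' ≤ m) : IsIncrement P m' D := fun Z hZ hb => h Z (hZ.mono hm le_rfl) hb

lemma IsIncrement.mul {m : MeasurableSpace Ω} {D W : Ω → ℝ} (h : IsIncrement P m D)
    (hW : Measurable[m] W) (hb : AEBdd P W) : IsIncrement P m fun ω => W ω * D ω := by
  intro Z hZ hZb
  simpa only [mul_assoc] using h (fun ω => Z ω * W ω) (hZ.mul hW) (hZb.mul hb)

lemma IsIncrement.add [IsFiniteMeasure P] {m : MeasurableSpace Ω} {D D' : Ω → ℝ} (hm : m ≤ mΩ)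
    (h : IsIncrement P m D) (h' : IsIncrement P m D')
    (hD : Measurable[mΩ] D) (hDb : AEBdd P D) (hD' : Measurable[mΩ] D') (hDb' : AEBdd P D') :
    IsIncrement P m fun ω => D ω + D' ω := by
  intro Z hZ hZb
  have hZ' : Measurable[mΩ] Z := hZ.mono hm le_rfl
  simp only [mul_add]
  rw [integral_add ((hZb.mul hDb).integrable (hZ'.mul hD))
    ((hZb.mul hDb').integrable (hZ'.mul hD')), h Z hZ hZb, h' Z hZ hZb, add_zero]

lemma IsIncrement.sum [IsFiniteMeasure P] {ι : Type*} {s : Finset ι} {m : MeasurableSpace Ω}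
    {D : ι → Ω → ℝ} (hm : m ≤ mΩ) (h : ∀ i ∈ s, IsIncrement P m (D i))
    (hD : ∀ i ∈ s, Measurable[mΩ] (D i)) (hDb : ∀ i ∈ s, AEBdd P (D i)) :
    IsIncrement P m fun ω => ∑ i ∈ s, D i ω := by
  intro Z hZ hZb
  have hZ' : Measurable[mΩ] Z := hZ.mono hm le_rfl
  simp only [Finset.mul_sum]
  rw [integral_finsetSum _ fun i hi => (hZb.mul (hDb i hi)).integrable (hZ'.mul (hD i hi))]
  exact Finset.sum_eq_zero fun i hi => h i hi Z hZ hZb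

lemma IsIncrement.integral_eq_zero {m : MeasurableSpace Ω} {D : Ω → ℝ} (h : IsIncrement P m D) :
    ∫ ω, D ω ∂P = 0 := by
  simpa using h (fun _ => 1) measurable_const (AEBdd.const 1)

/-- The chord of the convex exponential on `[-l, l]`, with `cosh l ≤ exp (l ^ 2 / 2)`, gives a bound
affine in `x`, whose linear part vanishes against a martingale increment. For `u = 0` nothing is
observed and nothing is compensated. -/
lemma exp_mul_sub_le {l x u : ℝ} (hu : u = 0 ∨ u = 1) (hx : |x| ≤ u) :
    Real.exp (l * x - l ^ 2 / 2 * u) ≤ 1 + Real.exp (-(l ^ 2 / 2)) * Real.sinh l * x := by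
  rcases hu with rfl | rfl
  · have : x = 0 := abs_nonpos_iff.1 hx
    simp [this]
  · have hx' := abs_le.1 hx
    have h1 := convexOn_exp.2 (Set.mem_univ l) (Set.mem_univ (-l))
      (show 0 ≤ (1 + x) / 2 by linarith) (show 0 ≤ (1 - x) / 2 by linarith) (by ring)
    simp only [smul_eq_mul] at h1
    have e1 : (1 + x) / 2 * l + (1 - x) / 2 * -l = l * x := by ring
    have e2 : (1 + x) / 2 * Real.exp l + (1 - x) / 2 * Real.exp (-l)
        = Real.cosh l + x * Real.sinh l := by
      rw [Real.cosh_eq, Real.sinh_eq]; ring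
    rw [e1, e2] at h1
    have h2 := Real.cosh_le_exp_half_sq l
    have h3 : Real.exp (-(l ^ 2 / 2)) * Real.exp (l ^ 2 / 2) = 1 := by
      rw [← Real.exp_add]; simp
    have h4 := Real.exp_pos (-(l ^ 2 / 2))
    rw [mul_one, sub_eq_add_neg, Real.exp_add]
    nlinarith [mul_le_mul_of_nonneg_right h1 h4.le, mul_le_mul_of_nonneg_left h2 h4.le]

/-- The exponential supermartingale of increments `D s` with `|D s| ≤ u s ∈ {0, 1}`. -/
lemma integral_exp_le_one [IsProbabilityMeasure P] {m : ℕ → MeasurableSpace Ω}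
    (hm : ∀ s, m s ≤ mΩ) {D u : ℕ → Ω → ℝ} {a b : ℕ}
    (hD : ∀ s ∈ Finset.Ico a b, Measurable (D s)) (hu : ∀ s ∈ Finset.Ico a b, Measurable (u s))
    (hDm : ∀ s ∈ Finset.Ico a b, ∀ t ∈ Finset.Ico a b, s < t → Measurable[m t] (D s))
    (hum : ∀ s ∈ Finset.Ico a b, ∀ t ∈ Finset.Ico a b, s < t → Measurable[m t] (u s))
    (hu01 : ∀ s ∈ Finset.Ico a b, ∀ ω, u s ω = 0 ∨ u s ω = 1)
    (hDu : ∀ s ∈ Finset.Ico a b, ∀ᵐ ω ∂P, |D s ω| ≤ u s ω)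
    (hinc : ∀ s ∈ Finset.Ico a b, IsIncrement P (m s) (D s)) (l : ℝ) :
    AEBdd P (fun ω => Real.exp (l * ∑ s ∈ Finset.Ico a b, D s ω
      - l ^ 2 / 2 * ∑ s ∈ Finset.Ico a b, u s ω)) ∧
    Measurable (fun ω => Real.exp (l * ∑ s ∈ Finset.Ico a b, D s ω
      - l ^ 2 / 2 * ∑ s ∈ Finset.Ico a b, u s ω)) ∧
    ∫ ω, Real.exp (l * ∑ s ∈ Finset.Ico a b, D s ω - l ^ 2 / 2 * ∑ s ∈ Finset.Ico a b, u s ω) ∂P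
      ≤ 1 := by
  have hub : ∀ s ∈ Finset.Ico a b, AEBdd P (u s) := fun s hs =>
    AEBdd.of_mem_Icc (ae_of_all _ fun ω => by rcases hu01 s hs ω with h | h <;> simp [h])
  have hDb : ∀ s ∈ Finset.Ico a b, AEBdd P (D s) := by
    intro s hs
    refine ⟨1, ?_⟩
    filter_upwards [hDu s hs] with ω h
    rcases hu01 s hs ω with h' | h' <;> rw [h'] at h <;> linarith
  refine ⟨(((AEBdd.const l).mul (AEBdd.sum hDb)).sub
      ((AEBdd.const _).mul (AEBdd.sum hub))).exp,
    (((Finset.measurable_sum _ hD).const_mul _).sub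
      ((Finset.measurable_sum _ hu).const_mul _)).exp, ?_⟩
  induction b with
  | zero => simp
  | succ b ih =>
    by_cases hab : a ≤ b
    swap
    · rw [Finset.Ico_eq_empty (by omega)]; simp
    have hsub : ∀ s ∈ Finset.Ico a b, s ∈ Finset.Ico a (b + 1) := fun s hs =>
      Finset.Ico_subset_Ico_right (Nat.le_succ b) hs
    have hb : b ∈ Finset.Ico a (b + 1) := by simp [hab]
    have ih' := ih (fun s hs => hD s (hsub s hs)) (fun s hs => hu s (hsub s hs))
      (fun s hs t ht => hDm s (hsub s hs) t (hsub t ht))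
      (fun s hs t ht => hum s (hsub s hs) t (hsub t ht)) (fun s hs => hu01 s (hsub s hs))
      (fun s hs => hDu s (hsub s hs)) (fun s hs => hinc s (hsub s hs))
      (fun s hs => hub s (hsub s hs)) (fun s hs => hDb s (hsub s hs))
    set Z : Ω → ℝ := fun ω => Real.exp (l * ∑ s ∈ Finset.Ico a b, D s ω
      - l ^ 2 / 2 * ∑ s ∈ Finset.Ico a b, u s ω) with hZ
    have hZb : AEBdd P Z := (((AEBdd.const l).mul (AEBdd.sum fun s hs => hDb s (hsub s hs))).sub
      ((AEBdd.const _).mul (AEBdd.sum fun s hs => hub s (hsub s hs)))).exp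
    have hZm : Measurable[m b] Z := by
      refine Measurable.exp (Measurable.sub ?_ ?_)
      · exact (Finset.measurable_sum _ fun s hs =>
          hDm s (hsub s hs) b hb (Finset.mem_Ico.1 hs).2).const_mul _
      · exact (Finset.measurable_sum _ fun s hs =>
          hum s (hsub s hs) b hb (Finset.mem_Ico.1 hs).2).const_mul _
    have hZm' : Measurable Z := hZm.mono (hm b) le_rfl
    set κ := Real.exp (-(l ^ 2 / 2)) * Real.sinh l with hκ
    have hZi : Integrable Z P := hZb.integrable hZm'
    have hZDi : Integrable (fun ω => Z ω * D b ω) P :=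
      (hZb.mul (hDb b hb)).integrable (hZm'.mul (hD b hb))
    have hle : ∀ᵐ ω ∂P, Real.exp (l * ∑ s ∈ Finset.Ico a (b + 1), D s ω
        - l ^ 2 / 2 * ∑ s ∈ Finset.Ico a (b + 1), u s ω) ≤ Z ω + κ * (Z ω * D b ω) := by
      filter_upwards [hDu b hb] with ω h
      rw [Finset.sum_Ico_succ_top hab, Finset.sum_Ico_succ_top hab]
      have e : l * (∑ s ∈ Finset.Ico a b, D s ω + D b ω)
          - l ^ 2 / 2 * (∑ s ∈ Finset.Ico a b, u s ω + u b ω)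
          = (l * ∑ s ∈ Finset.Ico a b, D s ω - l ^ 2 / 2 * ∑ s ∈ Finset.Ico a b, u s ω)
            + (l * D b ω - l ^ 2 / 2 * u b ω) := by ring
      rw [e, Real.exp_add]
      have h1 := mul_le_mul_of_nonneg_left (exp_mul_sub_le (l := l) (hu01 b hb ω) h)
        (Real.exp_pos (l * ∑ s ∈ Finset.Ico a b, D s ω
          - l ^ 2 / 2 * ∑ s ∈ Finset.Ico a b, u s ω)).le
      refine h1.trans (le_of_eq ?_)
      rw [hZ, hκ]; ring
    refine (integral_mono_of_nonneg (ae_of_all _ fun ω => (Real.exp_pos _).le)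
      (hZi.add (hZDi.const_mul κ)) hle).trans ?_
    have : ∫ ω, (Z + fun ω => κ * (Z ω * D b ω)) ω ∂P
        = ∫ ω, Z ω ∂P + κ * ∫ ω, Z ω * D b ω ∂P := by
      rw [← integral_const_mul]
      exact integral_add hZi (hZDi.const_mul κ)
    -- `Z` involves only earlier increments, so the new increment is orthogonal to it and the
    -- expectation does not grow.
    rw [this, hinc b hb Z hZm hZb, mul_zero, add_zero]
    exact ih'

/-! ### Measurability of the trajectories -/

section Measurability

variable {m d : ℕ} {y : ℕ → Ω → Outcome m d} {arm : ℕ → Ω → Fin m}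

lemma measurable_apply_arm {f : Ω → Fin m → ℝ} {a : Ω → Fin m}
    (hf : ∀ i, Measurable fun ω => f ω i) (ha : Measurable a) : Measurable fun ω => f ω (a ω) := by
  have : (fun ω => f ω (a ω)) = fun ω => ∑ i, if a ω = i then f ω i else 0 := by
    ext ω; simp
  rw [this]
  exact Finset.measurable_sum _ fun i _ =>
    Measurable.ite (ha (measurableSet_singleton i)) (hf i)
      measurable_const

lemma measurable_ite_arm {a : Ω → Fin m} (ha : Measurable a) (i : Fin m) :
    Measurable fun ω => if a ω = i then (1 : ℝ) else 0 :=
  Measurable.ite (ha (measurableSet_singleton i)) measurable_const measurable_const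

lemma measurable_act {B : ℝ} {t : ℕ} (hy : ∀ s ∈ Finset.Ico 1 t, Measurable (y s))
    (ha : ∀ s ∈ Finset.Ico 1 t, Measurable (arm s)) :
    Measurable fun ω => act B (fun s => y s ω) (fun s => arm s ω) t := by
  unfold act
  refine Measurable.ite ?_ measurable_const measurable_const
  simp only [Active]
  rw [Set.ofPred_forall]
  refine MeasurableSet.iInter fun j => measurableSet_le
    (Finset.measurable_sum _ fun s hs => ?_) measurable_const
  exact measurable_apply_arm (f := fun ω i => (y s ω).2 j i) (fun i => (measurable_pi_apply i).comp
    ((measurable_pi_apply j).comp (measurable_snd.comp (hy s hs)))) (ha s hs)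

lemma measurable_plays {w t : ℕ} (ha : ∀ s ∈ Finset.Ico 1 t, Measurable (arm s)) (i : Fin m) :
    Measurable fun ω => (plays (fun s => arm s ω) w t i : ℝ) := by
  simp only [plays_cast]
  exact Finset.measurable_sum _ fun s hs => measurable_ite_arm
    (ha s (by simp only [Finset.mem_Ico] at *; omega)) i

lemma measurable_radius {w t : ℕ} {L : ℝ} (ha : ∀ s ∈ Finset.Ico 1 t, Measurable (arm s))
    (i : Fin m) : Measurable fun ω => radius (fun s => arm s ω) w L t i := by
  unfold radius
  exact ((((measurable_plays ha i).add_const 1).const_div 2).mul_const L).sqrt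

end Measurability

/-! ### Runs of the algorithm -/

variable {m d T w₁ w₂ : ℕ} {b : ℝ}
  {E : Env m d} {y : ℕ → Ω → Outcome m d} {arm : ℕ → Ω → Fin m} {x : ℕ → Ω → Fin m → ℝ}

/-- Conditional probability, given the past, of playing arm `i` at period `t`. -/
noncomputable def condProb {mΩ : MeasurableSpace Ω} (P : Measure Ω) (y : ℕ → Ω → Outcome m d)
    (arm : ℕ → Ω → Fin m) (t : ℕ) (ω : Ω) (i : Fin m) : ℝ :=
  (P[Set.indicator {ω' | arm t ω' = i} (fun _ => (1 : ℝ)) | past y arm t]) ω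

lemma past_le (hy : ∀ t, Measurable (y t)) (ha : ∀ t, Measurable (arm t)) (t : ℕ) :
    past y arm t ≤ mΩ :=
  iSup₂_le fun s _ => sup_le (hy s).comap_le (ha s).comap_le

lemma measurable_outcome_past {s t : ℕ} (hs : s ∈ Finset.Ico 1 t) :
    Measurable[past y arm t] (y s) :=
  Measurable.of_comap_le (le_sup_left.trans (le_iSup₂_of_le s hs le_rfl))

lemma measurable_arm_past {s t : ℕ} (hs : s ∈ Finset.Ico 1 t) :
    Measurable[past y arm t] (arm s) :=
  Measurable.of_comap_le (le_sup_right.trans (le_iSup₂_of_le s hs le_rfl))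

lemma past_mono {s t : ℕ} (hst : s ≤ t) : past y arm s ≤ past y arm t :=
  biSup_mono fun _ hr => Finset.Ico_subset_Ico_right hst hr

lemma measurable_condProb_past (t : ℕ) (i : Fin m) :
    Measurable[past y arm t] fun ω => condProb P y arm t ω i :=
  stronglyMeasurable_condExp.measurable

lemma indicator_arm_eq (t : ℕ) (i : Fin m) :
    Set.indicator {ω' | arm t ω' = i} (fun _ => (1 : ℝ))
      = fun ω => if arm t ω = i then (1 : ℝ) else 0 := by
  ext ω; simp [Set.indicator_apply]

lemma aebdd_ite_arm (t : ℕ) (i : Fin m) :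
    AEBdd P fun ω => if arm t ω = i then (1 : ℝ) else 0 :=
  AEBdd.of_mem_Icc (ae_of_all _ fun ω => by split_ifs <;> simp)

lemma condProb_mem_Icc [IsProbabilityMeasure P] (hy : ∀ t, Measurable (y t))
    (ha : ∀ t, Measurable (arm t)) (t : ℕ) (i : Fin m) :
    ∀ᵐ ω ∂P, condProb P y arm t ω i ∈ Set.Icc (0 : ℝ) 1 := by
  have hi : Integrable (Set.indicator {ω' | arm t ω' = i} (fun _ => (1 : ℝ))) P := by
    rw [indicator_arm_eq]
    exact (aebdd_ite_arm t i).integrable (measurable_ite_arm (ha t) i)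
  have h1 : ∀ ω, Set.indicator {ω' | arm t ω' = i} (fun _ => (1 : ℝ)) ω ∈ Set.Icc (0 : ℝ) 1 := by
    intro ω
    rw [indicator_arm_eq]
    dsimp only
    split_ifs <;> simp
  have h2 := condExp_nonneg (m := past y arm t) (ae_of_all P fun ω => (h1 ω).1)
  have h3 := condExp_mono (m := past y arm t) hi (integrable_const (1 : ℝ))
    (ae_of_all P fun ω => (h1 ω).2)
  rw [condExp_const (past_le hy ha t)] at h3
  filter_upwards [h2, h3] with ω h2 h3
  exact ⟨h2, h3⟩

/-- By the pull-out property, a test function of the past may be moved inside the conditional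
expectation that defines `condProb`. -/
lemma isIncrement_draw [IsProbabilityMeasure P] (hy : ∀ t, Measurable (y t))
    (ha : ∀ t, Measurable (arm t)) (t : ℕ) (i : Fin m) :
    IsIncrement P (past y arm t)
      fun ω => (if arm t ω = i then (1 : ℝ) else 0) - condProb P y arm t ω i := by
  intro Z hZ hZb
  have hZ' : Measurable Z := hZ.mono (past_le hy ha t) le_rfl
  have hm := measurable_ite_arm (ha t) i
  have hpm : Measurable fun ω => condProb P y arm t ω i :=
    (measurable_condProb_past t i).mono (past_le hy ha t) le_rfl
  have hpb := AEBdd.of_mem_Icc (condProb_mem_Icc (P := P) hy ha t i)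
  have hf := (aebdd_ite_arm (P := P) (arm := arm) t i).integrable hm
  have hZf := (hZb.mul (aebdd_ite_arm (P := P) (arm := arm) t i)).integrable (hZ'.mul hm)
  have hpull := condExp_mul_of_stronglyMeasurable_left (m := past y arm t)
    hZ.stronglyMeasurable hZf hf
  simp only [mul_sub]
  rw [integral_sub hZf ((hZb.mul hpb).integrable (hZ'.mul hpm)), sub_eq_zero,
    ← integral_condExp (past_le hy ha t)]
  refine integral_congr_ae ?_
  filter_upwards [hpull] with ω h
  rw [condProb, indicator_arm_eq]
  exact h

lemma Env.integrable_of_mem_Icc (E : Env m d) {t : ℕ} {g : Outcome m d → ℝ} (hg : Measurable g)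
    (h : ∀ᵐ o ∂(E.law t), g o ∈ Set.Icc (0 : ℝ) 1) : Integrable g (E.law t) := by
  have := E.isProb t
  exact (AEBdd.of_mem_Icc h).integrable hg

lemma Env.integral_mem_Icc (E : Env m d) {t : ℕ} {g : Outcome m d → ℝ} (hg : Measurable g)
    (h : ∀ᵐ o ∂(E.law t), g o ∈ Set.Icc (0 : ℝ) 1) :
    ∫ o, g o ∂(E.law t) ∈ Set.Icc (0 : ℝ) 1 := by
  have := E.isProb t
  refine ⟨integral_nonneg_of_ae (h.mono fun _ ho => ho.1), ?_⟩
  have := integral_mono_ae (E.integrable_of_mem_Icc hg h) (integrable_const (1 : ℝ))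
    (h.mono fun _ ho => ho.2)
  simpa using this

lemma measurable_reward (i : Fin m) : Measurable fun o : Outcome m d => o.1 i :=
  (measurable_pi_apply i).comp measurable_fst

lemma measurable_consumption (j : Fin d) (i : Fin m) : Measurable fun o : Outcome m d => o.2 j i :=
  (measurable_pi_apply i).comp ((measurable_pi_apply j).comp measurable_snd)

lemma Env.reward_ae (E : Env m d) (t : ℕ) (i : Fin m) :
    ∀ᵐ o ∂(E.law t), o.1 i ∈ Set.Icc (0 : ℝ) 1 :=
  (E.reward_mem t).mono fun _ h => h i

lemma Env.consumption_ae (E : Env m d) (t : ℕ) (j : Fin d) (i : Fin m) :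
    ∀ᵐ o ∂(E.law t), o.2 j i ∈ Set.Icc (0 : ℝ) 1 :=
  (E.consumption_mem t).mono fun _ h => h j i

lemma Env.mu_mem (E : Env m d) (t : ℕ) (i : Fin m) : E.mu t i ∈ Set.Icc (0 : ℝ) 1 :=
  E.integral_mem_Icc (measurable_reward i) (E.reward_ae t i)

lemma Env.C_mem (E : Env m d) (t : ℕ) (j : Fin d) (i : Fin m) : E.C t j i ∈ Set.Icc (0 : ℝ) 1 :=
  E.integral_mem_Icc (measurable_consumption j i) (E.consumption_ae t j i)

lemma Env.C_null (E : Env m d) (t : ℕ) (j : Fin d) : E.C t j E.null = 0 :=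
  integral_eq_zero_of_ae ((E.null_consumption t).mono fun _ h => h j)

namespace IsRun

lemma ae_of_law (h : IsRun E b T w₁ w₂ P y arm x) {t : ℕ} (ht : t ∈ Finset.Icc 1 T)
    {p : Outcome m d → Prop} (hp : ∀ᵐ o ∂(E.law t), p o) : ∀ᵐ ω ∂P, p (y t ω) := by
  rw [← h.outcome_law t ht] at hp
  exact ae_of_ae_map (h.measurable_outcome t).aemeasurable hp

lemma measurable_act (h : IsRun E b T w₁ w₂ P y arm x) (B : ℝ) (t : ℕ) :
    Measurable fun ω => act B (fun s => y s ω) (fun s => arm s ω) t :=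
  BwK.measurable_act (fun s _ => h.measurable_outcome s) (fun s _ => h.measurable_arm s)

lemma aebdd_act (B : ℝ) (t : ℕ) :
    AEBdd P fun ω => act B (fun s => y s ω) (fun s => arm s ω) t :=
  AEBdd.of_mem_Icc (ae_of_all _ fun _ => ⟨act_nonneg _ _ _ _, act_le_one _ _ _ _⟩)

lemma past_le (h : IsRun E b T w₁ w₂ P y arm x) (t : ℕ) : past y arm t ≤ mΩ :=
  BwK.past_le h.measurable_outcome h.measurable_arm t

lemma played_le (h : IsRun E b T w₁ w₂ P y arm x) (t : ℕ) :
    past y arm t ⊔ MeasurableSpace.comap (arm t) inferInstance ≤ mΩ :=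
  sup_le (h.past_le t) (h.measurable_arm t).comap_le

lemma measurable_condProb (h : IsRun E b T w₁ w₂ P y arm x) (t : ℕ) (i : Fin m) :
    Measurable fun ω => condProb P y arm t ω i :=
  (measurable_condProb_past t i).mono (h.past_le t) le_rfl

lemma aebdd_condProb [IsProbabilityMeasure P] (h : IsRun E b T w₁ w₂ P y arm x) (t : ℕ)
    (i : Fin m) : AEBdd P fun ω => condProb P y arm t ω i :=
  AEBdd.of_mem_Icc (condProb_mem_Icc h.measurable_outcome h.measurable_arm t i)

lemma aebdd_comp (h : IsRun E b T w₁ w₂ P y arm x) {t : ℕ} (ht : t ∈ Finset.Icc 1 T)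
    {g : Outcome m d → ℝ} (hb : ∀ᵐ o ∂(E.law t), g o ∈ Set.Icc (0 : ℝ) 1) :
    AEBdd P fun ω => g (y t ω) :=
  AEBdd.of_mem_Icc (h.ae_of_law ht hb)

/-- Independence makes the expectation of the product factor. The current arm belongs to the
σ-algebra so that the indicator of the arm played may serve as a multiplier. -/
lemma isIncrement_outcome [IsProbabilityMeasure P] (h : IsRun E b T w₁ w₂ P y arm x) {t : ℕ}
    (ht : t ∈ Finset.Icc 1 T) {g : Outcome m d → ℝ} (hg : Measurable g)
    (hb : ∀ᵐ o ∂(E.law t), g o ∈ Set.Icc (0 : ℝ) 1) :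
    IsIncrement P (past y arm t ⊔ MeasurableSpace.comap (arm t) inferInstance)
      fun ω => g (y t ω) - ∫ o, g o ∂(E.law t) := by
  intro Z hZ hZb
  have hZ' : Measurable[mΩ] Z := hZ.mono (h.played_le t) le_rfl
  have hgm : Measurable fun ω => g (y t ω) := hg.comp (h.measurable_outcome t)
  have hgb := h.aebdd_comp ht hb
  have hint : ∫ ω, g (y t ω) ∂P = ∫ o, g o ∂(E.law t) := by
    rw [← h.outcome_law t ht]
    exact (integral_map (h.measurable_outcome t).aemeasurable hg.aestronglyMeasurable).symm
  have hind : IndepFun (fun ω => g (y t ω)) Z P := by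
    rw [IndepFun_iff_Indep]
    refine indep_of_indep_of_le_left (indep_of_indep_of_le_right (h.outcome_indep t ht)
      hZ.comap_le) ?_
    rw [← Function.comp_def, ← MeasurableSpace.comap_comp]
    exact MeasurableSpace.comap_mono hg.comap_le
  simp only [mul_sub]
  rw [integral_sub ((hZb.mul hgb).integrable (hZ'.mul hgm))
    ((hZb.mul (AEBdd.const _)).integrable (hZ'.mul measurable_const)), integral_mul_const,
    hind.symm.integral_fun_mul_eq_mul_integral hZ'.aestronglyMeasurable hgm.aestronglyMeasurable,
    hint, sub_self]

lemma measurable_ite_arm_played (t : ℕ) (i : Fin m) :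
    Measurable[past y arm t ⊔ MeasurableSpace.comap (arm t) inferInstance]
      fun ω => if arm t ω = i then (1 : ℝ) else 0 :=
  measurable_ite_arm (Measurable.of_comap_le le_sup_right) i

/-- The gain of the arm played, centred given the past, when gains lie in `[0, 1]`. -/
lemma isIncrement_play [IsProbabilityMeasure P] (h : IsRun E b T w₁ w₂ P y arm x) {t : ℕ}
    (ht : t ∈ Finset.Icc 1 T) {g : Fin m → Outcome m d → ℝ} (hg : ∀ i, Measurable (g i))
    (hb : ∀ i, ∀ᵐ o ∂(E.law t), g i o ∈ Set.Icc (0 : ℝ) 1) :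
    IsIncrement P (past y arm t) fun ω => g (arm t ω) (y t ω)
      - ∑ i, (∫ o, g i o ∂(E.law t)) * condProb P y arm t ω i := by
  have hgm : ∀ i, Measurable fun ω => g i (y t ω) := fun i =>
    (hg i).comp (h.measurable_outcome t)
  -- Two sources of noise: the outcome of the arm played, which is centred even given that arm, and
  -- the draw of the arm, weighted by the mean gains.
  have e : (fun ω => g (arm t ω) (y t ω)
      - ∑ i, (∫ o, g i o ∂(E.law t)) * condProb P y arm t ω i)
      = fun ω => ∑ i, ((if arm t ω = i then (1 : ℝ) else 0)
            * (g i (y t ω) - ∫ o, g i o ∂(E.law t))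
          + (∫ o, g i o ∂(E.law t))
            * ((if arm t ω = i then (1 : ℝ) else 0) - condProb P y arm t ω i)) := by
    ext ω
    have : ∑ i, (if arm t ω = i then (1 : ℝ) else 0) * g i (y t ω) = g (arm t ω) (y t ω) := by
      simp
    rw [← this, ← Finset.sum_sub_distrib]
    exact Finset.sum_congr rfl fun i _ => by ring
  have hi := fun i => measurable_ite_arm (h.measurable_arm t) i
  have hib := fun i => aebdd_ite_arm (P := P) (arm := arm) t i
  have m1 := fun i => (hi i).mul ((hgm i).sub_const (∫ o, g i o ∂(E.law t)))
  have b1 := fun i => (hib i).mul ((h.aebdd_comp ht (hb i)).sub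
    (AEBdd.const (∫ o, g i o ∂(E.law t))))
  have m2 := fun i => ((hi i).sub (h.measurable_condProb t i)).const_mul (∫ o, g i o ∂(E.law t))
  have b2 := fun i => (AEBdd.const (∫ o, g i o ∂(E.law t))).mul
    ((hib i).sub (h.aebdd_condProb t i))
  rw [e]
  refine IsIncrement.sum (h.past_le t) (fun i _ => ?_) (fun i _ => (m1 i).add (m2 i))
    (fun i _ => (b1 i).add (b2 i))
  refine IsIncrement.add (h.past_le t) ?_ ?_ (m1 i) (b1 i) (m2 i) (b2 i)
  · exact ((h.isIncrement_outcome ht (hg i) (hb i)).mul (measurable_ite_arm_played t i)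
      (hib i)).mono le_sup_left
  · exact (isIncrement_draw h.measurable_outcome h.measurable_arm t i).mul measurable_const
      (AEBdd.const _)

lemma measurable_act_past (B : ℝ) (t : ℕ) :
    Measurable[past y arm t] fun ω => act B (fun s => y s ω) (fun s => arm s ω) t :=
  BwK.measurable_act (fun _ hs => measurable_outcome_past hs) (fun _ hs => measurable_arm_past hs)

lemma measurable_play (h : IsRun E b T w₁ w₂ P y arm x) (t : ℕ) {g : Fin m → Outcome m d → ℝ}
    (hg : ∀ i, Measurable (g i)) : Measurable fun ω => g (arm t ω) (y t ω) :=
  measurable_apply_arm (f := fun ω i => g i (y t ω))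
    (fun i => (hg i).comp (h.measurable_outcome t)) (h.measurable_arm t)

lemma ae_play (h : IsRun E b T w₁ w₂ P y arm x) {t : ℕ} (ht : t ∈ Finset.Icc 1 T)
    {g : Fin m → Outcome m d → ℝ} (hb : ∀ i, ∀ᵐ o ∂(E.law t), g i o ∈ Set.Icc (0 : ℝ) 1) :
    ∀ᵐ ω ∂P, g (arm t ω) (y t ω) ∈ Set.Icc (0 : ℝ) 1 := by
  filter_upwards [ae_all_iff.2 fun i => h.ae_of_law ht (hb i)] with ω hω
  exact hω _

/-- Mean-zero fluctuation of the gains while playing. -/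
noncomputable def fluctuation {mΩ : MeasurableSpace Ω} (P : Measure Ω) (E : Env m d) (B : ℝ)
    (y : ℕ → Ω → Outcome m d) (arm : ℕ → Ω → Fin m) (g : Fin m → Outcome m d → ℝ) (t : ℕ)
    (ω : Ω) : ℝ :=
  act B (fun s => y s ω) (fun s => arm s ω) t * (g (arm t ω) (y t ω)
      - ∑ i, (∫ o, g i o ∂(E.law t)) * condProb P y arm t ω i)

lemma measurable_fluctuation (h : IsRun E b T w₁ w₂ P y arm x) {B : ℝ} {t : ℕ}
    {g : Fin m → Outcome m d → ℝ} (hg : ∀ i, Measurable (g i)) :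
    Measurable (fluctuation P E B y arm g t) :=
  (h.measurable_act B t).mul ((h.measurable_play t hg).sub
    (Finset.measurable_sum _ fun i _ => (h.measurable_condProb t i).const_mul _))

lemma aebdd_fluctuation [IsProbabilityMeasure P] (h : IsRun E b T w₁ w₂ P y arm x) {B : ℝ} {t : ℕ}
    (ht : t ∈ Finset.Icc 1 T) {g : Fin m → Outcome m d → ℝ}
    (hb : ∀ i, ∀ᵐ o ∂(E.law t), g i o ∈ Set.Icc (0 : ℝ) 1) :
    AEBdd P (fluctuation P E B y arm g t) :=
  (aebdd_act B t).mul ((AEBdd.of_mem_Icc (h.ae_play ht hb)).sub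
    (AEBdd.sum fun i _ => (AEBdd.const _).mul (h.aebdd_condProb t i)))

lemma isIncrement_fluctuation [IsProbabilityMeasure P] (h : IsRun E b T w₁ w₂ P y arm x) {B : ℝ}
    {t : ℕ} (ht : t ∈ Finset.Icc 1 T) {g : Fin m → Outcome m d → ℝ}
    (hg : ∀ i, Measurable (g i)) (hb : ∀ i, ∀ᵐ o ∂(E.law t), g i o ∈ Set.Icc (0 : ℝ) 1) :
    IsIncrement P (past y arm t) (fluctuation P E B y arm g t) :=
  (h.isIncrement_play ht hg hb).mul (measurable_act_past B t) (aebdd_act B t)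

lemma measurable_fluctuation_past {B : ℝ} {s t : ℕ}
    (hs : s ∈ Finset.Ico 1 t) {g : Fin m → Outcome m d → ℝ} (hg : ∀ i, Measurable (g i)) :
    Measurable[past y arm t] (fluctuation P E B y arm g s) := by
  have hst := past_mono (y := y) (arm := arm) (Finset.mem_Ico.1 hs).2.le
  refine ((measurable_act_past B s).mono hst le_rfl).mul (Measurable.sub ?_ ?_)
  · exact measurable_apply_arm (f := fun ω i => g i (y s ω))
      (fun i => (hg i).comp (measurable_outcome_past hs))
      (measurable_arm_past hs)
  · exact Finset.measurable_sum _ fun i _ =>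
      ((measurable_condProb_past s i).mono hst le_rfl).const_mul _

/-- While the algorithm plays, `condProb` coincides almost surely with `x t`. Working with
`condProb` supplies the measurability that a run does not ask of `x`. -/
lemma ae_optimal (h : IsRun E b T w₁ w₂ P y arm x) :
    ∀ᵐ ω ∂P, ∀ t ∈ Finset.Icc 1 T, Active (b * T) (fun s => y s ω) (fun s => arm s ω) t →
      StepOptimal (ucb T w₁ (fun s => y s ω) (fun s => arm s ω) t)
        (lcb T w₂ (fun s => y s ω) (fun s => arm s ω) t) b (condProb P y arm t ω) := by
  have h1 : ∀ᵐ ω ∂P, ∀ t, ∀ ht : t ∈ Finset.Icc 1 T, _ :=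
    ae_all_iff.2 fun t => ae_all_iff.2 fun ht => h.optimal t ht
  have h2 : ∀ᵐ ω ∂P, ∀ t, ∀ ht : t ∈ Finset.Icc 1 T, ∀ i, _ :=
    ae_all_iff.2 fun t => ae_all_iff.2 fun ht => ae_all_iff.2 fun i => h.draw t ht i
  filter_upwards [h1, h2] with ω h1 h2 t ht hact
  have e : condProb P y arm t ω = x t ω := funext fun i => h2 t ht i hact
  rw [e]
  exact h1 t ht hact

lemma abs_fluctuation_le [IsProbabilityMeasure P] (h : IsRun E b T w₁ w₂ P y arm x) {t : ℕ}
    (ht : t ∈ Finset.Icc 1 T) {g : Fin m → Outcome m d → ℝ} (hg : ∀ i, Measurable (g i))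
    (hb : ∀ i, ∀ᵐ o ∂(E.law t), g i o ∈ Set.Icc (0 : ℝ) 1) :
    ∀ᵐ ω ∂P, |fluctuation P E (b * T) y arm g t ω| ≤ 1 := by
  filter_upwards [h.ae_optimal, h.ae_play ht hb] with ω h1 h2
  by_cases ha : Active (b * T) (fun s => y s ω) (fun s => arm s ω) t
  · have hs := (h1 t ht ha).1.1
    have hI := fun i => E.integral_mem_Icc (hg i) (hb i)
    have h3 := sum_mul_le_of_mem_stdSimplex hs (fun i => (hI i).2)
    have h4 : 0 ≤ ∑ i, (∫ o, g i o ∂(E.law t)) * condProb P y arm t ω i :=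
      Finset.sum_nonneg fun i _ => mul_nonneg (hI i).1 (hs.1 i)
    rw [fluctuation, act, if_pos ha, one_mul]
    -- Both the gain and its conditional mean lie in `[0, 1]`. The latter uses that the drawing
    -- probabilities are in the simplex while playing.
    exact abs_le.2 ⟨by linarith [h2.1], by linarith [h2.2]⟩
  · simp [fluctuation, act, ha]

/-- Exponential moments of the total fluctuation. -/
lemma integral_exp_fluctuation_le [IsProbabilityMeasure P] (h : IsRun E b T w₁ w₂ P y arm x)
    {g : Fin m → Outcome m d → ℝ} (hg : ∀ i, Measurable (g i))
    (hb : ∀ t i, ∀ᵐ o ∂(E.law t), g i o ∈ Set.Icc (0 : ℝ) 1) (l : ℝ) :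
    Integrable (fun ω => Real.exp (l * ∑ t ∈ Finset.Icc 1 T,
      fluctuation P E (b * T) y arm g t ω - l ^ 2 / 2 * T)) P ∧
    ∫ ω, Real.exp (l * ∑ t ∈ Finset.Icc 1 T, fluctuation P E (b * T) y arm g t ω
      - l ^ 2 / 2 * T) ∂P ≤ 1 := by
  have e : Finset.Ico 1 (T + 1) = Finset.Icc 1 T := by
    ext; simp only [Finset.mem_Ico, Finset.mem_Icc]; omega
  have key := integral_exp_le_one (P := P) (m := fun s => past y arm s) h.past_le
    (D := fluctuation P E (b * T) y arm g) (u := fun _ _ => 1) (a := 1) (b := T + 1)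
    (fun s _ => h.measurable_fluctuation hg) (fun _ _ => measurable_const)
    (fun s hs t ht hst => measurable_fluctuation_past
      (Finset.mem_Ico.2 ⟨(Finset.mem_Ico.1 hs).1, hst⟩) hg)
    (fun _ _ _ _ _ => measurable_const) (fun _ _ _ => Or.inr rfl)
    (fun s hs => h.abs_fluctuation_le (e ▸ hs) hg (hb s))
    (fun s hs => h.isIncrement_fluctuation (e ▸ hs) hg (hb s)) l
  rw [e] at key
  simp only [Finset.sum_const, Nat.card_Icc, Nat.add_sub_cancel, nsmul_eq_mul, mul_one] at key
  exact ⟨key.1.integrable key.2.1, key.2.2⟩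

lemma integral_sum_fluctuation [IsProbabilityMeasure P] (h : IsRun E b T w₁ w₂ P y arm x)
    {g : Fin m → Outcome m d → ℝ} (hg : ∀ i, Measurable (g i))
    (hb : ∀ t i, ∀ᵐ o ∂(E.law t), g i o ∈ Set.Icc (0 : ℝ) 1) (B : ℝ) :
    ∫ ω, ∑ t ∈ Finset.Icc 1 T, fluctuation P E B y arm g t ω ∂P = 0 := by
  rw [integral_finsetSum _ fun t ht =>
    (h.aebdd_fluctuation ht (hb t)).integrable (h.measurable_fluctuation hg)]
  exact Finset.sum_eq_zero fun t ht =>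
    (h.isIncrement_fluctuation ht hg (hb t)).integral_eq_zero

end IsRun

/-! ### Expected total width of the confidence intervals -/

lemma radius_mem {m : ℕ} (arm : ℕ → Fin m) (w : ℕ) {L : ℝ} (hL : 0 ≤ L) (t : ℕ) (i : Fin m) :
    |radius arm w L t i| ≤ √(2 * L) := by
  rw [abs_of_nonneg (radius_nonneg _ _ _ _ _)]
  refine Real.sqrt_le_sqrt ?_
  have : (0 : ℝ) ≤ plays arm w t i := Nat.cast_nonneg _
  gcongr
  exact div_le_self (by norm_num) (by linarith)

lemma IsRun.integrable_totalRadius [IsProbabilityMeasure P] (h : IsRun E b T w₁ w₂ P y arm x)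
    {L : ℝ} (hL : 0 ≤ L) (w : ℕ) (B : ℝ) :
    Integrable (fun ω => totalRadius B T w L (fun s => y s ω) (fun s => arm s ω)
      (fun t => condProb P y arm t ω)) P := by
  refine AEBdd.integrable (AEBdd.sum fun t _ => (aebdd_act B t).mul (AEBdd.sum fun i _ =>
    AEBdd.mul ⟨√(2 * L), ae_of_all _ fun _ => radius_mem _ _ hL _ _⟩ (h.aebdd_condProb t i))) ?_
  exact Finset.measurable_sum _ fun t _ => (h.measurable_act B t).mul
    (Finset.measurable_sum _ fun i _ => (measurable_radius (fun s _ => h.measurable_arm s) i).mul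
      (h.measurable_condProb t i))

/-- Indicator and radius are determined by the past, so replacing the drawing probabilities by the
indicator of the arm drawn leaves the expectation unchanged. The widths of the arms played are then
bounded on every trajectory. -/
lemma IsRun.integral_totalRadius_le [IsProbabilityMeasure P] (h : IsRun E b T w₁ w₂ P y arm x)
    {L : ℝ} (hL : 0 ≤ L) {w : ℕ} (hw : 1 ≤ w) (hT : 1 ≤ T) (B : ℝ) :
    ∫ ω, totalRadius B T w L (fun s => y s ω) (fun s => arm s ω)
      (fun t => condProb P y arm t ω) ∂P ≤ 2 * √2 * (√(m * L * w) * ((T - 1) / w + 1 : ℕ)) := by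
  set D : ℕ → Fin m → Ω → ℝ := fun t i ω =>
    (act B (fun s => y s ω) (fun s => arm s ω) t * radius (fun s => arm s ω) w L t i)
      * ((if arm t ω = i then (1 : ℝ) else 0) - condProb P y arm t ω i) with hD
  have hDm : ∀ t i, Measurable (D t i) := fun t i =>
    ((h.measurable_act B t).mul (measurable_radius (fun s _ => h.measurable_arm s) i)).mul
      ((measurable_ite_arm (h.measurable_arm t) i).sub (h.measurable_condProb t i))
  have hWb : ∀ t i, AEBdd P fun ω => act B (fun s => y s ω) (fun s => arm s ω) t
      * radius (fun s => arm s ω) w L t i := fun t i =>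
    (aebdd_act B t).mul ⟨√(2 * L), ae_of_all _ fun _ => radius_mem _ _ hL _ _⟩
  have hDb : ∀ t i, AEBdd P (D t i) := fun t i =>
    (hWb t i).mul ((aebdd_ite_arm t i).sub (h.aebdd_condProb t i))
  have hD0 : ∀ t i, ∫ ω, D t i ω ∂P = 0 := fun t i =>
    ((isIncrement_draw h.measurable_outcome h.measurable_arm t i).mul
      ((measurable_act_past B t).mul (measurable_radius (fun _ hs => measurable_arm_past hs) i))
      (hWb t i)).integral_eq_zero
  have hsum0 : ∫ ω, ∑ t ∈ Finset.Icc 1 T, ∑ i, D t i ω ∂P = 0 := by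
    rw [integral_finsetSum _ fun t _ =>
      (AEBdd.sum fun i _ => hDb t i).integrable (Finset.measurable_sum _ fun i _ => hDm t i)]
    refine Finset.sum_eq_zero fun t _ => ?_
    rw [integral_finsetSum _ fun i _ => (hDb t i).integrable (hDm t i)]
    exact Finset.sum_eq_zero fun i _ => hD0 t i
  have hDi : Integrable (fun ω => ∑ t ∈ Finset.Icc 1 T, ∑ i, D t i ω) P :=
    (AEBdd.sum fun t _ => AEBdd.sum fun i _ => hDb t i).integrable
      (Finset.measurable_sum _ fun t _ => Finset.measurable_sum _ fun i _ => hDm t i)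
  have hRi := h.integrable_totalRadius hL w B
  have h1 := integral_add hRi hDi
  rw [hsum0, add_zero] at h1
  rw [← h1]
  have h2 : ∀ ω, totalRadius B T w L (fun s => y s ω) (fun s => arm s ω)
      (fun t => condProb P y arm t ω) + ∑ t ∈ Finset.Icc 1 T, ∑ i, D t i ω
      ≤ 2 * √2 * (√(m * L * w) * ((T - 1) / w + 1 : ℕ)) := by
    intro ω
    refine le_trans ?_ (sum_radius_le (fun s => arm s ω) hw hT hL)
    rw [totalRadius, ← Finset.sum_add_distrib]
    refine Finset.sum_le_sum fun t _ => ?_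
    have e : ∑ i, D t i ω = act B (fun s => y s ω) (fun s => arm s ω) t
          * radius (fun s => arm s ω) w L t (arm t ω)
        - act B (fun s => y s ω) (fun s => arm s ω) t
          * ∑ i, radius (fun s => arm s ω) w L t i * condProb P y arm t ω i := by
      simp only [hD, mul_sub, Finset.sum_sub_distrib, mul_ite, mul_one, mul_zero,
        Finset.sum_ite_eq, Finset.mem_univ, if_true, Finset.mul_sum, mul_assoc]
    rw [e]
    have := mul_le_of_le_one_left (radius_nonneg (fun s => arm s ω) w L t (arm t ω))
      (act_le_one B (fun s => y s ω) (fun s => arm s ω) t)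
    linarith
  refine (integral_mono (hRi.add hDi) (integrable_const _) h2).trans ?_
  simp

/-! ### Failure of the confidence bounds -/

/-- Nonnegative, and at least `1` if a confidence bound of arm `i` fails. -/
noncomputable def failure {m : ℕ} (arm : ℕ → Fin m) (z ζ : ℕ → ℝ) (w T : ℕ) (L : ℝ)
    (i : Fin m) : ℝ :=
  ∑ t ∈ Finset.Icc 1 T, ∑ k ∈ Finset.range T, Real.exp (1 / 2 - L) *
    (Real.exp (tilt L k * deviation arm z ζ w t i - tilt L k ^ 2 / 2 * plays arm w t i)
      + Real.exp (tilt L k * -deviation arm z ζ w t i - tilt L k ^ 2 / 2 * plays arm w t i))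

lemma failure_nonneg {m : ℕ} (arm : ℕ → Fin m) (z ζ : ℕ → ℝ) (w T : ℕ) (L : ℝ) (i : Fin m) :
    0 ≤ failure arm z ζ w T L i :=
  Finset.sum_nonneg fun t _ => Finset.sum_nonneg fun k _ => by positivity

/-- The best tilt depends on the random play count, but the supermartingale needs a constant one.
Summing over all possible counts `k < T` includes the term whose `k` is the realised count, and that
term alone reaches `1`. -/
lemma one_le_failure {m : ℕ} {arm : ℕ → Fin m} {z ζ : ℕ → ℝ} {w T : ℕ} {L : ℝ} (hL : 0 ≤ L)
    {i : Fin m} {t : ℕ} (ht : t ∈ Finset.Icc 1 T)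
    (h : √(2 * L * (plays arm w t i + 1)) < |deviation arm z ζ w t i| + 1) :
    1 ≤ failure arm z ζ w T L i := by
  have hk : plays arm w t i ∈ Finset.range T := Finset.mem_range.2 (plays_lt arm w ht i)
  have h1 := mul_le_mul_of_nonneg_left (exp_le_of_deviation hL h) (Real.exp_pos (1 / 2 - L)).le
  rw [← Real.exp_add, show 1 / 2 - L + (L - 1 / 2) = 0 by ring, Real.exp_zero] at h1
  refine h1.trans ?_
  refine le_trans ?_ (Finset.single_le_sum (f := fun t => ∑ k ∈ Finset.range T,
    Real.exp (1 / 2 - L) *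
    (Real.exp (tilt L k * deviation arm z ζ w t i - tilt L k ^ 2 / 2 * plays arm w t i)
      + Real.exp (tilt L k * -deviation arm z ζ w t i - tilt L k ^ 2 / 2 * plays arm w t i)))
    (fun t _ => Finset.sum_nonneg fun k _ => by positivity) ht)
  exact Finset.single_le_sum (f := fun k => Real.exp (1 / 2 - L) *
    (Real.exp (tilt L k * deviation arm z ζ w t i - tilt L k ^ 2 / 2 * plays arm w t i)
      + Real.exp (tilt L k * -deviation arm z ζ w t i - tilt L k ^ 2 / 2 * plays arm w t i)))
    (fun k _ => by positivity) hk

/-- There are `T ^ 2` pairs of period and count, with two exponentials each, all of mean at most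
`1`. -/
lemma IsRun.integral_failure_le [IsProbabilityMeasure P] (h : IsRun E b T w₁ w₂ P y arm x)
    {g : Outcome m d → ℝ} (hg : Measurable g)
    (hb : ∀ t, ∀ᵐ o ∂(E.law t), g o ∈ Set.Icc (0 : ℝ) 1) (w : ℕ) (L : ℝ) (i : Fin m) :
    Integrable (fun ω => failure (fun s => arm s ω) (fun s => g (y s ω))
      (fun s => ∫ o, g o ∂(E.law s)) w T L i) P ∧
    ∫ ω, failure (fun s => arm s ω) (fun s => g (y s ω))
      (fun s => ∫ o, g o ∂(E.law s)) w T L i ∂P ≤ 2 * T ^ 2 * Real.exp (1 / 2 - L) := by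
  have key : ∀ t ∈ Finset.Icc 1 T, ∀ l : ℝ,
      Integrable (fun ω => Real.exp (l * deviation (fun s => arm s ω) (fun s => g (y s ω))
        (fun s => ∫ o, g o ∂(E.law s)) w t i - l ^ 2 / 2 * plays (fun s => arm s ω) w t i)) P ∧
      ∫ ω, Real.exp (l * deviation (fun s => arm s ω) (fun s => g (y s ω))
        (fun s => ∫ o, g o ∂(E.law s)) w t i - l ^ 2 / 2 * plays (fun s => arm s ω) w t i) ∂P
        ≤ 1 := by
    intro t ht l
    have hwin : ∀ s ∈ Finset.Ico (max 1 (t - w)) t, s ∈ Finset.Icc 1 T := fun s hs => by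
      simp only [Finset.mem_Ico, Finset.mem_Icc] at *; omega
    have hlt : ∀ s ∈ Finset.Ico (max 1 (t - w)) t, ∀ r, s < r → s ∈ Finset.Ico 1 r :=
      fun s hs r hr => by simp only [Finset.mem_Ico] at *; omega
    have hgm : ∀ s, Measurable fun ω => g (y s ω) := fun s => hg.comp (h.measurable_outcome s)
    have e : ∀ s ω, (if arm s ω = i then g (y s ω) - ∫ o, g o ∂(E.law s) else 0)
        = (if arm s ω = i then (1 : ℝ) else 0) * (g (y s ω) - ∫ o, g o ∂(E.law s)) :=
      fun s ω => by split_ifs <;> simp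
    -- The σ-algebras contain the current arm, and `u` is the indicator of playing `i`, so the
    -- compensator counts the plays and not the periods.
    have h1 := integral_exp_le_one (P := P)
      (m := fun s => past y arm s ⊔ MeasurableSpace.comap (arm s) inferInstance) h.played_le
      (D := fun s ω => (if arm s ω = i then (1 : ℝ) else 0) * (g (y s ω) - ∫ o, g o ∂(E.law s)))
      (u := fun s ω => if arm s ω = i then (1 : ℝ) else 0) (a := max 1 (t - w)) (b := t)
      (fun s _ => (measurable_ite_arm (h.measurable_arm s) i).mul ((hgm s).sub_const _))
      (fun s _ => measurable_ite_arm (h.measurable_arm s) i)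
      (fun s hs r _ hsr => Measurable.mono (Measurable.mul
          (measurable_ite_arm (measurable_arm_past (hlt s hs r hsr)) i)
          ((hg.comp (measurable_outcome_past (hlt s hs r hsr))).sub_const _)) le_sup_left le_rfl)
      (fun s hs r _ hsr => Measurable.mono
          (measurable_ite_arm (measurable_arm_past (y := y) (hlt s hs r hsr)) i)
          le_sup_left le_rfl)
      (fun s _ ω => by split_ifs <;> simp)
      (fun s hs => by
        filter_upwards [h.ae_of_law (hwin s hs) (hb s)] with ω hω
        have hI := E.integral_mem_Icc hg (hb s)
        split_ifs
        · rw [one_mul]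
          exact abs_le.2 ⟨by linarith [hω.1, hI.2], by linarith [hω.2, hI.1]⟩
        · simp)
      (fun s hs => (h.isIncrement_outcome (hwin s hs) hg (hb s)).mul
        (IsRun.measurable_ite_arm_played s i) (aebdd_ite_arm s i)) l
    simp only [deviation, plays_cast, e]
    exact ⟨h1.1.integrable h1.2.1, h1.2.2⟩
  have key' : ∀ t ∈ Finset.Icc 1 T, ∀ l : ℝ,
      Integrable (fun ω => Real.exp (l * -deviation (fun s => arm s ω) (fun s => g (y s ω))
        (fun s => ∫ o, g o ∂(E.law s)) w t i - l ^ 2 / 2 * plays (fun s => arm s ω) w t i)) P ∧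
      ∫ ω, Real.exp (l * -deviation (fun s => arm s ω) (fun s => g (y s ω))
        (fun s => ∫ o, g o ∂(E.law s)) w t i - l ^ 2 / 2 * plays (fun s => arm s ω) w t i) ∂P
        ≤ 1 := by
    intro t ht l
    have := key t ht (-l)
    simpa only [neg_mul, mul_neg, even_two.neg_pow] using this
  have hint : ∀ t ∈ Finset.Icc 1 T, ∀ k ∈ Finset.range T, Integrable (fun ω =>
      Real.exp (1 / 2 - L) *
      (Real.exp (tilt L k * deviation (fun s => arm s ω) (fun s => g (y s ω))
        (fun s => ∫ o, g o ∂(E.law s)) w t i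
          - tilt L k ^ 2 / 2 * plays (fun s => arm s ω) w t i)
      + Real.exp (tilt L k * -deviation (fun s => arm s ω) (fun s => g (y s ω))
        (fun s => ∫ o, g o ∂(E.law s)) w t i
          - tilt L k ^ 2 / 2 * plays (fun s => arm s ω) w t i))) P := fun t ht k _ =>
    ((key t ht _).1.add (key' t ht _).1).const_mul _
  refine ⟨integrable_finsetSum _ fun t ht => integrable_finsetSum _ fun k hk => hint t ht k hk, ?_⟩
  simp only [failure]
  rw [integral_finsetSum _ fun t ht => integrable_finsetSum _ fun k hk => hint t ht k hk]
  have hterm : ∀ t ∈ Finset.Icc 1 T, ∫ ω, ∑ k ∈ Finset.range T, Real.exp (1 / 2 - L) *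
      (Real.exp (tilt L k * deviation (fun s => arm s ω) (fun s => g (y s ω))
        (fun s => ∫ o, g o ∂(E.law s)) w t i
          - tilt L k ^ 2 / 2 * plays (fun s => arm s ω) w t i)
      + Real.exp (tilt L k * -deviation (fun s => arm s ω) (fun s => g (y s ω))
        (fun s => ∫ o, g o ∂(E.law s)) w t i
          - tilt L k ^ 2 / 2 * plays (fun s => arm s ω) w t i)) ∂P
      ≤ ∑ _k ∈ Finset.range T, Real.exp (1 / 2 - L) * 2 := by
    intro t ht
    rw [integral_finsetSum _ fun k hk => hint t ht k hk]
    refine Finset.sum_le_sum fun k _ => ?_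
    rw [integral_const_mul, integral_add (key t ht _).1 (key' t ht _).1]
    refine mul_le_mul_of_nonneg_left ?_ (Real.exp_pos _).le
    linarith [(key t ht (tilt L k)).2, (key' t ht (tilt L k)).2]
  refine (Finset.sum_le_sum hterm).trans (le_of_eq ?_)
  simp only [Finset.sum_const, Nat.card_Icc, Nat.add_sub_cancel, Finset.card_range, nsmul_eq_mul]
  ring

/-! ### The regret bound -/

lemma norm_sub_le_one_of_mem_Icc {n : ℕ} {a c : Fin n → ℝ} (ha : ∀ i, a i ∈ Set.Icc (0 : ℝ) 1)
    (hc : ∀ i, c i ∈ Set.Icc (0 : ℝ) 1) : ‖a - c‖ ≤ 1 := by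
  refine (pi_norm_le_iff_of_nonneg zero_le_one).2 fun i => ?_
  rw [Pi.sub_apply, Real.norm_eq_abs]
  exact abs_le.2 ⟨by linarith [(ha i).1, (hc i).2], by linarith [(ha i).2, (hc i).1]⟩

lemma sum_Ico_le_of_le_one {f : ℕ → ℝ} (hf : ∀ t, f t ≤ 1) (T : ℕ) :
    ∑ t ∈ Finset.Ico 1 T, f t ≤ T := by
  refine (Finset.sum_le_sum fun t _ => hf t).trans ?_
  simp only [Finset.sum_const, Nat.card_Ico, nsmul_eq_mul, mul_one]
  exact_mod_cast Nat.sub_le T 1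

lemma V1_nonneg (mu : ℕ → Fin m → ℝ) (T : ℕ) : 0 ≤ V1 mu T :=
  Finset.sum_nonneg fun _ _ => norm_nonneg _

lemma V2_nonneg (C : ℕ → Fin d → Fin m → ℝ) (T : ℕ) : 0 ≤ V2 C T :=
  Real.iSup_nonneg fun _ => Finset.sum_nonneg fun _ _ => norm_nonneg _

lemma Env.V1_le (E : Env m d) (T : ℕ) : V1 E.mu T ≤ T :=
  sum_Ico_le_of_le_one (fun t => norm_sub_le_one_of_mem_Icc (E.mu_mem t) (E.mu_mem (t + 1))) T

lemma Env.V2_le (E : Env m d) (hd : 1 ≤ d) (T : ℕ) : V2 E.C T ≤ T := by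
  have : Nonempty (Fin d) := ⟨⟨0, hd⟩⟩
  exact ciSup_le fun j => sum_Ico_le_of_le_one
    (fun t => norm_sub_le_one_of_mem_Icc (E.C_mem t j) (E.C_mem (t + 1) j)) T

lemma W1_nonneg (mu : ℕ → Fin m → ℝ) (T : ℕ) : 0 ≤ W1 mu T :=
  Finset.sum_nonneg fun _ _ => norm_nonneg _

lemma W2_nonneg (C : ℕ → Fin d → Fin m → ℝ) (T : ℕ) : 0 ≤ W2 C T :=
  Finset.sum_nonneg fun _ _ => Real.iSup_nonneg fun _ => Finset.sum_nonneg fun _ _ => abs_nonneg _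

lemma norm_le_qbar {q : Fin d → ℝ} {qs : ℕ → Fin d → ℝ} {t : ℕ} (ht : t ∈ Finset.Icc 1 T) :
    ‖qs t‖ ≤ qbar T q qs := by
  refine le_trans ?_ (le_max_right _ _)
  exact_mod_cast Finset.le_sup (f := fun t => ‖qs t‖₊) ht

/-- Upper bound for the positive part of the overspending of all resources. -/
noncomputable def overspendBound {mΩ : MeasurableSpace Ω} (P : Measure Ω) (E : Env m d) (b : ℝ)
    (T : ℕ) (L : ℝ) (y : ℕ → Ω → Outcome m d) (arm : ℕ → Ω → Fin m) (ω : Ω) : ℝ :=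
  √T * (L + ∑ j, Real.exp (1 / √T * overspend (b * T) T E.C (fun s => y s ω) (fun s => arm s ω)
    (fun t => condProb P y arm t ω) j - L))

lemma overspend_eq_sum_fluctuation (B : ℝ) (j : Fin d) (ω : Ω) :
    overspend B T E.C (fun s => y s ω) (fun s => arm s ω) (fun t => condProb P y arm t ω) j
      = ∑ t ∈ Finset.Icc 1 T, IsRun.fluctuation P E B y arm (fun i o => o.2 j i) t ω := rfl

/-- From `x + 1 ≤ exp x`, `x ≤ L + exp (x - L)`. Summing the exponentials gives one bound for all
resources. -/
lemma overspend_le_overspendBound (hT : 1 ≤ T) (L : ℝ) (j : Fin d) (ω : Ω) :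
    overspend (b * T) T E.C (fun s => y s ω) (fun s => arm s ω)
      (fun t => condProb P y arm t ω) j ≤ overspendBound P E b T L y arm ω := by
  have hT0 : 0 < √(T : ℝ) := Real.sqrt_pos.2 (by exact_mod_cast hT)
  rw [overspendBound]
  set o := fun j => overspend (b * T) T E.C (fun s => y s ω) (fun s => arm s ω)
      (fun t => condProb P y arm t ω) j with ho
  have h1 := Finset.single_le_sum (f := fun j => Real.exp (1 / √T * o j - L))
    (fun j _ => (Real.exp_pos _).le) (Finset.mem_univ j)
  have h2 := Real.add_one_le_exp (1 / √T * o j - L)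
  have h3 : √T * (1 / √T * o j) = o j := by field_simp
  have h4 : √T * (1 / √T * o j) ≤ √T * (L + ∑ j, Real.exp (1 / √T * o j - L)) := by
    refine mul_le_mul_of_nonneg_left ?_ hT0.le
    linarith
  rwa [h3] at h4

/-- At the tilt `1 / √T` the compensator over `T` periods is exactly `1 / 2`, whence the exponent `1
/ 2 - L` for each resource. -/
lemma IsRun.integral_overspendBound_le [IsProbabilityMeasure P]
    (h : IsRun E b T w₁ w₂ P y arm x) (hT : 1 ≤ T) (L : ℝ) :
    Integrable (overspendBound P E b T L y arm) P ∧
    ∫ ω, overspendBound P E b T L y arm ω ∂P ≤ √T * (L + d * Real.exp (1 / 2 - L)) := by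
  have hT0 : (0 : ℝ) < T := by exact_mod_cast hT
  have key := fun j => h.integral_exp_fluctuation_le (g := fun i o => o.2 j i)
    (fun i => measurable_consumption j i) (fun t i => E.consumption_ae t j i) (1 / √T)
  have e : ∀ j ω, Real.exp (1 / √T * overspend (b * T) T E.C (fun s => y s ω) (fun s => arm s ω)
      (fun t => condProb P y arm t ω) j - L)
      = Real.exp (1 / 2 - L) * Real.exp (1 / √T * ∑ t ∈ Finset.Icc 1 T,
        IsRun.fluctuation P E (b * T) y arm (fun i o => o.2 j i) t ω - (1 / √T) ^ 2 / 2 * T) := by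
    intro j ω
    rw [overspend_eq_sum_fluctuation, ← Real.exp_add]
    congr 1
    rw [div_pow, Real.sq_sqrt hT0.le]
    field_simp
    ring
  have hi : ∀ j, Integrable (fun ω => Real.exp (1 / √T * overspend (b * T) T E.C
      (fun s => y s ω) (fun s => arm s ω) (fun t => condProb P y arm t ω) j - L)) P := fun j => by
    simp only [e]; exact (key j).1.const_mul _
  have hs : Integrable (fun ω => ∑ j, Real.exp (1 / √T * overspend (b * T) T E.C
      (fun s => y s ω) (fun s => arm s ω) (fun t => condProb P y arm t ω) j - L)) P :=
    integrable_finsetSum _ fun j _ => hi j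
  refine ⟨((integrable_const L).add hs).const_mul _, ?_⟩
  simp only [overspendBound]
  rw [integral_const_mul, integral_add (integrable_const L) hs, integral_const,
    integral_finsetSum _ fun j _ => hi j]
  simp only [probReal_univ, one_smul]
  refine mul_le_mul_of_nonneg_left (add_le_add_right ?_ L) (Real.sqrt_nonneg _)
  have hj : ∀ j ∈ (Finset.univ : Finset (Fin d)), ∫ ω, Real.exp (1 / √T * overspend (b * T) T E.C
      (fun s => y s ω) (fun s => arm s ω) (fun t => condProb P y arm t ω) j - L) ∂P
      ≤ Real.exp (1 / 2 - L) := by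
    intro j _
    simp only [e]
    rw [integral_const_mul]
    exact mul_le_of_le_one_right (Real.exp_pos _).le (key j).2
  refine (Finset.sum_le_sum hj).trans ?_
  simp

lemma IsRun.integrable_totalReward [IsProbabilityMeasure P] (h : IsRun E b T w₁ w₂ P y arm x)
    (B : ℝ) : Integrable (fun ω => totalReward B T (fun s => y s ω) (fun s => arm s ω)) P := by
  have h1 : Integrable (fun ω => ∑ t ∈ Finset.Icc 1 T,
      act B (fun s => y s ω) (fun s => arm s ω) (t + 1) * (y t ω).1 (arm t ω)) P := by
    refine AEBdd.integrable (AEBdd.sum fun t ht => (aebdd_act B (t + 1)).mul ?_)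
      (Finset.measurable_sum _ fun t _ => (h.measurable_act B (t + 1)).mul ?_)
    · exact AEBdd.of_mem_Icc (h.ae_play ht (g := fun i o => o.1 i) (E.reward_ae t))
    · exact h.measurable_play t (g := fun i o => o.1 i) measurable_reward
  refine h1.congr ?_
  have h2 : ∀ᵐ ω ∂P, ∀ t, ∀ ht : t ∈ Finset.Icc 1 T, ∀ j i, (y t ω).2 j i ∈ Set.Icc (0 : ℝ) 1 :=
    ae_all_iff.2 fun t => ae_all_iff.2 fun ht => h.ae_of_law ht (E.consumption_mem t)
  filter_upwards [h2] with ω h2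
  exact (totalReward_eq fun t ht j i => (h2 t ht j i).1).symm

/-- The optimal values of the single-step programs against the reward collected, almost surely. -/
lemma IsRun.ae_sum_value_le (h : IsRun E b T w₁ w₂ P y arm x) (hb : 0 < b) (hT : 1 ≤ T)
    (hL₁ : 0 ≤ Real.log (12 * m * T ^ 3)) (hL₂ : 0 ≤ Real.log (12 * m * d * T ^ 3))
    {xs : ℕ → Fin m → ℝ} (hxs : ∀ t ∈ Finset.Icc 1 T, StepFeasible (E.C t) b (xs t)) :
    ∀ᵐ ω ∂P, ∑ t ∈ Finset.Icc 1 T, ∑ i, E.mu t i * xs t i ≤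
      totalReward (b * T) T (fun s => y s ω) (fun s => arm s ω)
      - ∑ t ∈ Finset.Icc 1 T, IsRun.fluctuation P E (b * T) y arm (fun i o => o.1 i) t ω
      + 2 * totalRadius (b * T) T w₁ (Real.log (12 * m * T ^ 3)) (fun s => y s ω)
          (fun s => arm s ω) (fun t => condProb P y arm t ω)
      + 1 / b * overspendBound P E b T (Real.log (12 * m * d * T ^ 3)) y arm ω
      + 2 / b * totalRadius (b * T) T w₂ (Real.log (12 * m * d * T ^ 3)) (fun s => y s ω)
          (fun s => arm s ω) (fun t => condProb P y arm t ω)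
      + T * ∑ i, failure (fun s => arm s ω) (fun s => (y s ω).1 i) (fun s => E.mu s i) w₁ T
          (Real.log (12 * m * T ^ 3)) i
      + T * ∑ j, ∑ i, failure (fun s => arm s ω) (fun s => (y s ω).2 j i) (fun s => E.C s j i) w₂ T
          (Real.log (12 * m * d * T ^ 3)) i
      + (1 + 2 * (w₁ * V1 E.mu T) + d * (w₂ * V2 E.C T) / b + 1 / b * (w₂ * V2 E.C T)) := by
  have hr : ∀ᵐ ω ∂P, ∀ t, ∀ ht : t ∈ Finset.Icc 1 T, ∀ i, (y t ω).1 i ∈ Set.Icc (0 : ℝ) 1 :=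
    ae_all_iff.2 fun t => ae_all_iff.2 fun ht => h.ae_of_law ht (E.reward_mem t)
  have hc : ∀ᵐ ω ∂P, ∀ t, ∀ ht : t ∈ Finset.Icc 1 T, ∀ j i, (y t ω).2 j i ∈ Set.Icc (0 : ℝ) 1 :=
    ae_all_iff.2 fun t => ae_all_iff.2 fun ht => h.ae_of_law ht (E.consumption_mem t)
  have hc0 : ∀ᵐ ω ∂P, ∀ t, ∀ ht : t ∈ Finset.Icc 1 T, ∀ j, (y t ω).2 j E.null = 0 :=
    ae_all_iff.2 fun t => ae_all_iff.2 fun ht => h.ae_of_law ht (E.null_consumption t)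
  filter_upwards [hr, hc, hc0, h.ae_optimal] with ω hr hc hc0 hopt
  set Y : ℕ → Outcome m d := fun s => y s ω
  set I : ℕ → Fin m := fun s => arm s ω
  set p : ℕ → Fin m → ℝ := fun t => condProb P y arm t ω with hp
  set L₁ := Real.log (12 * m * T ^ 3)
  set L₂ := Real.log (12 * m * d * T ^ 3)
  set O := overspendBound P E b T L₂ y arm ω with hO
  set R₁ := totalRadius (b * T) T w₁ L₁ Y I p with hR₁
  set R₂ := totalRadius (b * T) T w₂ L₂ Y I p with hR₂
  set F₁ : ℝ := ∑ i, failure I (fun s => (Y s).1 i) (fun s => E.mu s i) w₁ T L₁ i with hF₁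
  set F₂ : ℝ := ∑ j, ∑ i, failure I (fun s => (Y s).2 j i) (fun s => E.C s j i) w₂ T L₂ i with hF₂
  have hO0 : 0 ≤ O := mul_nonneg (Real.sqrt_nonneg _)
    (add_nonneg hL₂ (Finset.sum_nonneg fun _ _ => (Real.exp_pos _).le))
  have hR0 : ∀ w L, 0 ≤ totalRadius (b * T) T w L Y I p := by
    intro w L
    refine Finset.sum_nonneg fun t ht => ?_
    by_cases ha : Active (b * T) Y I t
    · exact mul_nonneg (act_nonneg _ _ _ _) (Finset.sum_nonneg fun i _ =>
        mul_nonneg (radius_nonneg _ _ _ _ _) ((hopt t ht ha).1.1.1 i))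
    · simp [act, ha]
  have hF₁0 : 0 ≤ F₁ := Finset.sum_nonneg fun _ _ => failure_nonneg _ _ _ _ _ _ _
  have hF₂0 : 0 ≤ F₂ := Finset.sum_nonneg fun _ _ => Finset.sum_nonneg fun _ _ =>
    failure_nonneg _ _ _ _ _ _ _
  have hT0 : (0 : ℝ) ≤ T := Nat.cast_nonneg _
  have hTF₁ := mul_nonneg hT0 hF₁0
  have hTF₂ := mul_nonneg hT0 hF₂0
  have hflu : ∑ t ∈ Finset.Icc 1 T, IsRun.fluctuation P E (b * T) y arm (fun i o => o.1 i) t ω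
      = ∑ t ∈ Finset.Icc 1 T, act (b * T) Y I t * (Y t).1 (I t)
        - ∑ t ∈ Finset.Icc 1 T, act (b * T) Y I t * ∑ i, E.mu t i * p t i := by
    rw [← Finset.sum_sub_distrib]
    exact Finset.sum_congr rfl fun t _ => mul_sub _ _ _
  have hrew := sum_act_le_totalReward_add_one (B := b * T) (y := Y) (arm := I)
    (fun t ht j i => (hc t ht j i).1) (fun t ht i => (hr t ht i).2)
  have hR₁0 : 0 ≤ R₁ := hR0 w₁ L₁
  have hR₂0 : 0 ≤ R₂ := hR0 w₂ L₂
  have e2 : 1 / b * (O + w₂ * V2 E.C T + 2 * R₂)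
      = 1 / b * O + 2 / b * R₂ + 1 / b * (w₂ * V2 E.C T) := by ring
  by_cases hgood : (∀ t ∈ Finset.Icc 1 T, ∀ i,
      |deviation I (fun s => (Y s).1 i) (fun s => E.mu s i) w₁ t i| + 1
        ≤ √(2 * L₁ * (plays I w₁ t i + 1))) ∧
      (∀ t ∈ Finset.Icc 1 T, ∀ j i,
      |deviation I (fun s => (Y s).2 j i) (fun s => E.C s j i) w₂ t i| + 1
        ≤ √(2 * L₂ * (plays I w₂ t i + 1)))
  · have key : ∑ t ∈ Finset.Icc 1 T, ∑ i, E.mu t i * xs t i ≤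
        ∑ t ∈ Finset.Icc 1 T, act (b * T) Y I t * ∑ i, E.mu t i * p t i
        + 2 * (w₁ * V1 E.mu T) + d * (w₂ * V2 E.C T) / b + 2 * R₁
        + 1 / b * (O + w₂ * V2 E.C T + 2 * R₂) := BwK.sum_value_le hb E.mu_mem E.C_mem (fun t ht i => (hr t ht i).1)
      (fun t ht j i => (hc t ht j i).1) hc0 hopt hxs hgood.1 hgood.2 hO0
      (fun j => overspend_le_overspendBound hT L₂ j ω)
    rw [e2] at key
    rw [hflu]
    linarith
  -- If an interval fails, the left side is at most `T` and some failure term is at least `1`. The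
  -- remaining terms are nonnegative, or combine to a nonnegative quantity with the reward.
  · have hval : ∑ t ∈ Finset.Icc 1 T, ∑ i, E.mu t i * xs t i ≤ T := by
      refine (Finset.sum_le_sum fun t ht =>
        sum_mul_le_of_mem_stdSimplex (hxs t ht).1 fun i => (E.mu_mem t i).2).trans ?_
      simp
    have hY0 : 0 ≤ ∑ t ∈ Finset.Icc 1 T, act (b * T) Y I t * ∑ i, E.mu t i * p t i := by
      refine Finset.sum_nonneg fun t ht => ?_
      by_cases ha : Active (b * T) Y I t
      · exact mul_nonneg (act_nonneg _ _ _ _) (Finset.sum_nonneg fun i _ =>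
          mul_nonneg (E.mu_mem t i).1 ((hopt t ht ha).1.1.1 i))
      · simp [act, ha]
    have hfail : 1 ≤ F₁ ∨ 1 ≤ F₂ := by
      rw [not_and_or] at hgood
      push Not at hgood
      rcases hgood with ⟨t, ht, i, hi⟩ | ⟨t, ht, j, i, hi⟩
      · left
        refine (one_le_failure hL₁ ht hi).trans ?_
        exact Finset.single_le_sum (f := fun i => failure I (fun s => (Y s).1 i)
          (fun s => E.mu s i) w₁ T L₁ i) (fun _ _ => failure_nonneg _ _ _ _ _ _ _)
          (Finset.mem_univ i)
      · right
        refine (one_le_failure hL₂ ht hi).trans ?_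
        refine le_trans ?_ (Finset.single_le_sum (f := fun j => ∑ i, failure I
          (fun s => (Y s).2 j i) (fun s => E.C s j i) w₂ T L₂ i) (fun _ _ =>
          Finset.sum_nonneg fun _ _ => failure_nonneg _ _ _ _ _ _ _) (Finset.mem_univ j))
        exact Finset.single_le_sum (f := fun i => failure I (fun s => (Y s).2 j i)
          (fun s => E.C s j i) w₂ T L₂ i) (fun _ _ => failure_nonneg _ _ _ _ _ _ _)
          (Finset.mem_univ i)
    have hTF : (T : ℝ) ≤ T * F₁ + T * F₂ := by
      rcases hfail with h1 | h1
      · have := mul_le_mul_of_nonneg_left h1 hT0; linarith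
      · have := mul_le_mul_of_nonneg_left h1 hT0; linarith
    rw [hflu]
    have hV₁ := V1_nonneg E.mu T
    have hV₂ := V2_nonneg E.C T
    have h1 : 0 ≤ 2 * (w₁ * V1 E.mu T) := by positivity
    have h2 : 0 ≤ d * (w₂ * V2 E.C T) / b := by positivity
    have h3 : 0 ≤ 1 / b * (w₂ * V2 E.C T) := by positivity
    have h4 : 0 ≤ 1 / b * O := by positivity
    have h5 : 0 ≤ 2 / b * R₂ := by positivity
    linarith

/-! ### Taking expectations and tracking constants -/

lemma two_le_log {a : ℝ} (ha : 12 ≤ a) : 2 ≤ Real.log a := by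
  rw [Real.le_log_iff_exp_le (by linarith)]
  have h1 : Real.exp 2 = Real.exp 1 ^ 2 := by rw [← Real.exp_nat_mul]; norm_num
  have h2 := Real.exp_one_lt_d9
  have h3 := Real.exp_pos 1
  rw [h1]
  nlinarith

/-- The factor `√e` lost in the deviation bound is at most `2`. -/
lemma exp_half_sub_log_le {a : ℝ} (ha : 0 < a) : Real.exp (1 / 2 - Real.log a) ≤ 2 / a := by
  rw [Real.exp_sub, Real.exp_log ha]
  gcongr
  have h1 : Real.exp (1 / 2) ^ 2 = Real.exp 1 := by rw [← Real.exp_nat_mul]; norm_num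
  refine le_of_sq_le_sq ?_ (by norm_num)
  rw [h1]
  linarith [Real.exp_one_lt_d9]

lemma IsRun.sum_value_le [IsProbabilityMeasure P] (h : IsRun E b T w₁ w₂ P y arm x)
    (hb : 0 < b) (hT : 1 ≤ T) (hd : 1 ≤ d) (hw₁ : 1 ≤ w₁) (hw₂ : 1 ≤ w₂)
    {xs : ℕ → Fin m → ℝ} (hxs : ∀ t ∈ Finset.Icc 1 T, StepFeasible (E.C t) b (xs t)) :
    ∑ t ∈ Finset.Icc 1 T, ∑ i, E.mu t i * xs t i ≤
      ∫ ω, totalReward (b * T) T (fun s => y s ω) (fun s => arm s ω) ∂P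
      + 2 * (2 * √2 * (√(m * Real.log (12 * m * T ^ 3) * w₁) * ((T - 1) / w₁ + 1 : ℕ)))
      + 1 / b * (√T * (Real.log (12 * m * d * T ^ 3) + 1 / 6))
      + 2 / b * (2 * √2 * (√(m * Real.log (12 * m * d * T ^ 3) * w₂) * ((T - 1) / w₂ + 1 : ℕ)))
      + 1 / 3 + 1 / 3
      + (1 + 2 * (w₁ * V1 E.mu T) + d * (w₂ * V2 E.C T) / b + 1 / b * (w₂ * V2 E.C T)) := by
  have hm : 1 ≤ m := E.null.pos
  have hm' : (1 : ℝ) ≤ m := by exact_mod_cast hm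
  have hd' : (1 : ℝ) ≤ d := by exact_mod_cast hd
  have hT' : (1 : ℝ) ≤ T := by exact_mod_cast hT
  have hT3 : (1 : ℝ) ≤ (T : ℝ) ^ 3 := one_le_pow₀ hT'
  have ha₁ : (12 : ℝ) ≤ 12 * m * T ^ 3 := by
    nlinarith [mul_le_mul hm' hT3 zero_le_one (by linarith)]
  have hmd : (1 : ℝ) ≤ m * d := by nlinarith
  have ha₂ : (12 : ℝ) ≤ 12 * m * d * T ^ 3 := by
    nlinarith [mul_le_mul hmd hT3 zero_le_one (by linarith)]
  have hL₁ : 0 ≤ Real.log (12 * m * T ^ 3) := by linarith [two_le_log ha₁]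
  have hL₂ : 0 ≤ Real.log (12 * m * d * T ^ 3) := by linarith [two_le_log ha₂]
  have hae := h.ae_sum_value_le hb hT hL₁ hL₂ hxs
  have i0 := h.integrable_totalReward (b * T)
  have i1 : Integrable (fun ω => ∑ t ∈ Finset.Icc 1 T,
      IsRun.fluctuation P E (b * T) y arm (fun i o => o.1 i) t ω) P :=
    integrable_finsetSum _ fun t ht => (h.aebdd_fluctuation ht (E.reward_ae t)).integrable
      (h.measurable_fluctuation measurable_reward)
  have z1 := h.integral_sum_fluctuation (g := fun i o => o.1 i) measurable_reward
    (fun t => E.reward_ae t) (b * T)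
  have i2 := (h.integrable_totalRadius hL₁ w₁ (b * T)).const_mul 2
  have z2 := h.integral_totalRadius_le hL₁ hw₁ hT (b * T)
  have i3 := (h.integral_overspendBound_le hT (Real.log (12 * m * d * T ^ 3))).1.const_mul (1 / b)
  have z3 := (h.integral_overspendBound_le hT (Real.log (12 * m * d * T ^ 3))).2
  have i4 := (h.integrable_totalRadius hL₂ w₂ (b * T)).const_mul (2 / b)
  have z4 := h.integral_totalRadius_le hL₂ hw₂ hT (b * T)
  have f₁ := fun i => h.integral_failure_le (measurable_reward i) (fun t => E.reward_ae t i) w₁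
    (Real.log (12 * m * T ^ 3)) i
  have f₂ := fun j i => h.integral_failure_le (measurable_consumption j i)
    (fun t => E.consumption_ae t j i) w₂ (Real.log (12 * m * d * T ^ 3)) i
  have i5 := (integrable_finsetSum Finset.univ fun i _ => (f₁ i).1).const_mul (T : ℝ)
  have i6 := (integrable_finsetSum Finset.univ fun j _ =>
    integrable_finsetSum Finset.univ fun i _ => (f₂ j i).1).const_mul (T : ℝ)
  have i7 : Integrable (fun _ : Ω => 1 + 2 * (w₁ * V1 E.mu T) + d * (w₂ * V2 E.C T) / b
    + 1 / b * (w₂ * V2 E.C T)) P := integrable_const _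
  have hint := integral_mono_ae (integrable_const _)
    (((((((i0.sub i1).add i2).add i3).add i4).add i5).add i6).add i7) hae
  rw [integral_add' ((((((i0.sub i1).add i2).add i3).add i4).add i5).add i6) i7,
    integral_add' (((((i0.sub i1).add i2).add i3).add i4).add i5) i6,
    integral_add' ((((i0.sub i1).add i2).add i3).add i4) i5,
    integral_add' (((i0.sub i1).add i2).add i3) i4,
    integral_add' ((i0.sub i1).add i2) i3, integral_add' (i0.sub i1) i2, integral_sub' i0 i1, z1,
    integral_const_mul, integral_const_mul, integral_const_mul, integral_const_mul,
    integral_const_mul, integral_finsetSum _ fun i _ => (f₁ i).1,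
    integral_finsetSum _ fun j _ => integrable_finsetSum Finset.univ fun i _ => (f₂ j i).1,
    integral_const, integral_const] at hint
  simp only [probReal_univ, one_smul] at hint
  -- The logarithmic level is tuned for this: `T * m * (2 * T ^ 2) * 2 / (12 * m * T ^ 3) = 1 / 3`.
  have hf₁ : T * ∑ i, ∫ ω, failure (fun s => arm s ω) (fun s => (y s ω).1 i)
      (fun s => ∫ o, o.1 i ∂(E.law s)) w₁ T (Real.log (12 * m * T ^ 3)) i ∂P ≤ 1 / 3 := by
    calc _ ≤ (T : ℝ) * ∑ _i : Fin m, 2 * (T : ℝ) ^ 2 * (2 / (12 * m * T ^ 3)) := by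
          gcongr with i
          refine (f₁ i).2.trans ?_
          gcongr
          exact exp_half_sub_log_le (by linarith)
      _ = 1 / 3 := by
          simp only [Finset.sum_const, Finset.card_univ, Fintype.card_fin, nsmul_eq_mul]
          field_simp
          norm_num
  have hf₂ : T * ∑ j, ∫ ω, ∑ i, failure (fun s => arm s ω) (fun s => (y s ω).2 j i)
      (fun s => ∫ o, o.2 j i ∂(E.law s)) w₂ T (Real.log (12 * m * d * T ^ 3)) i ∂P ≤ 1 / 3 := by
    calc _ ≤ (T : ℝ) * ∑ _j : Fin d, ∑ _i : Fin m,
            2 * (T : ℝ) ^ 2 * (2 / (12 * m * d * T ^ 3)) := by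
          gcongr with j
          rw [integral_finsetSum _ fun i _ => (f₂ j i).1]
          gcongr with i
          refine (f₂ j i).2.trans ?_
          gcongr
          exact exp_half_sub_log_le (by linarith)
      _ = 1 / 3 := by
          simp only [Finset.sum_const, Finset.card_univ, Fintype.card_fin, nsmul_eq_mul]
          field_simp
          norm_num
  have hover : 1 / b * ∫ ω, overspendBound P E b T (Real.log (12 * m * d * T ^ 3)) y arm ω ∂P
      ≤ 1 / b * (√T * (Real.log (12 * m * d * T ^ 3) + 1 / 6)) := by
    refine mul_le_mul_of_nonneg_left (z3.trans ?_) (by positivity)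
    refine mul_le_mul_of_nonneg_left (add_le_add_right ?_ _) (Real.sqrt_nonneg _)
    calc d * Real.exp (1 / 2 - Real.log (12 * m * d * T ^ 3)) ≤ d * (2 / (12 * m * d * T ^ 3)) := by
          gcongr
          exact exp_half_sub_log_le (by linarith)
      _ = 1 / 6 * (1 / (m * T ^ 3)) := by field_simp; norm_num
      _ ≤ 1 / 6 * 1 := by
          gcongr
          rw [div_le_one (by positivity)]
          nlinarith
      _ = 1 / 6 := by norm_num
  have hr₂ := mul_le_mul_of_nonneg_left z4 (show 0 ≤ 2 / b by positivity)
  have hr₁ := mul_le_mul_of_nonneg_left z2 (show (0 : ℝ) ≤ 2 by norm_num)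
  simp only [Env.mu] at hint ⊢
  linarith

/-- The regret bound, before it is weakened to the forms of the theorem. -/
lemma IsRun.regret_le [IsProbabilityMeasure P] {q : Fin d → ℝ} {qs : ℕ → Fin d → ℝ} {αs : ℕ → ℝ}
    (hd : 1 ≤ d) (hT : 1 ≤ T) (hb : 0 < b)
    (h : IsRun E b T (window m T (V1 E.mu T) (Real.log (12 * m * T ^ 3)))
      (window m T (V2 E.C T) (Real.log (12 * m * d * T ^ 3))) P y arm x)
    (hq : ∀ t ∈ Finset.Icc 1 T, StepDualOptimal (E.mu t) (E.C t) b (qs t) (αs t)) :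
    regret E (b * T) T P y arm ≤ 5 / 3
      + 10 * rate m T (V1 E.mu T) (Real.log (12 * m * T ^ 3))
      + 4 * (√(2 * m * T) * √(Real.log (12 * m * T ^ 3)))
      + 1 / b * (2 * (√T * Real.log (12 * m * d * T ^ 3))
        + (2 * d + 8) * rate m T (V2 E.C T) (Real.log (12 * m * d * T ^ 3))
        + 4 * (√(2 * m * T) * √(Real.log (12 * m * d * T ^ 3))))
      + 2 * (W1 E.mu T + qbar T q qs * W2 E.C T) := by
  have hm : 1 ≤ m := E.null.pos
  have hm' : (1 : ℝ) ≤ m := by exact_mod_cast hm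
  have hd' : (1 : ℝ) ≤ d := by exact_mod_cast hd
  have hT' : (1 : ℝ) ≤ T := by exact_mod_cast hT
  have hT3 : (1 : ℝ) ≤ (T : ℝ) ^ 3 := one_le_pow₀ hT'
  have ha₁ : (12 : ℝ) ≤ 12 * m * T ^ 3 := by
    nlinarith [mul_le_mul hm' hT3 zero_le_one (by linarith)]
  have hmd : (1 : ℝ) ≤ m * d := by nlinarith
  have ha₂ : (12 : ℝ) ≤ 12 * m * d * T ^ 3 := by
    nlinarith [mul_le_mul hmd hT3 zero_le_one (by linarith)]
  set L₁ := Real.log (12 * m * T ^ 3) with hL₁def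
  set L₂ := Real.log (12 * m * d * T ^ 3) with hL₂def
  have hL₁ : 2 ≤ L₁ := two_le_log ha₁
  have hL₂ : 2 ≤ L₂ := two_le_log ha₂
  have hV₁ := V1_nonneg E.mu T
  have hV₂ := V2_nonneg E.C T
  obtain ⟨u₁, s₁⟩ := window_bounds hm hT hV₁ (E.V1_le T) (by linarith : 1 ≤ L₁)
  obtain ⟨u₂, s₂⟩ := window_bounds hm hT hV₂ (E.V2_le hd T) (by linarith : 1 ≤ L₂)
  have hw₁ := one_le_window hm hT hV₁ (by linarith : 1 ≤ L₁)
  have hw₂ := one_le_window hm hT hV₂ (by linarith : 1 ≤ L₂)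
  set w₁ := window m T (V1 E.mu T) L₁
  set w₂ := window m T (V2 E.C T) L₂
  set A₁ := rate m T (V1 E.mu T) L₁
  set A₂ := rate m T (V2 E.C T) L₂
  choose xs hxs using fun t => exists_stepOptimal (E.mu t) (E.C t) hb.le (E.C_null t)
  have hval := h.sum_value_le hb hT hd hw₁ hw₂ (xs := xs) fun t _ => (hxs t).1
  rw [← hL₁def, ← hL₂def] at hval
  -- Each dual optimum is at most the primal optimum, by comparison with the dual point supplied by
  -- strong duality.
  have hdyn : dynLP E.mu E.C T (b * T) ≤ ∑ t ∈ Finset.Icc 1 T, ∑ i, E.mu t i * xs t i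
      + 2 * (W1 E.mu T + qbar T q qs * W2 E.C T) := by
    refine (dynLP_le hT hb.le E.C_null (fun t ht => (hq t ht).1)
      (fun t ht => norm_le_qbar (q := q) ht)).trans ?_
    refine add_le_add_left (Finset.sum_le_sum fun t ht => ?_) _
    obtain ⟨q', α', hf, hle⟩ := (hxs t).exists_dual hb (E.C_null t)
    exact ((hq t ht).2 q' α' hf).trans hle
  have hsq : ∀ L : ℝ, √2 * √(m * L * T) = √(2 * m * T) * √L := fun L => by
    rw [← Real.sqrt_mul (by norm_num), ← Real.sqrt_mul (by positivity)]
    congr 1; ring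
  have h2 : 4 * √2 ≤ 6 := by
    have : √2 ≤ 3 / 2 := Real.sqrt_le_iff.2 ⟨by norm_num, by norm_num⟩
    linarith
  have hA₁ : 0 ≤ A₁ := rate_nonneg _ _ hV₁ (by linarith)
  have hA₂ : 0 ≤ A₂ := rate_nonneg _ _ hV₂ (by linarith)
  have r₁ : 2 * (2 * √2 * (√(m * L₁ * w₁) * ((T - 1) / w₁ + 1 : ℕ)))
      ≤ 6 * A₁ + 4 * (√(2 * m * T) * √L₁) := by
    rw [← hsq]
    have := mul_le_mul_of_nonneg_left s₁ (show 0 ≤ 4 * √2 by positivity)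
    have := mul_le_mul_of_nonneg_right h2 hA₁
    linarith
  have r₂ : 2 * (2 * √2 * (√(m * L₂ * w₂) * ((T - 1) / w₂ + 1 : ℕ)))
      ≤ 6 * A₂ + 4 * (√(2 * m * T) * √L₂) := by
    rw [← hsq]
    have := mul_le_mul_of_nonneg_left s₂ (show 0 ≤ 4 * √2 by positivity)
    have := mul_le_mul_of_nonneg_right h2 hA₂
    linarith
  have r₃ : √T * (L₂ + 1 / 6) ≤ 2 * (√T * L₂) := by
    have := mul_le_mul_of_nonneg_left (show L₂ + 1 / 6 ≤ 2 * L₂ by linarith)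
      (Real.sqrt_nonneg (T : ℝ))
    linarith
  -- Of the drift, `d` parts come from shrinking towards the null arm and one from the budget. With
  -- the `6` of `r₂` this gives the coefficient `2 * d + 8`.
  have r₄ : (d + 1) * (w₂ * V2 E.C T) ≤ (2 * d + 2) * A₂ := by
    have := mul_le_mul_of_nonneg_left u₂ (show (0 : ℝ) ≤ d + 1 by positivity)
    linarith
  have hcons : 1 / b * (√T * (L₂ + 1 / 6)) + 2 / b *
      (2 * √2 * (√(m * L₂ * w₂) * ((T - 1) / w₂ + 1 : ℕ)))
      + d * (w₂ * V2 E.C T) / b + 1 / b * (w₂ * V2 E.C T)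
      ≤ 1 / b * (2 * (√T * L₂) + (2 * d + 8) * A₂ + 4 * (√(2 * m * T) * √L₂)) := by
    have e : 1 / b * (√T * (L₂ + 1 / 6)) + 2 / b *
        (2 * √2 * (√(m * L₂ * w₂) * ((T - 1) / w₂ + 1 : ℕ)))
        + d * (w₂ * V2 E.C T) / b + 1 / b * (w₂ * V2 E.C T)
        = 1 / b * (√T * (L₂ + 1 / 6)
          + 2 * (2 * √2 * (√(m * L₂ * w₂) * ((T - 1) / w₂ + 1 : ℕ)))
          + (d + 1) * (w₂ * V2 E.C T)) := by ring
    rw [e]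
    refine mul_le_mul_of_nonneg_left ?_ (by positivity)
    linarith
  rw [regret]
  linarith

/-- Passing from the regret bound to the explicit bound for `b ≤ 1`. -/
lemma le_explicit_of_le_one {r b W A₁ A₂ S₁ S₂ l₁ l₂ d : ℝ} (hb : 0 < b) (hb1 : b ≤ 1) (hl₁ : 2 ≤ l₁)
    (hl₂ : 0 ≤ l₂) (hA₁ : 0 ≤ A₁) (hA₂ : 0 ≤ A₂) (hS₂ : 0 ≤ S₂) (hS : S₁ ≤ S₂)
    (h : r ≤ 5 / 3 + 10 * A₁ + 4 * S₁ + 1 / b * (2 * l₂ + (2 * d + 8) * A₂ + 4 * S₂) + 2 * W) :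
    r ≤ 1 / b * (4 * l₂ + (14 + 2 * d) * A₂ + 8 * S₂ + 1) + 4 * l₁ + 16 * A₁ + 2 * W := by
  -- For `b ≤ 1` the reward width fits under the consumption width, doubling its coefficient from
  -- `4` to `8`.
  have h1 : S₁ ≤ 1 / b * S₂ := hS.trans (le_mul_of_one_le_left hS₂ ((one_le_div hb).2 hb1))
  have h2 : 1 / b * (2 * l₂ + (2 * d + 8) * A₂ + 8 * S₂)
      ≤ 1 / b * (4 * l₂ + (14 + 2 * d) * A₂ + 8 * S₂ + 1) := by
    refine mul_le_mul_of_nonneg_left ?_ (by positivity)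
    linarith
  linarith

/-- Passing from the regret bound to the explicit bound for every `b`. -/
lemma le_explicit {r b W A₁ A₂ S₁ S₂ l₁ l₂ d : ℝ} (hb : 0 < b) (hl₁ : 2 ≤ l₁)
    (hl₂ : 0 ≤ l₂) (hA₁ : 0 ≤ A₁) (hA₂ : 0 ≤ A₂) (hS₁ : 0 ≤ S₁) (hS₂ : 0 ≤ S₂)
    (h : r ≤ 5 / 3 + 10 * A₁ + 4 * S₁ + 1 / b * (2 * l₂ + (2 * d + 8) * A₂ + 4 * S₂) + 2 * W) :
    r ≤ 1 / b * (4 * l₂ + (14 + 2 * d) * A₂ + 8 * S₂ + 1) + 4 * l₁ + 16 * A₁ + 2 * W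
      + 8 * S₁ := by
  have h2 : 1 / b * (2 * l₂ + (2 * d + 8) * A₂ + 4 * S₂)
      ≤ 1 / b * (4 * l₂ + (14 + 2 * d) * A₂ + 8 * S₂ + 1) := by
    refine mul_le_mul_of_nonneg_left ?_ (by positivity)
    linarith
  linarith

lemma rpow_third_le {L : ℝ} (hL : 1 ≤ L) : L ^ (1 / 3 : ℝ) ≤ L := by
  conv_rhs => rw [← Real.rpow_one L]
  exact Real.rpow_le_rpow_of_exponent_le hL (by norm_num)

/-- Passing from the regret bound to the bound with a universal constant. -/
lemma le_universal {r b W a₁ a₂ L₁ L₂ d m T : ℝ} (hb : 0 < b) (hm : 1 ≤ m) (hd : 1 ≤ d)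
    (hT : 1 ≤ T) (hL₁ : 2 ≤ L₁) (hL₁₂ : L₁ ≤ L₂) (ha₁ : 0 ≤ a₁) (ha₂ : 0 ≤ a₂) (hW : 0 ≤ W)
    (h : r ≤ 5 / 3 + 10 * (a₁ * L₁ ^ (1 / 3 : ℝ)) + 4 * (√(2 * m * T) * √L₁)
      + 1 / b * (2 * (√T * L₂) + (2 * d + 8) * (a₂ * L₂ ^ (1 / 3 : ℝ))
        + 4 * (√(2 * m * T) * √L₂)) + 2 * W) :
    r ≤ 16 * L₂ * (max 1 (1 / b) * √(m * T) + a₁ + 1 / b * (d * a₂) + W) := by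
  have hL₂ : 2 ≤ L₂ := hL₁.trans hL₁₂
  have hb' : 0 < 1 / b := by positivity
  have hM1 : 1 ≤ max 1 (1 / b) := le_max_left _ _
  have hMb : 1 / b ≤ max 1 (1 / b) := le_max_right _ _
  have hTs : √T ≤ √(m * T) := Real.sqrt_le_sqrt (by nlinarith)
  have hs1 : 1 ≤ √(m * T) := (Real.one_le_sqrt.2 hT).trans hTs
  have hSs : √(2 * m * T) ≤ 3 / 2 * √(m * T) := by
    rw [mul_assoc, Real.sqrt_mul (by norm_num)]
    gcongr
    exact Real.sqrt_le_iff.2 ⟨by norm_num, by norm_num⟩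
  have hsq : √L₂ ≤ L₂ := Real.sqrt_le_iff.2 ⟨by linarith, le_self_pow₀ (by linarith) two_ne_zero⟩
  generalize √(2 * m * T) = S at *
  generalize √(m * T) = s at *
  generalize max 1 (1 / b) = M at *
  have hS : √L₁ ≤ L₂ := (Real.sqrt_le_sqrt hL₁₂).trans hsq
  have hsL : L₂ ≤ s * L₂ := le_mul_of_one_le_left (by linarith) hs1
  have hMsL : s * L₂ ≤ M * (s * L₂) := le_mul_of_one_le_left (by linarith) hM1
  have hbsL : 1 / b * (s * L₂) ≤ M * (s * L₂) := mul_le_mul_of_nonneg_right hMb (by linarith)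
  have hTsL : √T * L₂ ≤ s * L₂ := mul_le_mul_of_nonneg_right hTs (by linarith)
  have hSL₁ : S * √L₁ ≤ 3 / 2 * s * L₂ := mul_le_mul hSs hS (Real.sqrt_nonneg _) (by linarith)
  have hSL₂ : S * √L₂ ≤ 3 / 2 * s * L₂ := mul_le_mul hSs hsq (Real.sqrt_nonneg _) (by linarith)
  have t₁ : a₁ * L₁ ^ (1 / 3 : ℝ) ≤ a₁ * L₂ :=
    mul_le_mul_of_nonneg_left ((rpow_third_le (by linarith)).trans hL₁₂) ha₁
  have t₂ : (2 * d + 8) * (a₂ * L₂ ^ (1 / 3 : ℝ)) ≤ 10 * d * (a₂ * L₂) :=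
    mul_le_mul (by linarith) (mul_le_mul_of_nonneg_left (rpow_third_le (by linarith)) ha₂)
      (mul_nonneg ha₂ (Real.rpow_nonneg (by linarith) _)) (by linarith)
  have t₃ : 1 / b * (2 * (√T * L₂) + (2 * d + 8) * (a₂ * L₂ ^ (1 / 3 : ℝ)) + 4 * (S * √L₂))
      ≤ 1 / b * (8 * (s * L₂) + 10 * d * (a₂ * L₂)) :=
    mul_le_mul_of_nonneg_left (by linarith) hb'.le
  have t₄ : W * 2 ≤ W * L₂ := mul_le_mul_of_nonneg_left hL₂ hW
  have t₅ : 0 ≤ a₁ * L₂ := mul_nonneg ha₁ (by linarith)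
  have t₆ : 0 ≤ 1 / b * (d * (a₂ * L₂)) :=
    mul_nonneg hb'.le (mul_nonneg (by linarith) (mul_nonneg ha₂ (by linarith)))
  -- The constant `16` is set by the `√(m * T)` terms: `5 / 6` from the additive constant, `6` from
  -- the rewards and `8` from the consumption.
  have e₁ : 16 * L₂ * (M * s + a₁ + 1 / b * (d * a₂) + W)
      = 16 * (M * (s * L₂)) + 16 * (a₁ * L₂) + 16 * (1 / b * (d * (a₂ * L₂))) + 16 * (W * L₂) := by
    ring
  have e₂ : 1 / b * (8 * (s * L₂) + 10 * d * (a₂ * L₂))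
      = 8 * (1 / b * (s * L₂)) + 10 * (1 / b * (d * (a₂ * L₂))) := by ring
  rw [e₂] at t₃
  rw [e₁]
  linarith

end BwK

theorem theorem1 :
    ∃ K : ℝ, 0 < K ∧
      ∀ (m d T : ℕ) (b : ℝ) (E : BwK.Env m d) (Ω : Type*) (_ : MeasurableSpace Ω)
        (P : MeasureTheory.Measure Ω) (_ : MeasureTheory.IsProbabilityMeasure P)
        (y : ℕ → Ω → BwK.Outcome m d) (arm : ℕ → Ω → Fin m) (x : ℕ → Ω → Fin m → ℝ)
        (q : Fin d → ℝ) (α : ℕ → ℝ) (qs : ℕ → Fin d → ℝ) (αs : ℕ → ℝ),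
        1 ≤ d → 1 ≤ T → 0 < b →
        BwK.IsRun E b T
          (BwK.window m T (BwK.V1 E.mu T) (Real.log (12 * m * T ^ 3)))
          (BwK.window m T (BwK.V2 E.C T) (Real.log (12 * m * d * T ^ 3))) P y arm x →
        BwK.DynDualOptimal E.mu E.C T b q α →
        (∀ t ∈ Finset.Icc 1 T, BwK.StepDualOptimal (E.mu t) (E.C t) b (qs t) (αs t)) →
        (b ≤ 1 →
          BwK.regret E (b * T) T P y arm ≤
            BwK.regretBound m d T b (BwK.V1 E.mu T) (BwK.V2 E.C T) (BwK.W1 E.mu T)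
              (BwK.W2 E.C T) (BwK.qbar T q qs)) ∧
        BwK.regret E (b * T) T P y arm ≤
            BwK.regretBound m d T b (BwK.V1 E.mu T) (BwK.V2 E.C T) (BwK.W1 E.mu T)
              (BwK.W2 E.C T) (BwK.qbar T q qs)
            + 8 * √(2 * m * T) * √(Real.log (12 * m * T ^ 3)) ∧
        BwK.regret E (b * T) T P y arm ≤
            K * Real.log (12 * m * d * T ^ 3) *
              (max 1 (1 / b) * √(m * T)
                + (m : ℝ) ^ (1 / 3 : ℝ) * BwK.V1 E.mu T ^ (1 / 3 : ℝ) * (T : ℝ) ^ (2 / 3 : ℝ)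
                + 1 / b * ((m : ℝ) ^ (1 / 3 : ℝ) * d * BwK.V2 E.C T ^ (1 / 3 : ℝ)
                    * (T : ℝ) ^ (2 / 3 : ℝ))
                + BwK.W1 E.mu T + BwK.qbar T q qs * BwK.W2 E.C T) := by
  refine ⟨16, by norm_num, ?_⟩
  intro m d T b E Ω _ P _ y arm x q α qs αs hd hT hb hrun _ hq
  have hreg := hrun.regret_le hd hT hb (q := q) hq
  have hm' : (1 : ℝ) ≤ m := by exact_mod_cast (E.null.pos : 1 ≤ m)
  have hd' : (1 : ℝ) ≤ d := by exact_mod_cast hd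
  have hT' : (1 : ℝ) ≤ T := by exact_mod_cast hT
  have hT3 : (1 : ℝ) ≤ (T : ℝ) ^ 3 := one_le_pow₀ hT'
  have ha₁ : (12 : ℝ) ≤ 12 * m * T ^ 3 := by
    nlinarith [mul_le_mul hm' hT3 zero_le_one (by linarith)]
  have hL₁ := BwK.two_le_log ha₁
  have hL₁₂ : Real.log (12 * m * T ^ 3) ≤ Real.log (12 * m * d * T ^ 3) := by
    refine Real.log_le_log (by linarith) ?_
    have : (12 * m * T ^ 3 : ℝ) * 1 ≤ 12 * m * T ^ 3 * d := by gcongr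
    linarith
  have hV₁ := BwK.V1_nonneg E.mu T
  have hV₂ := BwK.V2_nonneg E.C T
  have hW : 0 ≤ BwK.W1 E.mu T + BwK.qbar T q qs * BwK.W2 E.C T :=
    add_nonneg (BwK.W1_nonneg _ _) (mul_nonneg ((norm_nonneg q).trans (le_max_left _ _))
      (BwK.W2_nonneg _ _))
  have hbound : BwK.regretBound m d T b (BwK.V1 E.mu T) (BwK.V2 E.C T) (BwK.W1 E.mu T)
      (BwK.W2 E.C T) (BwK.qbar T q qs)
      = 1 / b * (4 * (√T * Real.log (12 * m * d * T ^ 3))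
          + (14 + 2 * d) * BwK.rate m T (BwK.V2 E.C T) (Real.log (12 * m * d * T ^ 3))
          + 8 * (√(2 * m * T) * √(Real.log (12 * m * d * T ^ 3))) + 1)
        + 4 * (√T * Real.log (12 * m * T ^ 3))
        + 16 * BwK.rate m T (BwK.V1 E.mu T) (Real.log (12 * m * T ^ 3))
        + 2 * (BwK.W1 E.mu T + BwK.qbar T q qs * BwK.W2 E.C T) := by
    rw [BwK.regretBound, BwK.rate, BwK.rate]
    ring
  rw [hbound]
  clear hbound hrun hq
  generalize Real.log (12 * m * T ^ 3) = L₁ at *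
  generalize Real.log (12 * m * d * T ^ 3) = L₂ at *
  have hA₁ := BwK.rate_nonneg m T hV₁ (L := L₁) (by linarith)
  have hA₂ := BwK.rate_nonneg m T hV₂ (L := L₂) (by linarith)
  have hl₁ : 2 ≤ √(T : ℝ) * L₁ := by nlinarith [Real.one_le_sqrt.2 hT']
  have hl₂ : 0 ≤ √(T : ℝ) * L₂ := mul_nonneg (Real.sqrt_nonneg _) (by linarith)
  have hS : √(2 * m * T) * √L₁ ≤ √(2 * m * T) * √L₂ :=
    mul_le_mul_of_nonneg_left (Real.sqrt_le_sqrt hL₁₂) (Real.sqrt_nonneg _)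
  have hS₁ : 0 ≤ √(2 * m * T) * √L₁ := by positivity
  refine ⟨fun hb1 => ?_, ?_, ?_⟩
  · exact BwK.le_explicit_of_le_one hb hb1 hl₁ hl₂ hA₁ hA₂ (hS₁.trans hS) hS hreg
  · refine (BwK.le_explicit hb hl₁ hl₂ hA₁ hA₂ hS₁ (hS₁.trans hS) hreg).trans (le_of_eq ?_)
    ring
  · refine (BwK.le_universal hb hm' hd' hT' hL₁ hL₁₂ (by positivity) (by positivity) hW
      hreg).trans (le_of_eq ?_)
    ring
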